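/- **Notation.** Let $q\in\mathbb C$ with $0<|q|<1$. Put $(x;q)_\infty=\prod_{k\ge0}(1-xq^k)$, $j(z;q)=(z;q)_\infty(q/z;q)_\infty(q;q)_\infty$, $j(z_1,z_2;q)=j(z_1;q)j(z_2;q)$, $J_m=(q^m;q^m)_\infty$, and $$m(x,q,z)=\frac1{j(z;q)}\sum_{r\in\mathbb Z}\frac{(-1)^rq^{\binom r2}z^r}{1-q^{r-1}xz},\qquad \Delta(x,z_1,z_0;q)=\frac{z_0J_1^3\,j(z_1/z_0;q)\,j(xz_0z_1;q)}{j(z_0;q)\,j(z_1;q)\,j(xz_0;q)\,j(xz_1;q)},$$ $$\Psi_k^n(x,z,z';q)=-\frac{x^kz^{k+1}J_{n^2}^3}{j(z;q)\,j(z';q^{n^2})}\sum_{t=0}^{n-1}\frac{q^{\binom{t+1}2+kt}(-z)^t\,j\bigl(-q^{\binom{n+1}2+nk+nt}(-z)^n/z',\;q^{nt}(xz)^nz';\;q^{n^2}\bigr)}{j\bigl(-q^{\binom n2-nk}(-x)^nz',\;q^{nt}(xz)^n;\;q^{n^2}\bigr)}.$$ (In $\Delta(\dots;Q)$ and $\Psi_k^n(\dots;Q)$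 the base $q$ is replaced by $Q$ throughout, also in $J_m$.) For odd $d\ge1$ let $\zeta_d$ be a primitive $d$-th root of unity, let $z^{1/d}$ be any $d$-th root of $z$, with $z^{s/d}=(z^{1/d})^s$ for $s\in\mathbb Z$, and put $$\Lambda(d,z,z_0,z')=(-1)^{\frac{d+1}2}q^{-\frac{(d-1)^2}4}z^{\frac{d-1}d}\Bigl(\Psi_{\frac{d-1}2}^{d}(z^{-\frac2d}q^d,z_0,z';q^2)+\frac1d\sum_{t=0}^{d-1}\zeta_d^{-t}\Delta\bigl(\zeta_d^{-2t}z^{-\frac2d}q^d,\zeta_d^tz^{\frac1d}q^{-\frac{d-1}2},z_0;q^2\bigr)\Bigr).$$ Define $\overline N_d(m,n)$ by the expansion, as a power series in $q$ with coefficients in $\mathbb Z[z,z^{-1}]$, $$\sum_{m\in\mathbb Z,\,n\ge0}\overline N_d(m,n)z^mq^n=\frac{(-q;q)_\infty}{(q;q)_\infty}\Bigl(1+2\sum_{n\ge1}\frac{(1-z)(1-z^{-1})(-1)^nq^{n^2+dn}}{(1-zq^{dn})(1-z^{-1}q^{dn})}\Bigr),$$ let $\overline p(n)$ be the number of overpartitions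 of $n$ (partitions of $n$ in which the first occurrence of each distinct part may be overlined), and put $$\overline D_d(a,M)=\sum_{n\ge0}\Bigl(\sum_{k\equiv a\,(\mathrm{mod}\,M)}\overline N_d(k,n)-\frac{\overline p(n)}M\Bigr)q^n .$$ Let $\chi(X)=1$ if $X$ holds and $0$ otherwise. "Generic" means: for each $m(x,Q,z)$ that occurs, neither $z$ nor $xz$ is an integral power of $Q$, and no theta function in a denominator of a $\Psi$ or $\Delta$ that occurs vanishes. **Theorem 1.1.** Let $d\ge1$ be odd, let $2\le a\le M$ be integers, let $\zeta_M$ be a primitive $M$-th root of unity and let $z',z'',z_0\in\mathbb C^*$ be generic. Then the series $\overline D_d(a,M)$ and $\overline D_d(a-1,M)$ converge absolutely, and the following hold. (i) If $a$ and $M$ are even, then $$\begin{aligned}\overline D_d(a,M)+\overline D_d(a-1,M)={}&\chi(a=M)+2(-1)^{\frac a2}q^{-\frac{d^2a^2}4}\,m\bigl((-1)^{\frac M2+1}q^{d^2(\frac{M^2}4-\frac{aM}2)},\,q^{\frac{d^2M^2}2},\,z'\bigr)\\&-2q^{-d^2}\Psi_{\frac a2-1}^{\frac M2}(q^{-d^2},-1,z';q^{2d^2})+\frac2M\sum_{j=1}^{M-1}\zeta_M^{-aj}(1-\zeta_M^j)\Lambda(d,\zeta_M^j,z_0,-1).\end{aligned}$$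 (ii) If $a$ is even and $M$ is odd, then $$\begin{aligned}\overline D_d(a,M)+\overline D_d(a-1,M)={}&2(-1)^{\frac a2}q^{-d^2(\frac{2M-a}2)^2}m(q^{d^2M(a-M)},q^{2d^2M^2},z')\\&+2(-1)^{\frac{M+1-a}2}q^{-d^2(\frac{M+1-a}2)^2}m(q^{d^2M(a-1)},q^{2d^2M^2},z'')\\&-2\Psi_{\frac{2M-a}2}^{M}(q^{d^2},-1,z';q^{2d^2})+2\Psi_{\frac{M+1-a}2}^{M}(q^{d^2},-1,z'';q^{2d^2})\\&+\frac2M\sum_{j=1}^{M-1}\zeta_M^{-aj}(1-\zeta_M^j)\Lambda(d,\zeta_M^j,z_0,-1).\end{aligned}$$ (iii) If $a$ and $M$ are odd, then $$\begin{aligned}\overline D_d(a,M)+\overline D_d(a-1,M)={}&\chi(a=M)-2(-1)^{\frac{M-a}2}q^{-d^2(\frac{M-a}2)^2}m(q^{d^2Ma},q^{2d^2M^2},z')\\&+2(-1)^{\frac{a+1}2}q^{-d^2(\frac{2M-a+1}2)^2}m(q^{d^2M(a-M-1)},q^{2d^2M^2},z'')\\&-2\Psi_{\frac{M-a}2}^{M}(q^{d^2},-1,z';q^{2d^2})+2\Psi_{\frac{2M+1-a}2}^{M}(q^{d^2},-1,z'';q^{2d^2})\\&+\frac2M\sum_{j=1}^{M-1}\zeta_M^{-aj}(1-\zeta_M^j)\Lambda(d,\zeta_M^j,z_0,-1).\end{aligned}$$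 -/

import Mathlib

noncomputable section

namespace OverRank

open PowerSeries Finset

/-! ### Overpartitions and the generalized rank generating function -/

/-- The overpartitions of `n`: a partition of `n` together with the set of those part sizes
whose first occurrence is overlined. -/
def overpartitions (n : ℕ) : Finset (Σ _ : n.Partition, Finset ℕ) :=
  (Finset.univ : Finset n.Partition).sigma fun p => p.parts.toFinset.powerset

/-- The number `p̄(n)` of overpartitions of `n`. -/
def pbar (n : ℕ) : ℕ := (overpartitions n).card

/-- The formal power series in `q` over the ring `ℤ[z, z⁻¹]` given by
`(-q)_∞ / (q)_∞ * (1 + 2 ∑_{n ≥ 1} (1 - z)(1 - z⁻¹)(-1)^n q^(n² + dn) /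
((1 - z q^(dn))(1 - z⁻¹ q^(dn))))`, with the infinite products and the infinite sum cut off
after `K` factors, respectively terms. For `d ≥ 1` the series that are inverted have constant
coefficient `1`, and the omitted factors and terms only contribute to the coefficients of `q^n`
with `n > K`. -/
def rankTrunc (d K : ℕ) : PowerSeries (LaurentPolynomial ℤ) :=
  (∏ k ∈ Icc 1 K, (1 + X ^ k)) * invOfUnit (∏ k ∈ Icc 1 K, (1 - X ^ k)) 1 *
    (1 + 2 * ∑ n ∈ Icc 1 K,
      C ((1 - LaurentPolynomial.T 1) * (1 - LaurentPolynomial.T (-1))) * (-1) ^ n *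
        X ^ (n ^ 2 + d * n) *
        invOfUnit ((1 - C (LaurentPolynomial.T 1) * X ^ (d * n)) *
          (1 - C (LaurentPolynomial.T (-1)) * X ^ (d * n))) 1)

/-- The coefficient of `q^N` does not depend on the cut-off `K ≥ N`. -/
theorem coeff_rankTrunc (d : ℕ) {N K : ℕ} (h : N ≤ K) :
    coeff N (rankTrunc d K) = coeff N (rankTrunc d N) := by
  induction K, h using Nat.le_induction with
  | base => rfl
  | succ K hK ih =>
    rw [← ih, ← sub_eq_zero, ← map_sub]
    refine X_pow_dvd_iff.mp (?_ : X ^ (K + 1) ∣ _) N (by omega)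
    have c0 : ∀ L : ℕ, constantCoeff (∏ k ∈ Icc 1 L, (1 - X ^ k) :
        PowerSeries (LaurentPolynomial ℤ)) = 1 := by
      intro L
      rw [map_prod]
      refine Finset.prod_eq_one fun k hk => ?_
      have : k ≠ 0 := by have := (Finset.mem_Icc.mp hk).1; omega
      simp [this]
    have i1 := mul_invOfUnit _ 1 ((c0 K).trans Units.val_one.symm)
    have i2 := mul_invOfUnit _ 1 ((c0 (K + 1)).trans Units.val_one.symm)
    unfold rankTrunc
    rw [Finset.prod_Icc_succ_top (by omega)] at i2 ⊢
    rw [Finset.prod_Icc_succ_top (by omega), Finset.sum_Icc_succ_top (by omega)]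
    have e : (X : PowerSeries (LaurentPolynomial ℤ)) ^ ((K + 1) ^ 2 + d * (K + 1)) =
        X ^ (K + 1) * X ^ ((K + 1) * K + d * (K + 1)) := by
      rw [← pow_add]; congr 1; ring
    rw [e]
    generalize (X : PowerSeries (LaurentPolynomial ℤ)) ^ (K + 1) = Y at *
    generalize invOfUnit ((∏ k ∈ Icc 1 K, (1 - X ^ k) :
      PowerSeries (LaurentPolynomial ℤ)) * (1 - Y)) 1 = I' at *
    generalize invOfUnit (∏ k ∈ Icc 1 K, (1 - X ^ k) :
      PowerSeries (LaurentPolynomial ℤ)) 1 = I at *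
    generalize (∏ k ∈ Icc 1 K, (1 - X ^ k) : PowerSeries (LaurentPolynomial ℤ)) = A at *
    have hI : I' = I + Y * (A * I * I') := by
      linear_combination (- I') * i1 + I * i2
    generalize A * I * I' = B at hI
    rw [hI]
    generalize (∏ k ∈ Icc 1 K, (1 + X ^ k) : PowerSeries (LaurentPolynomial ℤ)) = P
    generalize (∑ n ∈ Icc 1 K, _ : PowerSeries (LaurentPolynomial ℤ)) = S
    generalize invOfUnit (R := LaurentPolynomial ℤ) _ 1 = V
    generalize (X : PowerSeries (LaurentPolynomial ℤ)) ^ ((K + 1) * K + d * (K + 1)) = Z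
    generalize C (R := LaurentPolynomial ℤ) _ = c
    generalize (-1 : PowerSeries (LaurentPolynomial ℤ)) ^ (K + 1) = s
    exact ⟨P * ((B + I + Y * B) * (1 + 2 * S + 2 * Y * (c * s * Z * V)) +
      2 * I * (c * s * Z * V)), by ring⟩

/-- The generating function `𝒪_d(z; q)`, as a formal power series in `q` over `ℤ[z, z⁻¹]`. -/
def rankGF (d : ℕ) : PowerSeries (LaurentPolynomial ℤ) :=
  PowerSeries.mk fun N => coeff N (rankTrunc d N)

/-- `N̄_d(m, n)`: the coefficient of `z^m q^n` in `𝒪_d(z; q)`. -/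
def Nbar (d : ℕ) (m : ℤ) (n : ℕ) : ℤ := (coeff n (rankGF d)).coeff m

/-- `N̄_d(a, M, n)`: the sum of `N̄_d(k, n)` over all `k ≡ a (mod M)`; only finitely many terms
are non-zero. -/
def NbarMod (d : ℕ) (a : ℤ) (M n : ℕ) : ℤ :=
  ∑ k ∈ (coeff n (rankGF d)).coeff.support with k ≡ a [ZMOD M], Nbar d k n

/-- The coefficient of `q^n` in the rank deviation `D̄_d(a, M)`. -/
def devCoeff (d : ℕ) (a : ℤ) (M n : ℕ) : ℂ := (NbarMod d a M n : ℂ) - (pbar n : ℂ) / (M : ℂ)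

/-- The generalized rank deviation `D̄_d(a, M)`, as a function of `q`. -/
def dev (d : ℕ) (a : ℤ) (M : ℕ) (q : ℂ) : ℂ := ∑' n : ℕ, devCoeff d a M n * q ^ n

/-! ### Theta functions and Appell–Lerch series -/

/-- `(x; q)_∞`. -/
def qPoch (x q : ℂ) : ℂ := ∏' k : ℕ, (1 - x * q ^ k)

/-- `j(z; q) = (z)_∞ (q/z)_∞ (q)_∞`. -/
def theta (z q : ℂ) : ℂ := qPoch z q * qPoch (q / z) q * qPoch q q

/-- `j(z₁, z₂; q) = j(z₁; q) j(z₂; q)`. -/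
def theta₂ (z₁ z₂ q : ℂ) : ℂ := theta z₁ q * theta z₂ q

/-- `J_m = (q^m; q^m)_∞`. -/
def J (m : ℕ) (q : ℂ) : ℂ := qPoch (q ^ m) (q ^ m)

/-- The Appell–Lerch series `m(x, q, z)`. -/
def appellLerch (x q z : ℂ) : ℂ :=
  1 / theta z q *
    ∑' r : ℤ, (-1) ^ r * q ^ (r * (r - 1) / 2) * z ^ r / (1 - q ^ (r - 1) * x * z)

/-- Neither `z` nor `x z` is an integral power of `q`. -/
def AppellLerchGeneric (x q z : ℂ) : Prop := ∀ r : ℤ, z ≠ q ^ r ∧ x * z ≠ q ^ r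

/-- `Δ(x, z₁, z₀; q)`. -/
def Delta (x z₁ z₀ q : ℂ) : ℂ :=
  z₀ * J 1 q ^ 3 * theta (z₁ / z₀) q * theta (x * z₀ * z₁) q /
    (theta z₀ q * theta z₁ q * theta (x * z₀) q * theta (x * z₁) q)

/-- No theta function in the denominator of `Δ(x, z₁, z₀; q)` vanishes. -/
def DeltaGeneric (x z₁ z₀ q : ℂ) : Prop :=
  theta z₀ q ≠ 0 ∧ theta z₁ q ≠ 0 ∧ theta (x * z₀) q ≠ 0 ∧ theta (x * z₁) q ≠ 0

/-- `Ψ_k^n(x, z, z'; q)`. -/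
def Psi (k n : ℕ) (x z z' q : ℂ) : ℂ :=
  -(x ^ k * z ^ (k + 1) * J (n ^ 2) q ^ 3 / (theta z q * theta z' (q ^ n ^ 2))) *
    ∑ t ∈ range n,
      q ^ ((t + 1).choose 2 + k * t) * (-z) ^ t *
        theta₂ (-q ^ ((n + 1).choose 2 + n * k + n * t) * (-z) ^ n / z')
          (q ^ (n * t) * (x * z) ^ n * z') (q ^ n ^ 2) /
        theta₂ (-q ^ ((n.choose 2 : ℤ) - n * k) * (-x) ^ n * z')
          (q ^ (n * t) * (x * z) ^ n) (q ^ n ^ 2)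

/-- No theta function in a denominator of `Ψ_k^n(x, z, z'; q)` vanishes. -/
def PsiGeneric (k n : ℕ) (x z z' q : ℂ) : Prop :=
  theta z q ≠ 0 ∧ theta z' (q ^ n ^ 2) ≠ 0 ∧
    ∀ t < n, theta₂ (-q ^ ((n.choose 2 : ℤ) - n * k) * (-x) ^ n * z')
      (q ^ (n * t) * (x * z) ^ n) (q ^ n ^ 2) ≠ 0

/-- `Λ(d, z, z₀, z')` for odd `d`, where `w` is the chosen `d`-th root `z^(1/d)` of `z = w^d` (so
that `z^((d-1)/d) = w^(d-1)` and `z^(-2/d) = w⁻²`) and `ξ` is the chosen primitive `d`-th root of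
unity `ζ_d`. -/
def Lambda (d : ℕ) (ξ w z₀ z' q : ℂ) : ℂ :=
  (-1) ^ ((d + 1) / 2) * q ^ (-(((d : ℤ) - 1) ^ 2 / 4)) * w ^ (d - 1) *
    (Psi ((d - 1) / 2) d (w ^ (-2 : ℤ) * q ^ d) z₀ z' (q ^ 2) +
      1 / (d : ℂ) * ∑ t ∈ range d,
        ξ ^ (-(t : ℤ)) *
          Delta (ξ ^ (-(2 * t : ℤ)) * w ^ (-2 : ℤ) * q ^ d)
            (ξ ^ t * w * q ^ (-(((d : ℤ) - 1) / 2))) z₀ (q ^ 2))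

/-- No theta function in a denominator of `Λ(d, w^d, z₀, z')` vanishes. -/
def LambdaGeneric (d : ℕ) (ξ w z₀ z' q : ℂ) : Prop :=
  PsiGeneric ((d - 1) / 2) d (w ^ (-2 : ℤ) * q ^ d) z₀ z' (q ^ 2) ∧
    ∀ t < d, DeltaGeneric (ξ ^ (-(2 * t : ℤ)) * w ^ (-2 : ℤ) * q ^ d)
      (ξ ^ t * w * q ^ (-(((d : ℤ) - 1) / 2))) z₀ (q ^ 2)

end OverRank

end

open OverRank

/-! Put S(z) = ∑ (-1)^n q^(n²) / (1 - z q^(dn)), summed over all integers n (`rankSum`). Partial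
fractions pair the terms n and -n, and (q)_∞ / (-q)_∞ = j(q; q²). Hence, for |z| = 1 and z ≠ 1, (1 +
z) 𝒪_d(z; q) = (1 - z) (2 S(z) / j(q; q²) - 1) (`evalSeries_rankAt`).

The deviation of a class b is a finite Fourier transform of 𝒪_d over the nontrivial M-th roots of
unity, since 𝒪_d(1; q) generates p̄(n) (`devCoeff_eq`). Adding the classes a and a - 1 produces the
factor 1 + ζ^j, exactly what the formula for (1 + z) 𝒪_d needs (`dev_add_dev`).

The function Λ is built so that S(z) / j(q; q²) = Λ + 1 - m(z⁻² q^(d²), q^(2d²), z') (`Lambda_eq`).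
For d = 1 the source is m(v⁻² q, q², v) = 1 - S(v) / j(q; q²). For general d this is averaged over
the d-th roots v of z, because ∑ 1 / (1 - ξ^t y) = d / (1 - y^d).

What remains is the Fourier transform of m(ζ^(-2j) q^(d²), q^(2d²), -1), which comes from
orthogonality (`sum_zpow_appellLerch`). Sorting the summation index by its residue modulo n turns
the transform into n Appell–Lerch series in base q^(n²), with different third arguments. The
three-term relation moves them all to one common z', and the corrections add up to Ψ. The parity of
M decides whether ζ⁻² is primitive of order M or of order M/2; this gives the different shapes of
the cases.

The three-term relation (`lerch_three_term`) holds because a cross combination of two theta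
functions and two Appell–Lerch sums has Laurent coefficients that satisfy the recursion of a theta
function. It is therefore a multiple of one theta function, with a constant fixed by special values
and by the residue of an Appell–Lerch sum at u = 1. -/

noncomputable section

/-! ### Terms of the theta series and the infinite product. -/

namespace OverRank
open Filter Topology

/-- The general term `(-1)^r Q^(r(r-1)/2) z^r` of the theta series. -/
def thetaTerm (Q z : ℂ) (r : ℤ) : ℂ := (-1) ^ r * Q ^ (r * (r - 1) / 2) * z ^ r

theorem triangle_succ (r : ℤ) : (r + 1) * (r + 1 - 1) / 2 = r * (r - 1) / 2 + r := by
  rw [← Int.add_mul_ediv_right _ _ (by norm_num)]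
  congr 1; ring

theorem thetaTerm_zero (Q z : ℂ) : thetaTerm Q z 0 = 1 := by simp [thetaTerm]

theorem thetaTerm_succ {Q z : ℂ} (hQ : Q ≠ 0) (hz : z ≠ 0) (r : ℤ) :
    thetaTerm Q z (r + 1) = -(Q ^ r * z) * thetaTerm Q z r := by
  unfold thetaTerm
  rw [triangle_succ, zpow_add₀ hQ, zpow_add₀ hz, zpow_add₀ (by norm_num)]
  simp; ring

theorem thetaTerm_one {Q z : ℂ} (hQ : Q ≠ 0) (hz : z ≠ 0) : thetaTerm Q z 1 = -z := by
  have := thetaTerm_succ hQ hz 0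
  simpa [thetaTerm_zero] using this

theorem thetaTerm_mul_right (Q z y : ℂ) (r : ℤ) :
    thetaTerm Q (z * y) r = thetaTerm Q z r * y ^ r := by
  unfold thetaTerm; rw [mul_zpow]; ring

theorem thetaTerm_ne_zero {Q z : ℂ} (hQ : Q ≠ 0) (hz : z ≠ 0) (r : ℤ) : thetaTerm Q z r ≠ 0 := by
  unfold thetaTerm
  exact mul_ne_zero (mul_ne_zero (zpow_ne_zero _ (by norm_num)) (zpow_ne_zero _ hQ))
    (zpow_ne_zero _ hz)

/-- A two-sided sequence with the recursion of the coefficients of a theta function is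
proportional to the theta coefficients. -/
theorem eq_mul_thetaTerm_of_rec {Q z : ℂ} (hQ : Q ≠ 0) (hz : z ≠ 0) {c : ℤ → ℂ}
    (hc : ∀ r, c (r + 1) = -(Q ^ r * z) * c r) (r : ℤ) : c r = c 0 * thetaTerm Q z r := by
  induction r using Int.induction_on with
  | zero => simp [thetaTerm_zero]
  | succ n ih => rw [hc, ih, thetaTerm_succ hQ hz]; ring
  | pred n ih =>
    have h1 := hc (-(n : ℤ) - 1)
    have h2 := thetaTerm_succ hQ hz (-(n : ℤ) - 1)
    rw [sub_add_cancel] at h1 h2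
    rw [h1, h2] at ih
    have h3 : -(Q ^ (-(n : ℤ) - 1) * z) ≠ 0 := neg_ne_zero.mpr (mul_ne_zero (zpow_ne_zero _ hQ) hz)
    exact mul_left_cancel₀ h3 (by rw [ih]; ring)

theorem tendsto_zpow_natCast {Q : ℂ} (hQ1 : ‖Q‖ < 1) : Tendsto (fun n : ℕ => Q ^ n) atTop (𝓝 0) :=
  tendsto_pow_atTop_nhds_zero_of_norm_lt_one hQ1

/-- Ratio test on each half: the ratios of consecutive norms are |Q|^n |z| and |Q|^(n+1) / |z|, both
tending to 0. -/
theorem summable_norm_thetaTerm {Q z : ℂ} (hQ : Q ≠ 0) (hQ1 : ‖Q‖ < 1) (hz : z ≠ 0) :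
    Summable fun r : ℤ => ‖thetaTerm Q z r‖ := by
  refine Summable.of_nat_of_neg ?_ ?_
  · refine summable_of_ratio_test_tendsto_lt_one (l := 0) one_pos
      (Eventually.of_forall fun n => norm_ne_zero_iff.mpr (thetaTerm_ne_zero hQ hz _)) ?_
    have h : Tendsto (fun n : ℕ => ‖Q‖ ^ n * ‖z‖) atTop (𝓝 (0 * ‖z‖)) :=
      (tendsto_pow_atTop_nhds_zero_of_lt_one (norm_nonneg _) hQ1).mul_const _
    rw [zero_mul] at h
    refine h.congr fun n => ?_
    have := norm_ne_zero_iff.mpr (thetaTerm_ne_zero hQ hz (n : ℤ))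
    push_cast
    rw [thetaTerm_succ hQ hz, norm_norm, norm_norm, norm_mul, norm_neg, norm_mul, zpow_natCast,
      norm_pow]
    field_simp
  · refine summable_of_ratio_test_tendsto_lt_one (l := 0) one_pos
      (Eventually.of_forall fun n => norm_ne_zero_iff.mpr (thetaTerm_ne_zero hQ hz _)) ?_
    have h : Tendsto (fun n : ℕ => ‖Q‖ ^ (n + 1) * ‖z‖⁻¹) atTop (𝓝 (0 * ‖z‖⁻¹)) :=
      ((tendsto_pow_atTop_nhds_zero_of_lt_one (norm_nonneg _) hQ1).comp
        (tendsto_add_atTop_nat 1)).mul_const _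
    rw [zero_mul] at h
    refine h.congr fun n => ?_
    have h0 := norm_ne_zero_iff.mpr (thetaTerm_ne_zero hQ hz (-((n + 1 : ℕ) : ℤ)))
    have h1 := thetaTerm_succ hQ hz (-((n + 1 : ℕ) : ℤ))
    have e : -((n + 1 : ℕ) : ℤ) + 1 = -(n : ℤ) := by push_cast; ring
    rw [e] at h1
    have hz' := norm_ne_zero_iff.mpr hz
    have hQ' := norm_ne_zero_iff.mpr hQ
    rw [h1, norm_norm, norm_norm, norm_mul, norm_neg, norm_mul, zpow_neg, zpow_natCast, norm_inv,
      norm_pow]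
    field_simp

theorem summable_thetaTerm_mul {Q z : ℂ} (hQ : Q ≠ 0) (hQ1 : ‖Q‖ < 1) (hz : z ≠ 0) {b : ℤ → ℂ}
    {B : ℝ} (hb : ∀ r, ‖b r‖ ≤ B) : Summable fun r : ℤ => ‖thetaTerm Q z r * b r‖ := by
  refine Summable.of_nonneg_of_le (fun _ => norm_nonneg _) (fun r => ?_)
    ((summable_norm_thetaTerm hQ hQ1 hz).mul_right B)
  rw [norm_mul]
  exact mul_le_mul_of_nonneg_left (hb r) (norm_nonneg _)

/-! ### The infinite product `(x; q)_∞` -/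

theorem summable_norm_mul_pow {q : ℂ} (hq1 : ‖q‖ < 1) (x : ℂ) :
    Summable fun k : ℕ => ‖-(x * q ^ k)‖ := by
  simp only [norm_neg, norm_mul, norm_pow]
  exact (summable_geometric_of_lt_one (norm_nonneg _) hq1).mul_left _

theorem multipliable_qPoch {q : ℂ} (hq1 : ‖q‖ < 1) (x : ℂ) :
    Multipliable fun k : ℕ => (1 - x * q ^ k) := by
  simpa [sub_eq_add_neg] using multipliable_one_add_of_summable (summable_norm_mul_pow hq1 x)

theorem tendsto_qPoch {q : ℂ} (hq1 : ‖q‖ < 1) (x : ℂ) :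
    Tendsto (fun N : ℕ => ∏ k ∈ Finset.range N, (1 - x * q ^ k)) atTop (𝓝 (qPoch x q)) :=
  (multipliable_qPoch hq1 x).hasProd.tendsto_prod_nat

theorem qPoch_eq_mul {q : ℂ} (hq1 : ‖q‖ < 1) (x : ℂ) :
    qPoch x q = (1 - x) * qPoch (x * q) q := by
  refine tendsto_nhds_unique ((tendsto_qPoch hq1 x).comp (tendsto_add_atTop_nat 1)) ?_
  have := (tendsto_qPoch hq1 (x * q)).const_mul (1 - x)
  refine this.congr fun N => ?_
  simp only [Function.comp, Finset.prod_range_succ']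
  rw [mul_comm]
  simp [pow_succ', mul_assoc]

theorem qPoch_ne_zero {q : ℂ} (hq1 : ‖q‖ < 1) {x : ℂ} (h : ∀ k : ℕ, x * q ^ k ≠ 1) :
    qPoch x q ≠ 0 := by
  have := tprod_one_add_ne_zero_of_summable (f := fun k : ℕ => -(x * q ^ k))
    (fun k => by rw [← sub_eq_add_neg]; exact sub_ne_zero.mpr (h k).symm)
    (summable_norm_mul_pow hq1 x)
  simpa [qPoch, sub_eq_add_neg] using this

theorem qPoch_eq_zero {q : ℂ} {x : ℂ} {k : ℕ} (h : x * q ^ k = 1) : qPoch x q = 0 :=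
  tprod_of_exists_eq_zero ⟨k, by rw [h, sub_self]⟩

theorem qPoch_self_ne_zero {q : ℂ} (hq1 : ‖q‖ < 1) : qPoch q q ≠ 0 := by
  refine qPoch_ne_zero hq1 fun k h => ?_
  rw [← pow_succ'] at h
  have : ‖q‖ ^ (k + 1) < 1 := pow_lt_one₀ (norm_nonneg _) hq1 (by omega)
  rw [← norm_pow, h] at this
  simp at this

theorem continuous_qPoch {q : ℂ} (hq1 : ‖q‖ < 1) : Continuous fun x => qPoch x q := by
  rw [continuous_iff_continuousAt]
  intro x
  -- The factors are dominated on the unit ball around `x`, where |y| ≤ |x| + 1.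
  have := tendsto_tprod_one_add_of_dominated_convergence (𝓕 := 𝓝 x)
    (f := fun y (k : ℕ) => -(y * q ^ k)) (g := fun k : ℕ => -(x * q ^ k))
    (bound := fun k => (‖x‖ + 1) * ‖q‖ ^ k)
    ((summable_geometric_of_lt_one (norm_nonneg _) hq1).mul_left _)
    (fun k => (by fun_prop : Continuous fun y : ℂ => -(y * q ^ k)).tendsto x)
    (by
      filter_upwards [(continuous_norm.tendsto x).eventually (gt_mem_nhds (lt_add_one ‖x‖))]
        with y hy k
      rw [norm_neg, norm_mul, norm_pow]
      gcongr)
  simpa only [ContinuousAt, qPoch, sub_eq_add_neg] using this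

end OverRank

namespace OverRank
open Filter Topology

/-! ### The Jacobi triple product -/

/-- `(q; q)_n`. -/
def qFac (q : ℂ) (n : ℕ) : ℂ := ∏ k ∈ Finset.range n, (1 - q ^ (k + 1))

/-- `1 / (q; q)_m`, which is `0` for negative `m`. -/
def invQFac (q : ℂ) (m : ℤ) : ℂ := if 0 ≤ m then (qFac q m.toNat)⁻¹ else 0

theorem one_sub_pow_succ_ne_zero {q : ℂ} (hq1 : ‖q‖ < 1) (k : ℕ) : 1 - q ^ (k + 1) ≠ 0 := by
  intro h
  have : ‖q‖ ^ (k + 1) < 1 := pow_lt_one₀ (norm_nonneg _) hq1 (by omega)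
  rw [← norm_pow, ← sub_eq_zero.mp h] at this
  simp at this

theorem qFac_ne_zero {q : ℂ} (hq1 : ‖q‖ < 1) (n : ℕ) : qFac q n ≠ 0 :=
  Finset.prod_ne_zero_iff.mpr fun k _ => one_sub_pow_succ_ne_zero hq1 k

theorem qFac_succ (q : ℂ) (n : ℕ) : qFac q (n + 1) = qFac q n * (1 - q ^ (n + 1)) :=
  Finset.prod_range_succ _ _

/-- The convention 1 / (q; q)_m = 0 for m < 0 makes the recursion hold at every integer: at m = 0
the factor 1 - q^0 vanishes. No boundary terms therefore arise when indices are shifted. -/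
theorem invQFac_sub_one {q : ℂ} (hq1 : ‖q‖ < 1) (m : ℤ) :
    invQFac q (m - 1) = (1 - q ^ m) * invQFac q m := by
  rcases lt_trichotomy m 0 with h | rfl | h
  · rw [invQFac, invQFac, if_neg (by omega), if_neg (by omega), mul_zero]
  · simp [invQFac]
  · obtain ⟨n, rfl⟩ : ∃ n : ℕ, m = n + 1 := ⟨(m - 1).toNat, by omega⟩
    have e1 : ((n : ℤ) + 1 - 1) = n := by ring
    have e2 : ((n : ℤ) + 1) = ((n + 1 : ℕ) : ℤ) := by push_cast; ring
    rw [e1, e2]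
    simp only [invQFac, Nat.cast_nonneg, if_true, Int.toNat_natCast, qFac_succ, zpow_natCast]
    have h1 := qFac_ne_zero hq1 n
    have h2 := one_sub_pow_succ_ne_zero hq1 n
    field_simp

theorem tendsto_qFac {q : ℂ} (hq1 : ‖q‖ < 1) : Tendsto (qFac q) atTop (𝓝 (qPoch q q)) := by
  refine (tendsto_qPoch hq1 q).congr fun N => ?_
  simp [qFac, pow_succ']

theorem tendsto_invQFac {q : ℂ} (hq1 : ‖q‖ < 1) : Tendsto (invQFac q) atTop (𝓝 (qPoch q q)⁻¹) := by
  have h : Tendsto (fun m : ℤ => (qFac q m.toNat)⁻¹) atTop (𝓝 (qPoch q q)⁻¹) :=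
    ((tendsto_qFac hq1).comp (tendsto_atTop_atTop.mpr fun n : ℕ =>
      ⟨(n : ℤ), fun m hm => (by omega : n ≤ m.toNat)⟩)).inv₀ (qPoch_self_ne_zero hq1)
  refine h.congr' ?_
  filter_upwards [eventually_ge_atTop 0] with m hm
  simp [invQFac, hm]

theorem exists_bound_of_tendsto {f : ℕ → ℂ} {l : ℂ} (h : Tendsto f atTop (𝓝 l)) :
    ∃ B, 0 ≤ B ∧ ∀ n, ‖f n‖ ≤ B := by
  obtain ⟨B, hB⟩ := h.norm.bddAbove_range
  exact ⟨B, (norm_nonneg _).trans (hB ⟨0, rfl⟩), fun n => hB ⟨n, rfl⟩⟩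

theorem exists_bound_invQFac {q : ℂ} (hq1 : ‖q‖ < 1) : ∃ B, 0 ≤ B ∧ ∀ m, ‖invQFac q m‖ ≤ B := by
  obtain ⟨B, hB0, hB⟩ := exists_bound_of_tendsto ((tendsto_qFac hq1).inv₀ (qPoch_self_ne_zero hq1))
  refine ⟨B, hB0, fun m => ?_⟩
  unfold invQFac
  split_ifs
  · exact hB _
  · simpa

/-- The finite form of the Jacobi triple product. -/
theorem hasSum_finite_triple {q z : ℂ} (hq : q ≠ 0) (hq1 : ‖q‖ < 1) (hz : z ≠ 0) (N : ℕ) :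
    HasSum (fun n : ℤ => qFac q (2 * N) * invQFac q (N + n) * invQFac q (N - n) * thetaTerm q z n)
      (∏ k ∈ Finset.range N, (1 - z * q ^ k) * (1 - q / z * q ^ k)) := by
  induction N with
  | zero =>
    have h := hasSum_single (f := fun n : ℤ => qFac q (2 * 0) * invQFac q ((0 : ℕ) + n) *
      invQFac q ((0 : ℕ) - n) * thetaTerm q z n) 0 (by
        intro n hn
        rcases lt_or_gt_of_ne hn with h | h
        · have : ¬ (0 ≤ n) := by omega
          simp [invQFac, this]
        · have : ¬ (n ≤ 0) := by omega
          simp [invQFac, this])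
    simpa [invQFac, qFac, thetaTerm_zero] using h
  | succ N ih =>
    -- The new factor expands to 1 + q^(2N+1) - z q^N - (q/z) q^N. The monomials in z and 1/z shift
    -- the summation index by ±1, so the claim is a linear relation between three neighbouring
    -- coefficients.
    have h1 := (Equiv.subRight (1 : ℤ)).hasSum_iff.mpr ih
    have h2 := (Equiv.addRight (1 : ℤ)).hasSum_iff.mpr ih
    have h := ((ih.mul_left (1 + q ^ (2 * N + 1))).add (h1.mul_left (-(z * q ^ N)))).add
      (h2.mul_left (-(q / z * q ^ N)))
    rw [Finset.prod_range_succ]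
    have hval : (∏ k ∈ Finset.range N, (1 - z * q ^ k) * (1 - q / z * q ^ k)) *
        ((1 - z * q ^ N) * (1 - q / z * q ^ N)) =
        (1 + q ^ (2 * N + 1)) * ∏ k ∈ Finset.range N, (1 - z * q ^ k) * (1 - q / z * q ^ k) +
        -(z * q ^ N) * ∏ k ∈ Finset.range N, (1 - z * q ^ k) * (1 - q / z * q ^ k) +
        -(q / z * q ^ N) * ∏ k ∈ Finset.range N, (1 - z * q ^ k) * (1 - q / z * q ^ k) := by
      generalize ∏ k ∈ Finset.range N, (1 - z * q ^ k) * (1 - q / z * q ^ k) = P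
      field_simp
      ring
    rw [hval]
    refine (congrArg (HasSum · _) (funext fun n => ?_)).mpr h
    simp only [Function.comp, Equiv.subRight_apply, Equiv.coe_addRight]
    have t1 : thetaTerm q z n = -(q ^ (n - 1) * z) * thetaTerm q z (n - 1) := by
      have := thetaTerm_succ hq hz (n - 1)
      rwa [sub_add_cancel] at this
    have t2 := thetaTerm_succ hq hz n
    have a1 := invQFac_sub_one hq1 ((N : ℤ) + 1 + n)
    have a2 := invQFac_sub_one hq1 ((N : ℤ) + n)
    have b1 := invQFac_sub_one hq1 ((N : ℤ) + 1 - n)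
    have b2 := invQFac_sub_one hq1 ((N : ℤ) - n)
    rw [show (N : ℤ) + 1 + n - 1 = N + n by ring] at a1
    rw [show (N : ℤ) + 1 - n - 1 = N - n by ring] at b1
    rw [show (N : ℤ) + n - 1 = N + (n - 1) by ring, a1] at a2
    rw [show (N : ℤ) - n - 1 = N - (n + 1) by ring, b1] at b2
    rw [show (N : ℤ) - (n - 1) = N + 1 - n by ring, show (N : ℤ) + (n + 1) = N + 1 + n by ring,
      a2, b2, a1, b1, t2]
    push_cast
    rw [show 2 * (N + 1) = 2 * N + 1 + 1 by ring, qFac_succ, qFac_succ]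
    have hqn : q ^ n ≠ 0 := zpow_ne_zero _ hq
    have e1 : q ^ ((N : ℤ) + 1 + n) = q ^ N * q * q ^ n := by
      rw [zpow_add₀ hq, zpow_add₀ hq]; simp
    have e2 : q ^ ((N : ℤ) + n) = q ^ N * q ^ n := by rw [zpow_add₀ hq]; simp
    have e3 : q ^ ((N : ℤ) + 1 - n) = q ^ N * q / q ^ n := by
      rw [zpow_sub₀ hq, zpow_add₀ hq]; simp
    have e4 : q ^ ((N : ℤ) - n) = q ^ N / q ^ n := by rw [zpow_sub₀ hq]; simp
    have t1' : thetaTerm q z (n - 1) = -(q / (z * q ^ n)) * thetaTerm q z n := by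
      rw [t1, zpow_sub_one₀ hq]; field_simp
    rw [e1, e2, e3, e4, t1']
    field_simp
    ring

/-- Dominated convergence in the finite triple product: each coefficient tends to (q)_∞ / (q)_∞² = 1
/ (q)_∞, and the factors 1 / (q; q)_m are uniformly bounded. -/
theorem theta_eq_tsum {q z : ℂ} (hq : q ≠ 0) (hq1 : ‖q‖ < 1) (hz : z ≠ 0) :
    theta z q = ∑' n : ℤ, thetaTerm q z n := by
  obtain ⟨B, hB0, hB⟩ := exists_bound_invQFac hq1
  obtain ⟨C, hC0, hC⟩ := exists_bound_of_tendsto (tendsto_qFac hq1)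
  have hne := qPoch_self_ne_zero hq1
  have h1 : Tendsto (fun N : ℕ => ∑' n : ℤ,
      qFac q (2 * N) * invQFac q (N + n) * invQFac q (N - n) * thetaTerm q z n) atTop
      (𝓝 (∑' n : ℤ, qPoch q q * (qPoch q q)⁻¹ * (qPoch q q)⁻¹ * thetaTerm q z n)) := by
    refine tendsto_tsum_of_dominated_convergence
      ((summable_norm_thetaTerm hq hq1 hz).mul_left (C * B * B)) (fun n => ?_)
      (Eventually.of_forall fun N n => ?_)
    · have hN : Tendsto (fun N : ℕ => (N : ℤ)) atTop atTop := tendsto_natCast_atTop_atTop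
      refine Tendsto.mul_const _ (Tendsto.mul (Tendsto.mul ?_ ?_) ?_)
      · exact (tendsto_qFac hq1).comp (tendsto_id.const_mul_atTop' (by norm_num))
      · exact (tendsto_invQFac hq1).comp (tendsto_atTop_add_const_right _ _ hN)
      · exact (tendsto_invQFac hq1).comp (by
          simpa [sub_eq_add_neg] using tendsto_atTop_add_const_right _ (-n) hN)
    · rw [norm_mul, norm_mul, norm_mul]
      gcongr
      · exact hC _
      · exact hB _
      · exact hB _
  have h2 : Tendsto (fun N : ℕ => ∑' n : ℤ,
      qFac q (2 * N) * invQFac q (N + n) * invQFac q (N - n) * thetaTerm q z n) atTop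
      (𝓝 (qPoch z q * qPoch (q / z) q)) := by
    refine ((tendsto_qPoch hq1 z).mul (tendsto_qPoch hq1 (q / z))).congr fun N => ?_
    rw [(hasSum_finite_triple hq hq1 hz N).tsum_eq, Finset.prod_mul_distrib]
  have h3 := tendsto_nhds_unique h1 h2
  rw [tsum_mul_left, mul_inv_cancel₀ hne, one_mul] at h3
  rw [theta, ← h3]
  field_simp

/-! ### Elementary properties of theta functions -/

theorem theta_q_mul {q z : ℂ} (hq : q ≠ 0) (hq1 : ‖q‖ < 1) (hz : z ≠ 0) :
    theta (q * z) q = -(z⁻¹ * theta z q) := by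
  rw [theta_eq_tsum hq hq1 hz, theta_eq_tsum hq hq1 (mul_ne_zero hq hz), ← tsum_mul_left,
    ← tsum_neg, ← (Equiv.addRight (1 : ℤ)).tsum_eq (fun n => -(z⁻¹ * thetaTerm q z n))]
  congr 1; funext n
  rw [Equiv.coe_addRight, thetaTerm_succ hq hz, mul_comm q z, thetaTerm_mul_right]
  field_simp

theorem theta_q_div {q z : ℂ} (hq : q ≠ 0) : theta (q / z) q = theta z q := by
  unfold theta
  rw [show q / (q / z) = z by rw [div_div_eq_mul_div, mul_div_cancel_left₀ _ hq]]
  ring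

theorem theta_inv {q z : ℂ} (hq : q ≠ 0) (hq1 : ‖q‖ < 1) (hz : z ≠ 0) :
    theta z⁻¹ q = -(z⁻¹ * theta z q) := by
  have h := theta_q_mul hq hq1 (inv_ne_zero hz)
  rw [← div_eq_mul_inv, theta_q_div hq, inv_inv] at h
  rw [h]; field_simp

/-- Shifting the summation index by r gives a sequence with the theta recursion for q^r z, hence a
multiple of its theta terms. -/
theorem theta_q_zpow_mul {q z : ℂ} (hq : q ≠ 0) (hq1 : ‖q‖ < 1) (hz : z ≠ 0) (r : ℤ) :
    theta z q = thetaTerm q z r * theta (q ^ r * z) q := by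
  rw [theta_eq_tsum hq hq1 hz, theta_eq_tsum hq hq1 (mul_ne_zero (zpow_ne_zero _ hq) hz),
    ← tsum_mul_left, ← (Equiv.addRight r).tsum_eq (fun n => thetaTerm q z n)]
  congr 1; funext n
  rw [Equiv.coe_addRight, eq_mul_thetaTerm_of_rec (c := fun n => thetaTerm q z (n + r)) hq
    (mul_ne_zero (zpow_ne_zero r hq) hz) (fun n => ?_) n, zero_add]
  rw [add_right_comm, thetaTerm_succ hq hz, zpow_add₀ hq]
  ring

theorem theta_eq_zero_of_zpow {q : ℂ} (hq : q ≠ 0) (hq1 : ‖q‖ < 1) (r : ℤ) :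
    theta (q ^ r) q = 0 := by
  have h := theta_q_zpow_mul hq hq1 one_ne_zero r
  rw [mul_one] at h
  have h1 : theta 1 q = 0 := by
    unfold theta; rw [qPoch_eq_zero (k := 0) (by simp)]; simp
  rw [h1] at h
  exact (mul_eq_zero.mp h.symm).resolve_left (thetaTerm_ne_zero hq one_ne_zero r)

theorem theta_ne_zero {q z : ℂ} (hq : q ≠ 0) (hq1 : ‖q‖ < 1) (hz : z ≠ 0)
    (h : ∀ r : ℤ, z ≠ q ^ r) : theta z q ≠ 0 := by
  refine mul_ne_zero (mul_ne_zero (qPoch_ne_zero hq1 fun k hk => ?_)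
    (qPoch_ne_zero hq1 fun k hk => ?_)) (qPoch_self_ne_zero hq1)
  · refine h (-k) ?_
    rw [zpow_neg, zpow_natCast]
    exact eq_inv_of_mul_eq_one_left hk
  · refine h (k + 1) ?_
    rw [zpow_add₀ hq, zpow_natCast, zpow_one]
    field_simp at hk
    rw [← hk, mul_comm]

theorem ne_zpow_of_theta_ne_zero {q z : ℂ} (hq : q ≠ 0) (hq1 : ‖q‖ < 1)
    (h : theta z q ≠ 0) (r : ℤ) : z ≠ q ^ r := by
  rintro rfl
  exact h (theta_eq_zero_of_zpow hq hq1 r)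

theorem continuousAt_theta {q z : ℂ} (hq1 : ‖q‖ < 1) (hz : z ≠ 0) :
    ContinuousAt (fun z => theta z q) z := by
  unfold theta
  have h := continuous_qPoch hq1
  refine ContinuousAt.mul (h.continuousAt.mul ?_) continuousAt_const
  exact h.continuousAt.comp (f := fun z => q / z) (continuousAt_const.div continuousAt_id hz)

theorem J_one (q : ℂ) : J 1 q = qPoch q q := by simp [J]

/-- `j(z; q) / (1 - z)` tends to `J_1³` as `z → 1`. -/
theorem tendsto_theta_div {q : ℂ} (hq1 : ‖q‖ < 1) :
    Tendsto (fun z => theta z q / (1 - z)) (𝓝[≠] 1) (𝓝 (J 1 q ^ 3)) := by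
  have h := continuous_qPoch hq1
  have h1 : ContinuousAt (fun z : ℂ => qPoch (z * q) q * qPoch (q / z) q * qPoch q q) 1 := by
    refine ContinuousAt.mul (ContinuousAt.mul ?_ ?_) continuousAt_const
    · exact (h.comp (continuous_id.mul continuous_const)).continuousAt
    · exact h.continuousAt.comp (f := fun z => q / z)
        (continuousAt_const.div continuousAt_id one_ne_zero)
  have h2 := h1.tendsto.mono_left (nhdsWithin_le_nhds (s := {1}ᶜ))
  rw [J_one, pow_three']
  simp only [one_mul, div_one] at h2
  refine h2.congr' ?_
  filter_upwards [self_mem_nhdsWithin] with z hz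
  have : 1 - z ≠ 0 := sub_ne_zero.mpr (Ne.symm hz)
  rw [theta, qPoch_eq_mul hq1 z]
  field_simp

end OverRank

namespace OverRank
open Filter Topology

/-! ### Appell–Lerch sums and the three-term relation -/

/-- The Appell–Lerch sum `∑ (-1)^r Q^(r(r-1)/2) Z^r / (1 - Q^(r-1) u)`. -/
def lerch (Q u Z : ℂ) : ℂ := ∑' r : ℤ, thetaTerm Q Z r / (1 - Q ^ (r - 1) * u)

theorem appellLerch_eq (x q z : ℂ) : appellLerch x q z = lerch q (x * z) z / theta z q := by
  unfold appellLerch lerch thetaTerm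
  rw [div_mul_eq_mul_div, one_mul]
  congr 2; funext r
  rw [mul_assoc (q ^ (r - 1))]

theorem one_sub_zpow_mul_ne_zero {Q u : ℂ} (hu : ∀ r : ℤ, u ≠ Q ^ r) (r : ℤ) :
    1 - Q ^ r * u ≠ 0 := by
  intro h
  refine hu (-r) ?_
  rw [zpow_neg]
  exact eq_inv_of_mul_eq_one_right (sub_eq_zero.mp h).symm

theorem exists_bound_inv_one_sub {Q u : ℂ} (hQ : Q ≠ 0) (hQ1 : ‖Q‖ < 1) (hu0 : u ≠ 0)
    (hu : ∀ r : ℤ, u ≠ Q ^ r) : ∃ B, 0 ≤ B ∧ ∀ r : ℤ, ‖(1 - Q ^ r * u)⁻¹‖ ≤ B := by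
  have h1 : Tendsto (fun n : ℕ => (1 - Q ^ n * u)⁻¹) atTop (𝓝 (1 - 0 * u)⁻¹) :=
    (((tendsto_zpow_natCast hQ1).mul_const u).const_sub 1).inv₀ (by simp)
  have h2 : Tendsto (fun n : ℕ => Q ^ n / (Q ^ n - u)) atTop (𝓝 (0 / (0 - u))) :=
    (tendsto_zpow_natCast hQ1).div ((tendsto_zpow_natCast hQ1).sub_const u) (by simpa using hu0)
  obtain ⟨B, hB0, hB⟩ := exists_bound_of_tendsto h1
  obtain ⟨C, hC0, hC⟩ := exists_bound_of_tendsto h2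
  refine ⟨max B C, le_max_of_le_left hB0, fun r => ?_⟩
  obtain ⟨n, rfl | rfl⟩ := Int.eq_nat_or_neg r
  · rw [zpow_natCast]; exact (hB n).trans (le_max_left _ _)
  · refine le_trans (le_of_eq ?_) ((hC n).trans (le_max_right _ _))
    congr 1
    have hn : Q ^ n ≠ 0 := pow_ne_zero _ hQ
    have h3 := one_sub_zpow_mul_ne_zero hu (-(n : ℤ))
    rw [zpow_neg, zpow_natCast] at h3 ⊢
    have h4 : Q ^ n - u ≠ 0 := by
      intro h; apply h3; rw [← sub_eq_zero.mp h, inv_mul_cancel₀ hn, sub_self]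
    field_simp

/-- The denominators stay away from 0: they tend to 1 in one direction and to infinity in the other,
and none of them vanishes. -/
theorem summable_lerch {Q u Z : ℂ} (hQ : Q ≠ 0) (hQ1 : ‖Q‖ < 1) (hu0 : u ≠ 0) (hZ : Z ≠ 0)
    (hu : ∀ r : ℤ, u ≠ Q ^ r) :
    Summable fun r : ℤ => ‖thetaTerm Q Z r / (1 - Q ^ (r - 1) * u)‖ := by
  obtain ⟨B, -, hB⟩ := exists_bound_inv_one_sub hQ hQ1 hu0 hu
  simp only [div_eq_mul_inv]
  exact summable_thetaTerm_mul hQ hQ1 hZ fun r => hB (r - 1)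

/-- `A(u; QZ) = (Q/u) (A(u; Z) - j(Z))`. -/
theorem lerch_q_mul {Q u Z : ℂ} (hQ : Q ≠ 0) (hQ1 : ‖Q‖ < 1) (hu0 : u ≠ 0) (hZ : Z ≠ 0)
    (hu : ∀ r : ℤ, u ≠ Q ^ r) :
    lerch Q u (Q * Z) = Q / u * (lerch Q u Z - theta Z Q) := by
  rw [theta_eq_tsum hQ hQ1 hZ]
  unfold lerch
  rw [← (summable_lerch hQ hQ1 hu0 hZ hu).of_norm.tsum_sub
    (summable_norm_thetaTerm hQ hQ1 hZ).of_norm, ← tsum_mul_left]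
  congr 1; funext r
  have h := one_sub_zpow_mul_ne_zero hu (r - 1)
  rw [mul_comm Q Z, thetaTerm_mul_right]
  have : Q ^ r = Q ^ (r - 1) * Q := by rw [← zpow_add_one₀ hQ, sub_add_cancel]
  rw [this]
  field_simp
  ring

/-- Terms of the double series for `j(u₀Y) A(u₁; u₁Y) - j(u₁Y) A(u₀; u₀Y)` at `Y = 1`. -/
def crossTerm (Q u₁ u₀ : ℂ) (r s : ℤ) : ℂ :=
  thetaTerm Q u₁ r * thetaTerm Q u₀ s * ((1 - Q ^ (r - 1) * u₁)⁻¹ - (1 - Q ^ (s - 1) * u₀)⁻¹)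

/-- `(r, s) ↦ (r + s, r)`. -/
def addShear : ℤ × ℤ ≃ ℤ × ℤ where
  toFun p := (p.1 + p.2, p.1)
  invFun p := (p.2, p.1 - p.2)
  left_inv p := by ext <;> simp
  right_inv p := by ext <;> simp

theorem summable_prod_of_norm {f g : ℤ → ℂ} (hf : Summable fun r => ‖f r‖)
    (hg : Summable fun r => ‖g r‖) : Summable fun p : ℤ × ℤ => f p.1 * g p.2 :=
  summable_mul_of_summable_norm hf hg

theorem hasSum_prod_of_norm {f g : ℤ → ℂ} (hf : Summable fun r => ‖f r‖)
    (hg : Summable fun r => ‖g r‖) :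
    HasSum (fun p : ℤ × ℤ => f p.1 * g p.2) ((∑' r, f r) * ∑' r, g r) :=
  hf.of_norm.hasSum.mul hg.of_norm.hasSum (summable_prod_of_norm hf hg)

theorem summable_diag_of_norm {f g : ℤ → ℂ} (hf : Summable fun r => ‖f r‖)
    (hg : Summable fun r => ‖g r‖) (M : ℤ) : Summable fun r => f r * g (M - r) := by
  simpa [Function.comp_def, addShear] using
    (addShear.symm.summable_iff.mpr (summable_prod_of_norm hf hg)).prod_factor M

section
variable {Q u₁ u₀ : ℂ} (hQ : Q ≠ 0) (hQ1 : ‖Q‖ < 1) (h₁ : u₁ ≠ 0) (h₀ : u₀ ≠ 0)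
  (hu₁ : ∀ r : ℤ, u₁ ≠ Q ^ r) (hu₀ : ∀ r : ℤ, u₀ ≠ Q ^ r)
include hQ hQ1 h₁ h₀ hu₁ hu₀

/-- The double series is graded by the power r + s of Y; its diagonal sums are the Laurent
coefficients of the cross combination. -/
theorem hasSum_crossTerm {Y : ℂ} (hY : Y ≠ 0) :
    HasSum (fun p : ℤ × ℤ => crossTerm Q u₁ u₀ p.1 p.2 * Y ^ (p.1 + p.2))
      (theta (u₀ * Y) Q * lerch Q u₁ (u₁ * Y) - theta (u₁ * Y) Q * lerch Q u₀ (u₀ * Y)) := by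
  have z₁ := mul_ne_zero h₁ hY
  have z₀ := mul_ne_zero h₀ hY
  have a₁ := summable_lerch hQ hQ1 h₁ z₁ hu₁
  have a₀ := summable_lerch hQ hQ1 h₀ z₀ hu₀
  have t₁ := summable_norm_thetaTerm hQ hQ1 z₁
  have t₀ := summable_norm_thetaTerm hQ hQ1 z₀
  have e := (hasSum_prod_of_norm a₁ t₀).sub (hasSum_prod_of_norm t₁ a₀)
  rw [← theta_eq_tsum hQ hQ1 z₀, ← theta_eq_tsum hQ hQ1 z₁, mul_comm _ (theta (u₀ * Y) Q)] at e
  refine (congrArg (HasSum · _) (funext fun p => ?_)).mpr e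
  simp only [crossTerm, thetaTerm_mul_right, zpow_add₀ hY]
  ring

/-- Writing 1/(1 - y) = 1 + y/(1 - y) in each half yields the factor -Q^(N-1) u₁ u₀ and an extra
diagonal sum of products of theta terms. That extra sum is the same in both halves and cancels in
the difference. -/
theorem crossTerm_rec (N : ℤ) :
    ∑' r : ℤ, crossTerm Q u₁ u₀ r (N + 1 - r) =
      -(Q ^ (N - 1) * (u₁ * u₀)) * ∑' r : ℤ, crossTerm Q u₁ u₀ r (N - r) := by
  have a₁ := summable_lerch hQ hQ1 h₁ h₁ hu₁
  have a₀ := summable_lerch hQ hQ1 h₀ h₀ hu₀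
  have t₁ := summable_norm_thetaTerm hQ hQ1 h₁
  have t₀ := summable_norm_thetaTerm hQ hQ1 h₀
  simp only [div_eq_mul_inv] at a₁ a₀
  have s₁ (M : ℤ) := summable_diag_of_norm a₁ t₀ M
  have s₀ (M : ℤ) := summable_diag_of_norm t₁ a₀ M
  have s (M : ℤ) := summable_diag_of_norm t₁ t₀ M
  have split (M : ℤ) : ∑' r : ℤ, crossTerm Q u₁ u₀ r (M - r) =
      ∑' r, thetaTerm Q u₁ r * (1 - Q ^ (r - 1) * u₁)⁻¹ * thetaTerm Q u₀ (M - r) -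
      ∑' r, thetaTerm Q u₁ r * (thetaTerm Q u₀ (M - r) * (1 - Q ^ (M - r - 1) * u₀)⁻¹) := by
    rw [← (s₁ M).tsum_sub (s₀ M)]
    congr 1; funext r; unfold crossTerm; ring
  rw [split, split, mul_sub, ← tsum_mul_left, ← tsum_mul_left]
  have p₁ : ∑' r, thetaTerm Q u₁ r * (1 - Q ^ (r - 1) * u₁)⁻¹ * thetaTerm Q u₀ (N + 1 - r) =
      ∑' r, -(Q ^ (N - 1) * (u₁ * u₀)) *
        (thetaTerm Q u₁ r * (1 - Q ^ (r - 1) * u₁)⁻¹ * thetaTerm Q u₀ (N - r)) +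
      ∑' r, thetaTerm Q u₁ r * thetaTerm Q u₀ (N + 1 - r) := by
    rw [← ((s₁ N).mul_left (-(Q ^ (N - 1) * (u₁ * u₀)))).tsum_add (s (N + 1))]
    congr 1; funext r
    have hr := one_sub_zpow_mul_ne_zero hu₁ (r - 1)
    rw [show N + 1 - r = N - r + 1 by ring, thetaTerm_succ hQ h₀]
    have : Q ^ (N - 1) = Q ^ (N - r) * Q ^ (r - 1) := by rw [← zpow_add₀ hQ]; congr 1; ring
    rw [this]
    field_simp
    ring
  have p₀ : ∑' r, thetaTerm Q u₁ r *
        (thetaTerm Q u₀ (N + 1 - r) * (1 - Q ^ (N + 1 - r - 1) * u₀)⁻¹) =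
      ∑' r, -(Q ^ (N - 1) * (u₁ * u₀)) *
        (thetaTerm Q u₁ r * (thetaTerm Q u₀ (N - r) * (1 - Q ^ (N - r - 1) * u₀)⁻¹)) +
      ∑' r, thetaTerm Q u₁ r * thetaTerm Q u₀ (N + 1 - r) := by
    rw [← (Equiv.addRight (1 : ℤ)).tsum_eq (fun r => thetaTerm Q u₁ r *
        (thetaTerm Q u₀ (N + 1 - r) * (1 - Q ^ (N + 1 - r - 1) * u₀)⁻¹)),
      ← (Equiv.addRight (1 : ℤ)).tsum_eq (fun r => thetaTerm Q u₁ r * thetaTerm Q u₀ (N + 1 - r))]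
    simp only [Equiv.coe_addRight]
    have hadd := ((s₀ N).mul_left (-(Q ^ (N - 1) * (u₁ * u₀)))).tsum_add
      ((Equiv.addRight (1 : ℤ)).summable_iff.mpr (s (N + 1)))
    simp only [Function.comp_def, Equiv.coe_addRight] at hadd
    rw [← hadd]
    congr 1; funext r
    have hr := one_sub_zpow_mul_ne_zero hu₀ (N - r - 1)
    rw [show N + 1 - (r + 1) = N - r by ring, thetaTerm_succ hQ h₁]
    have : Q ^ (N - 1) = Q ^ (N - r - 1) * Q ^ r := by rw [← zpow_add₀ hQ]; congr 1; ring
    rw [this]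
    field_simp
    ring
  rw [p₁, p₀]
  ring

/-- The Laurent coefficients in Y obey the recursion of a theta series, which determines them up to
one constant. Since `c` does not depend on Y, it can be found or eliminated by choosing special Y.
-/
theorem exists_cross_eq : ∃ c : ℂ, ∀ Y : ℂ, Y ≠ 0 →
    theta (u₀ * Y) Q * lerch Q u₁ (u₁ * Y) - theta (u₁ * Y) Q * lerch Q u₀ (u₀ * Y) =
      c * Y * theta (u₀ * u₁ * Y) Q := by
  refine ⟨∑' r : ℤ, crossTerm Q u₁ u₀ r (1 - r), fun Y hY => ?_⟩
  have h := addShear.symm.hasSum_iff.mpr (hasSum_crossTerm hQ hQ1 h₁ h₀ hu₁ hu₀ hY)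
  have h2 := h.prod_fiberwise fun N => (h.summable.prod_factor N).hasSum
  -- Counting from the coefficient of Y¹ turns the exponent N - 1 of the recursion into the one of
  -- `thetaTerm`; this is the origin of the factor `c * Y`.
  have h3 := (Equiv.addRight (1 : ℤ)).hasSum_iff.mpr h2
  rw [← h3.tsum_eq, theta_eq_tsum hQ hQ1 (mul_ne_zero (mul_ne_zero h₀ h₁) hY), ← tsum_mul_left]
  congr 1; funext N
  have key := eq_mul_thetaTerm_of_rec
    (c := fun N : ℤ => ∑' r : ℤ, crossTerm Q u₁ u₀ r (N + 1 - r)) hQ (mul_ne_zero h₀ h₁)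
    (fun r => by
      rw [crossTerm_rec hQ hQ1 h₁ h₀ hu₁ hu₀ (r + 1)]; ring_nf) N
  simp only [Function.comp, addShear, Equiv.coe_addRight, Equiv.coe_fn_symm_mk, zero_add,
    add_sub_cancel] at key ⊢
  rw [tsum_mul_right, key, thetaTerm_mul_right _ (u₀ * u₁) Y, zpow_add_one₀ hY]
  ring

end

/-- `A(u; 1) j(u)` does not depend on `u`. -/
theorem lerch_one_mul_theta_eq {Q u₁ u₀ : ℂ} (hQ : Q ≠ 0) (hQ1 : ‖Q‖ < 1) (h₁ : u₁ ≠ 0)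
    (h₀ : u₀ ≠ 0) (hu₁ : ∀ r : ℤ, u₁ ≠ Q ^ r) (hu₀ : ∀ r : ℤ, u₀ ≠ Q ^ r)
    (h : theta (u₁ / u₀) Q ≠ 0) :
    lerch Q u₁ 1 * theta u₁ Q = lerch Q u₀ 1 * theta u₀ Q := by
  obtain ⟨c, hc⟩ := exists_cross_eq hQ hQ1 h₁ h₀ hu₁ hu₀
  -- At Y = 1/u₀ and Y = 1/u₁ one of the two products contains j(1) = 0 and the other contains an
  -- Appell–Lerch sum at Z = 1. Eliminating `c` gives the claim.
  have c₀ := hc u₀⁻¹ (inv_ne_zero h₀)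
  have c₁ := hc u₁⁻¹ (inv_ne_zero h₁)
  have t1 : theta 1 Q = 0 := by simpa using theta_eq_zero_of_zpow hQ hQ1 0
  have hi := theta_inv hQ hQ1 (div_ne_zero h₁ h₀)
  rw [inv_div] at hi
  have e : u₀ * u₁ * u₁⁻¹ = u₀ := by field_simp
  have e' : u₀ * u₁ * u₀⁻¹ = u₁ := by field_simp
  rw [mul_inv_cancel₀ h₀, t1, ← div_eq_mul_inv u₁, e'] at c₀
  rw [mul_inv_cancel₀ h₁, t1, ← div_eq_mul_inv u₀, hi, e] at c₁
  refine mul_left_cancel₀ (mul_ne_zero h₀ h) ?_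
  field_simp at c₀ c₁
  linear_combination (theta u₀ Q) * c₀ - (theta u₁ Q) * c₁

end OverRank

/-! ### The residue at u = 1 and the constant in the three-term relation. -/

namespace OverRank
open Filter Topology

theorem zpow_ne_one_of_norm_lt_one {Q : ℂ} (hQ : Q ≠ 0) (hQ1 : ‖Q‖ < 1) {m : ℤ} (hm : m ≠ 0) :
    Q ^ m ≠ 1 := by
  intro h
  have h1 : ‖Q‖ ^ m = ‖Q‖ ^ (0 : ℤ) := by rw [← norm_zpow, h]; simp
  exact hm (zpow_right_injective₀ (norm_pos_iff.mpr hQ) hQ1.ne h1)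

/-- In an annulus around |u| = 1 every denominator except that with m = 0 is bounded below uniformly
in u and m. This dominates the series in the residue computation. -/
theorem le_norm_one_sub_zpow_mul {Q u : ℂ} (hQ : Q ≠ 0) (hQ1 : ‖Q‖ < 1)
    (h₁ : (1 + ‖Q‖) / 2 ≤ ‖u‖) (h₂ : ‖Q‖ * ‖u‖ ≤ (1 + ‖Q‖) / 2) {m : ℤ} (hm : m ≠ 0) :
    (1 - ‖Q‖) / 2 ≤ ‖1 - Q ^ m * u‖ := by
  have hQ0 := norm_pos_iff.mpr hQ
  rcases lt_or_gt_of_ne hm with h | h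
  · have h3 : ‖Q‖ ^ (-1 : ℤ) ≤ ‖Q‖ ^ m := zpow_le_zpow_right_of_le_one₀ hQ0 hQ1.le (by omega)
    have h4 : ‖Q‖ ^ (-1 : ℤ) * ((1 + ‖Q‖) / 2) ≤ ‖Q ^ m * u‖ := by
      rw [norm_mul, norm_zpow]; gcongr
    have h5 : ‖Q ^ m * u‖ - 1 ≤ ‖1 - Q ^ m * u‖ := by
      rw [norm_sub_rev]; simpa using norm_sub_norm_le (Q ^ m * u) 1
    have h6 : (1 - ‖Q‖) / 2 + 1 ≤ ‖Q‖ ^ (-1 : ℤ) * ((1 + ‖Q‖) / 2) := by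
      rw [zpow_neg_one, ← div_eq_inv_mul, le_div_iff₀ hQ0]
      nlinarith
    linarith
  · have h3 : ‖Q‖ ^ m ≤ ‖Q‖ ^ (1 : ℤ) := zpow_le_zpow_right_of_le_one₀ hQ0 hQ1.le (by omega)
    have h4 : ‖Q ^ m * u‖ ≤ (1 + ‖Q‖) / 2 := by
      rw [norm_mul, norm_zpow]
      refine le_trans ?_ h₂
      rw [zpow_one] at h3
      gcongr
    have h5 : 1 - ‖Q ^ m * u‖ ≤ ‖1 - Q ^ m * u‖ := by simpa using norm_sub_norm_le 1 (Q ^ m * u)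
    linarith

/-- Only the term r = 1 has a pole at u = 1, and its numerator is -1. -/
theorem tendsto_one_sub_mul_lerch_one {Q : ℂ} (hQ : Q ≠ 0) (hQ1 : ‖Q‖ < 1) :
    Tendsto (fun u => (1 - u) * lerch Q u 1) (𝓝[≠] 1) (𝓝 (-1)) := by
  have hQ0 := norm_pos_iff.mpr hQ
  have hlim : ∑' r : ℤ, thetaTerm Q 1 r * (if r = 1 then 1 else 0) = -1 := by
    rw [tsum_eq_single 1 (fun r hr => by simp [hr]), thetaTerm_one hQ one_ne_zero]; simp
  rw [← hlim]
  have hnorm : Tendsto (fun u : ℂ => ‖u‖) (𝓝[≠] 1) (𝓝 1) := by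
    simpa using (continuous_norm.tendsto (1 : ℂ)).mono_left nhdsWithin_le_nhds
  have hsub : Tendsto (fun u : ℂ => 1 - u) (𝓝[≠] 1) (𝓝 0) := by
    have h : Tendsto (fun u : ℂ => 1 - u) (𝓝 1) (𝓝 (1 - 1)) := tendsto_id.const_sub 1
    rw [sub_self] at h
    exact h.mono_left nhdsWithin_le_nhds
  have main : Tendsto (fun u => ∑' r : ℤ, thetaTerm Q 1 r * ((1 - u) / (1 - Q ^ (r - 1) * u)))
      (𝓝[≠] 1) (𝓝 (∑' r : ℤ, thetaTerm Q 1 r * (if r = 1 then 1 else 0))) := by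
    refine tendsto_tsum_of_dominated_convergence
      ((summable_norm_thetaTerm hQ hQ1 one_ne_zero).mul_right (2 / (1 - ‖Q‖))) (fun r => ?_) ?_
    · refine Tendsto.const_mul _ ?_
      by_cases hr : r = 1
      · subst hr
        simp only [if_true]
        refine tendsto_const_nhds.congr' ?_
        filter_upwards [self_mem_nhdsWithin] with u hu
        have : 1 - u ≠ 0 := sub_ne_zero.mpr (Ne.symm hu)
        simp [div_self this]
      · simp only [hr, if_false]
        have h1 : 1 - Q ^ (r - 1) * 1 ≠ 0 := by
          rw [mul_one]
          exact sub_ne_zero.mpr (zpow_ne_one_of_norm_lt_one hQ hQ1 (by omega)).symm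
        have h2 : Tendsto (fun u : ℂ => 1 - Q ^ (r - 1) * u) (𝓝[≠] 1) (𝓝 (1 - Q ^ (r - 1) * 1)) :=
          ((continuous_const.sub (continuous_const.mul continuous_id)).tendsto _).mono_left
            nhdsWithin_le_nhds
        have h3 := hsub.div h2 h1
        rwa [zero_div] at h3
    · have e1 : ∀ᶠ u in 𝓝[≠] (1 : ℂ), (1 + ‖Q‖) / 2 < ‖u‖ :=
        hnorm.eventually (lt_mem_nhds (by linarith))
      have e2 : ∀ᶠ u in 𝓝[≠] (1 : ℂ), ‖Q‖ * ‖u‖ < (1 + ‖Q‖) / 2 :=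
        (hnorm.const_mul ‖Q‖).eventually (gt_mem_nhds (by linarith))
      have e3 : ∀ᶠ u in 𝓝[≠] (1 : ℂ), ‖1 - u‖ < 1 :=
        hsub.norm.eventually (gt_mem_nhds (by simp))
      filter_upwards [e1, e2, e3, self_mem_nhdsWithin] with u h1 h2 h3 h4 r
      rw [norm_mul]
      refine mul_le_mul_of_nonneg_left ?_ (norm_nonneg _)
      have hpos : 0 < 1 - ‖Q‖ := by linarith
      by_cases hr : r = 1
      · subst hr
        have : 1 - u ≠ 0 := sub_ne_zero.mpr (Ne.symm h4)
        simp only [sub_self, zpow_zero, one_mul, div_self this, norm_one]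
        rw [le_div_iff₀ hpos]; linarith
      · have h5 := le_norm_one_sub_zpow_mul hQ hQ1 h1.le h2.le (m := r - 1) (by omega)
        rw [norm_div, div_le_div_iff₀ (by linarith) hpos]
        nlinarith
  refine main.congr fun u => ?_
  unfold lerch
  rw [← tsum_mul_left]
  congr 1; funext r; ring

theorem J_one_ne_zero {q : ℂ} (hq1 : ‖q‖ < 1) : J 1 q ≠ 0 := by
  rw [J_one]; exact qPoch_self_ne_zero hq1

/-- The product is independent of u, so it equals its limit at u = 1: the simple pole of the sum
meets the simple zero of the theta function, whose leading coefficient is J_1³. -/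
theorem lerch_one {Q u : ℂ} (hQ : Q ≠ 0) (hQ1 : ‖Q‖ < 1) (hu0 : u ≠ 0)
    (hu : ∀ r : ℤ, u ≠ Q ^ r) : lerch Q u 1 * theta u Q = -J 1 Q ^ 3 := by
  have ht := tendsto_theta_div hQ1
  have h1 := (tendsto_one_sub_mul_lerch_one hQ hQ1).mul ht
  rw [neg_one_mul] at h1
  refine tendsto_nhds_unique (tendsto_const_nhds.congr' ?_) h1
  have e1 : ∀ᶠ v in 𝓝[≠] (1 : ℂ), theta v Q / (1 - v) ≠ 0 :=
    ht.eventually_ne (pow_ne_zero _ (J_one_ne_zero hQ1))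
  have e2 : ∀ᶠ v in 𝓝[≠] (1 : ℂ), theta (v / u) Q ≠ 0 := by
    have h2 : ContinuousAt (fun v : ℂ => theta (v / u) Q) 1 :=
      (continuousAt_theta hQ1 (div_ne_zero one_ne_zero hu0)).comp (f := fun v => v / u)
        (continuousAt_id.div_const u)
    have h3 : theta (1 / u) Q ≠ 0 := theta_ne_zero hQ hQ1 (div_ne_zero one_ne_zero hu0)
      fun r hr => hu (-r) (by rw [zpow_neg, ← hr]; simp)
    exact (h2.tendsto.mono_left nhdsWithin_le_nhds).eventually_ne h3
  have e3 : ∀ᶠ v in 𝓝[≠] (1 : ℂ), v ≠ 0 :=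
    (continuousAt_id.eventually_ne one_ne_zero).filter_mono nhdsWithin_le_nhds
  filter_upwards [e1, e2, e3, self_mem_nhdsWithin] with v h4 h5 h6 h7
  have h8 : 1 - v ≠ 0 := sub_ne_zero.mpr (Ne.symm h7)
  have h9 := lerch_one_mul_theta_eq hQ hQ1 h6 hu0
    (ne_zpow_of_theta_ne_zero hQ hQ1 (fun h => h4 (by rw [h, zero_div]))) hu h5
  rw [← h9]
  field_simp

/-- The difference of two Appell–Lerch series with the same first argument, with cleared
denominators. -/
theorem lerch_three_term {Q x z₁ z₀ : ℂ} (hQ : Q ≠ 0) (hQ1 : ‖Q‖ < 1) (hx : x ≠ 0) (h₁ : z₁ ≠ 0)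
    (h₀ : z₀ ≠ 0) (hx₁ : theta (x * z₁) Q ≠ 0) (hx₀ : theta (x * z₀) Q ≠ 0) :
    theta z₀ Q * lerch Q (x * z₁) z₁ - theta z₁ Q * lerch Q (x * z₀) z₀ =
      z₀ * J 1 Q ^ 3 * theta (z₁ / z₀) Q * theta (x * z₀ * z₁) Q /
        (theta (x * z₀) Q * theta (x * z₁) Q) := by
  have n₁ := mul_ne_zero hx h₁
  have n₀ := mul_ne_zero hx h₀
  have g₁ := ne_zpow_of_theta_ne_zero hQ hQ1 hx₁
  have g₀ := ne_zpow_of_theta_ne_zero hQ hQ1 hx₀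
  obtain ⟨c, hc⟩ := exists_cross_eq hQ hQ1 n₁ n₀ g₁ g₀
  -- Y = 1/(x z₀) determines `c`, because one product vanishes and the other is evaluated by
  -- `lerch_one`; Y = 1/x then gives the relation itself.
  have c₀ := hc (x * z₀)⁻¹ (inv_ne_zero n₀)
  have cx := hc x⁻¹ (inv_ne_zero hx)
  have t1 : theta 1 Q = 0 := by simpa using theta_eq_zero_of_zpow hQ hQ1 0
  have L := lerch_one hQ hQ1 n₀ g₀
  rw [mul_inv_cancel₀ n₀, t1, show x * z₁ * (x * z₀)⁻¹ = z₁ / z₀ by field_simp,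
    show x * z₀ * (x * z₁) * (x * z₀)⁻¹ = x * z₁ by field_simp] at c₀
  rw [show x * z₀ * x⁻¹ = z₀ by field_simp, show x * z₁ * x⁻¹ = z₁ by field_simp,
    show x * z₀ * (x * z₁) * x⁻¹ = x * z₀ * z₁ by field_simp] at cx
  rw [cx]
  have c₀' : c * theta (x * z₁) Q * theta (x * z₀) Q = x * z₀ * theta (z₁ / z₀) Q * J 1 Q ^ 3 := by
    have : c * theta (x * z₁) Q = - (x * z₀ * theta (z₁ / z₀) Q * lerch Q (x * z₀) 1) := by
      field_simp at c₀
      linear_combination -c₀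
    rw [this]
    linear_combination (-(x * z₀ * theta (z₁ / z₀) Q)) * L
  field_simp
  linear_combination (theta (x * z₀ * z₁) Q) * c₀'

/-- `m(x, q, z₁) - m(x, q, z₀) = Δ(x, z₁, z₀; q)`. -/
theorem appellLerch_sub {Q x z₁ z₀ : ℂ} (hQ : Q ≠ 0) (hQ1 : ‖Q‖ < 1) (hx : x ≠ 0) (h₁ : z₁ ≠ 0)
    (h₀ : z₀ ≠ 0) (hg : DeltaGeneric x z₁ z₀ Q) :
    appellLerch x Q z₁ - appellLerch x Q z₀ = Delta x z₁ z₀ Q := by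
  obtain ⟨g1, g2, g3, g4⟩ := hg
  have h := lerch_three_term hQ hQ1 hx h₁ h₀ g4 g3
  rw [appellLerch_eq, appellLerch_eq, Delta, div_sub_div _ _ g2 g1, mul_comm (lerch Q _ _),
    h]
  field_simp

end OverRank

namespace OverRank
open Filter Topology Finset

/-! ### Roots of unity -/

theorem sum_zpow_primitiveRoot {η : ℂ} {n : ℕ} (hη : IsPrimitiveRoot η n) (m : ℤ) :
    ∑ j ∈ range n, (η ^ m) ^ j = if (n : ℤ) ∣ m then (n : ℂ) else 0 := by
  split_ifs with h
  · rw [(hη.zpow_eq_one_iff_dvd m).mpr h]; simp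
  · have h1 : η ^ m ≠ 1 := fun h2 => h ((hη.zpow_eq_one_iff_dvd m).mp h2)
    have h2 : (η ^ m) ^ n = 1 := by
      rw [← zpow_natCast, ← zpow_mul, mul_comm, zpow_mul, zpow_natCast, hη.pow_eq_one, one_zpow]
    rw [geom_sum_eq h1, h2, sub_self, zero_div]

/-- Expand 1/(1 - η^j y) as ∑_{i<n} (η^j y)^i / (1 - y^n); orthogonality of the roots of unity keeps
only i = k. -/
theorem sum_div_one_sub_primitiveRoot {η y : ℂ} {n k : ℕ} (hη : IsPrimitiveRoot η n) (hk : k < n)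
    (hy : y ^ n ≠ 1) :
    ∑ j ∈ range n, η ^ (-((k : ℤ) * j)) / (1 - η ^ j * y) = n * (y ^ k / (1 - y ^ n)) := by
  have hη0 : η ≠ 0 := hη.ne_zero (by omega)
  have hn : 1 - y ^ n ≠ 0 := sub_ne_zero.mpr hy.symm
  have h1 : ∀ j ∈ range n, η ^ (-((k : ℤ) * j)) / (1 - η ^ j * y) =
      ∑ i ∈ range n, (η ^ ((i : ℤ) - k)) ^ j * (y ^ i / (1 - y ^ n)) := by
    intro j _
    have e : (η ^ j * y) ^ n = y ^ n := by
      rw [mul_pow, ← pow_mul, mul_comm j, pow_mul, hη.pow_eq_one, one_pow, one_mul]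
    have h2 := mul_neg_geom_sum (η ^ j * y) n
    rw [e] at h2
    have h3 : 1 - η ^ j * y ≠ 0 := fun h => hn (by rw [← h2, h, zero_mul])
    have h4 : ∑ i ∈ range n, (η ^ ((i : ℤ) - k)) ^ j * (y ^ i / (1 - y ^ n)) =
        η ^ (-((k : ℤ) * j)) / (1 - y ^ n) * ∑ i ∈ range n, (η ^ j * y) ^ i := by
      rw [mul_sum]
      refine sum_congr rfl fun i _ => ?_
      rw [zpow_sub₀ hη0, zpow_neg, zpow_mul, zpow_natCast, zpow_natCast, zpow_natCast, div_pow,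
        mul_pow, ← pow_mul, ← pow_mul η j i, mul_comm i j]
      field_simp
    rw [h4, div_eq_iff h3, mul_assoc, mul_comm _ (1 - η ^ j * y), h2, div_mul_cancel₀ _ hn]
  rw [sum_congr rfl h1, sum_comm, sum_eq_single_of_mem k (mem_range.mpr hk)]
  · simp
  · intro i hi hik
    rw [← sum_mul, sum_zpow_primitiveRoot hη, if_neg, zero_mul]
    intro ⟨c, hc⟩
    have := mem_range.mp hi
    have hc0 : c = 0 := by
      by_contra h
      rcases lt_or_gt_of_ne h with h | h <;> nlinarith
    rw [hc0] at hc
    omega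

/-- The parametrization r = n(s - 1) + t + 1 is chosen so that r - 1, the exponent in Appell–Lerch
denominators, becomes n(s - 1) + t. -/
theorem tsum_int_eq_sum_residues {n : ℕ} (hn : 0 < n) {f : ℤ → ℂ} (hf : Summable f) :
    ∑' r, f r = ∑ t ∈ range n, ∑' s : ℤ, f (n * (s - 1) + t + 1) := by
  have : NeZero n := ⟨hn.ne'⟩
  let e : Fin n × ℤ ≃ ℤ :=
    ((Equiv.prodComm _ _).trans (Int.divModEquiv n).symm).trans (Equiv.addRight (1 - (n : ℤ)))
  have he : ∀ p : Fin n × ℤ, e p = n * (p.2 - 1) + (p.1 : ℕ) + 1 := by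
    intro p
    simp only [e, Equiv.trans_apply, Equiv.coe_addRight, Equiv.prodComm_apply]
    simp [Int.divModEquiv]
    ring
  have h1 : Summable fun p => f (e p) := e.summable_iff.mpr hf
  rw [← e.tsum_eq, h1.tsum_prod' fun b => h1.prod_factor b, tsum_fintype, sum_range]
  refine sum_congr rfl fun t _ => ?_
  congr 1; funext s
  rw [he]

theorem thetaTerm_natCast {q z : ℂ} (hq : q ≠ 0) (hz : z ≠ 0) (t : ℕ) :
    thetaTerm q z t = (-1) ^ t * q ^ t.choose 2 * z ^ t := by
  induction t with
  | zero => simp [thetaTerm_zero]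
  | succ t ih =>
    push_cast
    rw [thetaTerm_succ hq hz, ih, Nat.choose_succ_succ' t 1, Nat.choose_one_right]
    rw [pow_add q, zpow_natCast]; ring

theorem thetaTerm_add {q z : ℂ} (hq : q ≠ 0) (hz : z ≠ 0) (r s : ℤ) :
    thetaTerm q z (r + s) = thetaTerm q z r * thetaTerm q z s * q ^ (r * s) := by
  have h := eq_mul_thetaTerm_of_rec (c := fun n => thetaTerm q z (r + n)) hq
    (mul_ne_zero hz (zpow_ne_zero r hq)) (fun n => by
      rw [← add_assoc, thetaTerm_succ hq hz, zpow_add₀ hq]; ring) s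
  simp only [add_zero, thetaTerm_mul_right] at h
  rw [h, zpow_mul]; ring

end OverRank

namespace OverRank
open Filter Topology Finset

/-! ### Orthogonality for Appell–Lerch series -/

theorem two_mul_choose_two_add (n : ℕ) : 2 * n.choose 2 + n = n ^ 2 := by
  have h := Nat.triangle_succ n
  induction n with
  | zero => simp
  | succ n ih =>
    have := ih (Nat.triangle_succ n)
    rw [Nat.choose_succ_succ' n 1, Nat.choose_one_right]
    linarith [this, (by ring : (n + 1) ^ 2 = n ^ 2 + 2 * n + 1)]

theorem succ_choose_two (n : ℕ) : (n + 1).choose 2 = n.choose 2 + n := by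
  rw [Nat.choose_succ_succ' n 1, Nat.choose_one_right, add_comm]

theorem theta_q_pow_mul {q z : ℂ} (hq : q ≠ 0) (hq1 : ‖q‖ < 1) (hz : z ≠ 0) (k : ℕ) :
    theta z q = (-1) ^ k * q ^ k.choose 2 * z ^ k * theta (q ^ k * z) q := by
  rw [← thetaTerm_natCast hq hz]
  simpa using theta_q_zpow_mul hq hq1 hz k

/-- The root-of-unity sum is carried out inside each term, with y = q^(r-1) u; the condition on u^n
keeps y^n away from 1. -/
theorem sum_zpow_lerch {η q u z : ℂ} {n k : ℕ} (hη : IsPrimitiveRoot η n) (hk : k < n)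
    (hq : q ≠ 0) (hq1 : ‖q‖ < 1) (hu0 : u ≠ 0) (hz : z ≠ 0) (hu : ∀ r : ℤ, u ^ n ≠ q ^ (n * r)) :
    ∑ j ∈ range n, η ^ (-((k : ℤ) * j)) * lerch q (η ^ j * u) z =
      n * ∑' r : ℤ, thetaTerm q z r * ((q ^ (r - 1) * u) ^ k / (1 - (q ^ (r - 1) * u) ^ n)) := by
  have hη0 : η ≠ 0 := hη.ne_zero (by omega)
  have hj (j : ℕ) (r : ℤ) : η ^ j * u ≠ q ^ r := by
    intro h
    apply hu r
    rw [mul_comm (n : ℤ), zpow_mul, ← h, zpow_natCast, mul_pow, ← pow_mul, mul_comm j, pow_mul,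
      hη.pow_eq_one, one_pow, one_mul]
  unfold lerch
  simp_rw [← tsum_mul_left]
  rw [← Summable.tsum_finsetSum fun j _ => ((summable_lerch hq hq1
    (mul_ne_zero (pow_ne_zero _ hη0) hu0) hz (hj j)).of_norm.mul_left _)]
  congr 1; funext r
  have hy : (q ^ (r - 1) * u) ^ n ≠ 1 := by
    intro h
    apply hu (1 - r)
    rw [mul_pow] at h
    rw [mul_comm (n : ℤ), zpow_mul, zpow_natCast, eq_comm, ← mul_right_inj'
      (pow_ne_zero n (zpow_ne_zero (r - 1) hq)), h, ← mul_pow, ← zpow_add₀ hq]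
    simp
  rw [mul_left_comm, ← sum_div_one_sub_primitiveRoot hη hk hy, mul_sum]
  refine sum_congr rfl fun j _ => ?_
  rw [← mul_assoc (q ^ (r - 1)), mul_comm (q ^ (r - 1)), mul_assoc]
  ring

/-- Within one residue class the numerators again form a theta sequence in s, with base q^(n²). With
u_t = q^(nt) (xz)^n and X the first argument in the orthogonality relation, its theta argument is
u_t / X. The class therefore contributes an Appell–Lerch series with first argument X and third
argument u_t / X. -/
theorem thetaTerm_residue {q z x : ℂ} {n k : ℕ} (hq : q ≠ 0) (hz : z ≠ 0) (hx : x ≠ 0)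
    (t : ℕ) (s : ℤ) :
    thetaTerm q z (n * (s - 1) + t + 1) * (q ^ (n * (s - 1) + t : ℤ) * (x * z)) ^ k =
      thetaTerm q z (t + 1 - n) * (q ^ (t - n : ℤ) * (x * z)) ^ k *
        thetaTerm (q ^ n ^ 2) (q ^ (n * t) * (x * z) ^ n /
          (-q ^ ((n.choose 2 : ℤ) - n * k) * (-x) ^ n)) s := by
  have hxz := mul_ne_zero hx hz
  have hX : -q ^ ((n.choose 2 : ℤ) - n * k) * (-x) ^ n ≠ 0 :=
    mul_ne_zero (neg_ne_zero.mpr (zpow_ne_zero _ hq)) (pow_ne_zero _ (neg_ne_zero.mpr hx))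
  have h := eq_mul_thetaTerm_of_rec (Q := q ^ n ^ 2) (z := q ^ (n * t) * (x * z) ^ n /
          (-q ^ ((n.choose 2 : ℤ) - n * k) * (-x) ^ n))
    (c := fun s : ℤ => thetaTerm q z (n * (s - 1) + t + 1) *
      (q ^ (n * (s - 1) + t : ℤ) * (x * z)) ^ k)
    (pow_ne_zero _ hq) (div_ne_zero (mul_ne_zero (pow_ne_zero _ hq) (pow_ne_zero _ hxz)) hX)
    (fun s => ?_) s
  · rw [h]
    rw [show (n : ℤ) * (0 - 1) + t + 1 = t + 1 - n by ring,
      show (n : ℤ) * (0 - 1) + t = t - n by ring]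
  · have e1 : (n : ℤ) * (s + 1 - 1) + t + 1 = n * (s - 1) + t + 1 + n := by ring
    have e2 : (n : ℤ) * (s + 1 - 1) + t = n * (s - 1) + t + n := by ring
    rw [e1, e2, thetaTerm_add hq hz, thetaTerm_natCast hq hz, zpow_add₀ hq _ (n : ℤ), mul_pow,
      mul_pow, mul_pow (q ^ _) (x * z), zpow_natCast q n, ← pow_mul q n k]
    -- The exponents match because 2 · C(n, 2) + n = n².
    have key : q ^ (((n : ℤ) * (s - 1) + t + 1) * n) * q ^ n.choose 2 * q ^ (n * k) *
        q ^ ((n.choose 2 : ℤ) - n * k) = (q ^ n ^ 2) ^ s * q ^ (n * t) := by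
      have h2 : (2 * n.choose 2 + n : ℤ) = n ^ 2 := by exact_mod_cast two_mul_choose_two_add n
      rw [← zpow_natCast q, ← zpow_natCast q, ← zpow_natCast q, ← zpow_natCast q, ← zpow_mul,
        ← zpow_add₀ hq, ← zpow_add₀ hq, ← zpow_add₀ hq, ← zpow_add₀ hq]
      congr 1
      push_cast
      linear_combination h2
    have hm : ((-1 : ℂ) ^ n) * (-1) ^ n = 1 := by rw [← mul_pow]; norm_num
    have hq2 := zpow_ne_zero ((n.choose 2 : ℤ) - n * k) hq
    rw [neg_pow x n]
    have hm0 : ((-1 : ℂ) ^ n) ≠ 0 := pow_ne_zero _ (by norm_num)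
    generalize thetaTerm q z _ = T
    generalize (q ^ ((n : ℤ) * (s - 1) + t)) = A
    field_simp
    generalize q ^ (((n : ℤ) * (s - 1) + t + 1) * n) = B at *
    generalize q ^ ((n.choose 2 : ℤ) - n * k) = D at *
    rw [mul_pow x z, sq, hm]
    linear_combination (T * A ^ k * x ^ n * z ^ n) * key


/-- The k-th power replaces z by q^k z in the theta series, and quasi-periodicity returns to z. -/
theorem tsum_thetaTerm_mul_pow {q z x : ℂ} (hq : q ≠ 0) (hq1 : ‖q‖ < 1) (hz : z ≠ 0) (k : ℕ) :
    ∑' r : ℤ, thetaTerm q z r * (q ^ (r - 1) * (x * z)) ^ k =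
      (q ^ (k + 1).choose 2)⁻¹ * (-x) ^ k * theta z q := by
  have hqk : q ^ k ≠ 0 := pow_ne_zero _ hq
  rw [theta_q_pow_mul hq hq1 hz k, theta_eq_tsum hq hq1 (mul_ne_zero hqk hz), ← tsum_mul_left,
    ← tsum_mul_left]
  congr 1; funext r
  have e : (q ^ (r - 1)) ^ k = (q ^ k) ^ r / q ^ k := by
    rw [← zpow_natCast (q ^ (r - 1)), ← zpow_mul, sub_mul, zpow_sub₀ hq, mul_comm r, zpow_mul]
    simp
  have hm : ((-1 : ℂ) ^ k) * (-1) ^ k = 1 := by rw [← mul_pow]; norm_num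
  rw [mul_comm (q ^ k) z, thetaTerm_mul_right, mul_pow, mul_pow, e, succ_choose_two, pow_add,
    neg_pow x k]
  field_simp
  rw [sq, hm, mul_one]

theorem summable_thetaTerm_mul_pow {q z x : ℂ} (hq : q ≠ 0) (hq1 : ‖q‖ < 1) (hz : z ≠ 0) (k : ℕ) :
    Summable fun r : ℤ => ‖thetaTerm q z r * (q ^ (r - 1) * (x * z)) ^ k‖ := by
  have hqk : q ^ k ≠ 0 := pow_ne_zero _ hq
  refine ((summable_norm_thetaTerm hq hq1 (mul_ne_zero hz hqk)).mul_left
    ‖(q ^ k)⁻¹ * (x * z) ^ k‖).congr fun r => ?_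
  have e : (q ^ (r - 1)) ^ k = (q ^ k) ^ r / q ^ k := by
    rw [← zpow_natCast (q ^ (r - 1)), ← zpow_mul, sub_mul, zpow_sub₀ hq, mul_comm r, zpow_mul]
    simp
  rw [← norm_mul, thetaTerm_mul_right, mul_pow (q ^ (r - 1)), e]
  congr 1
  field_simp

theorem norm_pow_lt_one {q : ℂ} (hq1 : ‖q‖ < 1) {n : ℕ} (hn : n ≠ 0) : ‖q ^ n‖ < 1 := by
  rw [norm_pow]; exact pow_lt_one₀ (norm_nonneg _) hq1 hn

/-- The orthogonality relation for Appell–Lerch series at the `n`-th roots of unity. -/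
theorem sum_zpow_appellLerch {η q x z z' : ℂ} {n k : ℕ} (hη : IsPrimitiveRoot η n) (hk : k < n)
    (hq : q ≠ 0) (hq1 : ‖q‖ < 1) (hx : x ≠ 0) (hz : z ≠ 0) (hz' : z' ≠ 0)
    (hg : PsiGeneric k n x z z' q) :
    ∑ j ∈ range n, η ^ (-((k : ℤ) * j)) * appellLerch (η ^ j * x) q z =
      n * ((q ^ (k + 1).choose 2)⁻¹ * (-x) ^ k *
        appellLerch (-q ^ ((n.choose 2 : ℤ) - n * k) * (-x) ^ n) (q ^ n ^ 2) z' +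
          Psi k n x z z' q) := by
  obtain ⟨gz, gz', gt⟩ := hg
  have hn : n ≠ 0 := by omega
  have hxz := mul_ne_zero hx hz
  have hX : -q ^ ((n.choose 2 : ℤ) - n * k) * (-x) ^ n ≠ 0 :=
    mul_ne_zero (neg_ne_zero.mpr (zpow_ne_zero _ hq)) (pow_ne_zero _ (neg_ne_zero.mpr hx))
  have hQ : q ^ n ^ 2 ≠ 0 := pow_ne_zero _ hq
  have hQ1 : ‖q ^ n ^ 2‖ < 1 := norm_pow_lt_one hq1 (pow_ne_zero _ hn)
  have gX : theta (-q ^ ((n.choose 2 : ℤ) - n * k) * (-x) ^ n * z') (q ^ n ^ 2) ≠ 0 :=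
    left_ne_zero_of_mul (gt 0 (by omega))
  have gu (t : ℕ) (ht : t < n) : theta (q ^ (n * t) * (x * z) ^ n) (q ^ n ^ 2) ≠ 0 :=
    right_ne_zero_of_mul (gt t ht)
  have hu (r : ℤ) : (x * z) ^ n ≠ q ^ (n * r) := by
    intro h
    -- With t ≡ -r modulo n, the number q^(nt) (xz)^n = q^(n(t+r)) would be a power of q^(n²), hence
    -- a zero of a theta function in the denominator of Ψ.
    obtain ⟨t, ht⟩ : ∃ t : ℕ, (t : ℤ) = (-r) % n :=
      ⟨((-r) % n).toNat, Int.toNat_of_nonneg (Int.emod_nonneg _ (by omega))⟩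
    have h1 := Int.emod_lt_of_pos (-r) (by omega : (0 : ℤ) < n)
    have h2 := Int.emod_add_mul_ediv (-r) n
    refine ne_zpow_of_theta_ne_zero hQ hQ1 (gu t (by omega)) (-((-r) / n)) ?_
    rw [h, ← zpow_natCast q, ← zpow_natCast q, ← zpow_add₀ hq, ← zpow_mul]
    congr 1
    push_cast
    rw [← ht] at h2
    linear_combination (n : ℤ) * h2
  have hsum : Summable fun r : ℤ => thetaTerm q z r *
      ((q ^ (r - 1) * (x * z)) ^ k / (1 - (q ^ (r - 1) * (x * z)) ^ n)) := by
    have hu' (r : ℤ) : (x * z) ^ n ≠ (q ^ n) ^ r := by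
      rw [← zpow_natCast q, ← zpow_mul]; exact hu r
    obtain ⟨B, hB0, hB⟩ := exists_bound_inv_one_sub (pow_ne_zero n hq) (norm_pow_lt_one hq1 hn)
      (pow_ne_zero n hxz) hu'
    refine Summable.of_norm_bounded
      ((summable_thetaTerm_mul_pow (x := x) hq hq1 hz k).mul_right B) fun r => ?_
    rw [← mul_div_assoc, div_eq_mul_inv, norm_mul]
    refine mul_le_mul_of_nonneg_left ?_ (norm_nonneg _)
    have := hB (r - 1)
    rwa [← zpow_natCast q, ← zpow_mul, mul_comm (n : ℤ), zpow_mul, zpow_natCast, ← mul_pow] at this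
  have main : ∑ j ∈ range n, η ^ (-((k : ℤ) * j)) * appellLerch (η ^ j * x) q z =
      n * (∑ t ∈ range n, thetaTerm q z (t + 1 - n) * (q ^ (t - n : ℤ) * (x * z)) ^ k *
        lerch (q ^ n ^ 2) (q ^ (n * t) * (x * z) ^ n) (q ^ (n * t) * (x * z) ^ n /
          (-q ^ ((n.choose 2 : ℤ) - n * k) * (-x) ^ n))) / theta z q := by
    simp_rw [appellLerch_eq, mul_assoc _ x z, ← mul_div_assoc]
    rw [← sum_div, sum_zpow_lerch hη hk hq hq1 hxz hz hu,
      tsum_int_eq_sum_residues (by omega : 0 < n) hsum]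
    congr 2
    refine sum_congr rfl fun t _ => ?_
    unfold lerch
    rw [← tsum_mul_left]
    congr 1; funext s
    rw [add_sub_cancel_right, ← mul_div_assoc, thetaTerm_residue hq hz hx, mul_div_assoc]
    congr 3
    have : q ^ ((n : ℤ) * (s - 1) + t) * (x * z) = q ^ ((n : ℤ) * (s - 1)) * (q ^ t * (x * z)) := by
      rw [zpow_add₀ hq, zpow_natCast]; ring
    rw [this, mul_pow, mul_pow, ← pow_mul, mul_comm t, ← zpow_natCast (q ^ _), ← zpow_mul,
      ← zpow_natCast q (n ^ 2), ← zpow_mul]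
    congr 2
    push_cast; ring
  -- The theta values of the n classes, weighted by their prefactors, add up to a multiple of j(z;
  -- q). This is why a single series with third argument `z'` remains once every class has been
  -- moved to `z'`.
  have hC : ∑ t ∈ range n, thetaTerm q z (t + 1 - n) * (q ^ (t - n : ℤ) * (x * z)) ^ k *
        theta (q ^ (n * t) * (x * z) ^ n /
          (-q ^ ((n.choose 2 : ℤ) - n * k) * (-x) ^ n)) (q ^ n ^ 2) =
      (q ^ (k + 1).choose 2)⁻¹ * (-x) ^ k * theta z q := by
    rw [← tsum_thetaTerm_mul_pow hq hq1 hz,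
      tsum_int_eq_sum_residues (by omega : 0 < n) (summable_thetaTerm_mul_pow hq hq1 hz k).of_norm]
    refine sum_congr rfl fun t _ => ?_
    rw [theta_eq_tsum hQ hQ1 (div_ne_zero (mul_ne_zero (pow_ne_zero _ hq) (pow_ne_zero _ hxz)) hX),
      ← tsum_mul_left]
    congr 1; funext s
    rw [add_sub_cancel_right, thetaTerm_residue hq hz hx]
  rw [main, mul_div_assoc]
  congr 1
  rw [div_eq_iff gz, add_mul, appellLerch_eq, mul_right_comm, ← hC, sum_mul, Psi, mul_sum, sum_mul,
    ← sum_add_distrib]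
  refine sum_congr rfl fun t ht => ?_
  have ht' := gu t (mem_range.mp ht)
  have huz : q ^ (n * t) * (x * z) ^ n ≠ 0 := mul_ne_zero (pow_ne_zero _ hq) (pow_ne_zero _ hxz)
  have hXZ : -q ^ ((n.choose 2 : ℤ) - n * k) * (-x) ^ n * (q ^ (n * t) * (x * z) ^ n /
      (-q ^ ((n.choose 2 : ℤ) - n * k) * (-x) ^ n)) = q ^ (n * t) * (x * z) ^ n :=
    mul_div_cancel₀ _ hX
  have h3 := lerch_three_term (Q := q ^ n ^ 2) (z₁ := q ^ (n * t) * (x * z) ^ n /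
      (-q ^ ((n.choose 2 : ℤ) - n * k) * (-x) ^ n)) hQ hQ1 hX (div_ne_zero huz hX) hz'
      (by rwa [hXZ]) gX
  -- The case s = 1, where the theta term is minus its argument, identifies the prefactor of the
  -- class with the monomial in the t-th summand of Ψ.
  have hres := thetaTerm_residue (k := k) (n := n) hq hz hx t 1
  rw [thetaTerm_one hQ (div_ne_zero huz hX)] at hres
  -- The numerator theta function of Ψ is the one in the three-term relation shifted by one period
  -- q^(n²).
  have hnum : -q ^ ((n + 1).choose 2 + n * k + n * t) * (-z) ^ n / z' =
      q ^ n ^ 2 * (q ^ (n * t) * (x * z) ^ n /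
      (-q ^ ((n.choose 2 : ℤ) - n * k) * (-x) ^ n) / z') := by
    have e1 : q ^ n ^ 2 = q ^ n.choose 2 * q ^ n.choose 2 * q ^ n := by
      rw [← two_mul_choose_two_add n, two_mul, pow_add, pow_add]
    have e2 : q ^ ((n.choose 2 : ℤ) - n * k) = q ^ n.choose 2 / q ^ (n * k) := by
      rw [zpow_sub₀ hq, zpow_natCast]; norm_cast
    have hm : ((-1 : ℂ) ^ n) * (-1) ^ n = 1 := by rw [← mul_pow]; norm_num
    rw [e1, e2, succ_choose_two, pow_add, pow_add, pow_add, neg_pow x n, neg_pow z n, mul_pow x z]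
    field_simp
    rw [sq, hm]
  have hth := theta_q_mul (z := q ^ (n * t) * (x * z) ^ n /
      (-q ^ ((n.choose 2 : ℤ) - n * k) * (-x) ^ n) / z') hQ hQ1
      (div_ne_zero (div_ne_zero huz hX) hz')
  rw [mul_right_comm _ z', hXZ] at h3
  rw [theta₂, theta₂, hnum, hth]
  rw [show (n : ℤ) * (1 - 1) + t + 1 = ((t + 1 : ℕ) : ℤ) by push_cast; ring,
    show (n : ℤ) * (1 - 1) + t = t by ring, thetaTerm_natCast hq hz, zpow_natCast, mul_pow,
    ← pow_mul, mul_comm t k] at hres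
  generalize (thetaTerm q z (t + 1 - n) * (q ^ (t - n : ℤ) * (x * z)) ^ k) = C at *
  have hZ0 : q ^ (n * t) * (x * z) ^ n / (-q ^ ((n.choose 2 : ℤ) - n * k) * (-x) ^ n) ≠ 0 :=
    div_ne_zero huz hX
  generalize q ^ (n * t) * (x * z) ^ n / (-q ^ ((n.choose 2 : ℤ) - n * k) * (-x) ^ n) = Z at *
  rw [J, ← J_one]
  rw [eq_div_iff (mul_ne_zero gX ht')] at h3
  have hCZ : x ^ k * z ^ (k + 1) * (q ^ ((t + 1).choose 2 + k * t) * (-z) ^ t) = C * Z := by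
    rw [mul_pow x z, pow_succ, pow_succ] at hres
    rw [pow_add q, neg_pow z t, pow_succ]
    linear_combination -hres
  generalize theta (-q ^ ((n.choose 2 : ℤ) - n * k) * (-x) ^ n * z') (q ^ n ^ 2) = A at *
  generalize theta (q ^ (n * t) * (x * z) ^ n) (q ^ n ^ 2) = U at *
  generalize theta (q ^ (n * t) * (x * z) ^ n * z') (q ^ n ^ 2) = N at *
  generalize lerch (q ^ n ^ 2) (q ^ (n * t) * (x * z) ^ n) Z = L at *
  generalize lerch (q ^ n ^ 2) (-q ^ ((n.choose 2 : ℤ) - n * k) * (-x) ^ n * z') z' = L0 at *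
  generalize theta (Z / z') (q ^ n ^ 2) = T at *
  generalize theta z' (q ^ n ^ 2) = θ' at *
  generalize theta Z (q ^ n ^ 2) = θZ at *
  generalize theta z q = θ at *
  generalize J 1 (q ^ n ^ 2) = j at *
  generalize q ^ ((t + 1).choose 2 + k * t) * (-z) ^ t = P at *
  generalize x ^ k * z ^ (k + 1) = R at *
  field_simp
  linear_combination (C * Z) * h3 - (j ^ 3 * z' * T * N) * hCZ

end OverRank

namespace OverRank
open Filter Topology Finset

/-! ### Functional equations of Appell–Lerch series -/

/-- `A(Qu; Z) = j(Z) - (u/Z) A(u; Z)`. -/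
theorem lerch_q_mul_left {Q u Z : ℂ} (hQ : Q ≠ 0) (hQ1 : ‖Q‖ < 1) (hu0 : u ≠ 0) (hZ : Z ≠ 0)
    (hu : ∀ r : ℤ, u ≠ Q ^ r) :
    lerch Q (Q * u) Z = theta Z Q - u / Z * lerch Q u Z := by
  have h2 := (summable_lerch hQ hQ1 hu0 hZ hu).of_norm
  have h1 := (Equiv.addRight (1 : ℤ)).summable_iff.mpr (h2.mul_left (u / Z))
  simp only [Function.comp_def, Equiv.coe_addRight] at h1
  rw [theta_eq_tsum hQ hQ1 hZ]
  unfold lerch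
  rw [← tsum_mul_left, ← (Equiv.addRight (1 : ℤ)).tsum_eq
      (fun r => u / Z * (thetaTerm Q Z r / (1 - Q ^ (r - 1) * u)))]
  simp only [Equiv.coe_addRight]
  rw [← (summable_norm_thetaTerm hQ hQ1 hZ).of_norm.tsum_sub h1]
  congr 1; funext r
  have hr := one_sub_zpow_mul_ne_zero hu r
  rw [add_sub_cancel_right, thetaTerm_succ hQ hZ, ← mul_assoc, ← zpow_add_one₀ hQ, sub_add_cancel]
  field_simp
  ring

/-- `m(Qx, Q, z) = 1 - x m(x, Q, z)`. -/
theorem appellLerch_q_mul {Q x z : ℂ} (hQ : Q ≠ 0) (hQ1 : ‖Q‖ < 1) (hx : x ≠ 0) (hz : z ≠ 0)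
    (hθ : theta z Q ≠ 0) (hu : ∀ r : ℤ, x * z ≠ Q ^ r) :
    appellLerch (Q * x) Q z = 1 - x * appellLerch x Q z := by
  rw [appellLerch_eq, appellLerch_eq, mul_assoc, lerch_q_mul_left hQ hQ1 (mul_ne_zero hx hz) hz hu]
  field_simp

/-- `m(x⁻¹, Q, z⁻¹) = x m(x, Q, z)`. -/
theorem appellLerch_inv {Q x z : ℂ} (hQ : Q ≠ 0) (hQ1 : ‖Q‖ < 1) (hx : x ≠ 0) (hz : z ≠ 0)
    (hu : ∀ r : ℤ, x * z ≠ Q ^ r) :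
    appellLerch x⁻¹ Q z⁻¹ = x * appellLerch x Q z := by
  have key : lerch Q (x⁻¹ * z⁻¹) z⁻¹ = -(x / z) * lerch Q (x * z) z := by
    unfold lerch
    -- The reflection r ↦ 2 - r negates the exponent r - 1 in the denominators.
    rw [← tsum_mul_left, ← (Equiv.subLeft (2 : ℤ)).tsum_eq]
    congr 1; funext r
    have hr := one_sub_zpow_mul_ne_zero hu (r - 1)
    have hQr := zpow_ne_zero (r - 1) hQ
    rw [Equiv.subLeft_apply]
    have e1 : thetaTerm Q z⁻¹ (2 - r) = thetaTerm Q z r / (Q ^ (r - 1) * z ^ 2) := by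
      unfold thetaTerm
      have : (2 - r) * (2 - r - 1) / 2 = r * (r - 1) / 2 - (r - 1) := by
        rw [← Int.sub_mul_ediv_right _ _ (by norm_num)]
        congr 1; ring
      rw [this, zpow_sub₀ hQ, inv_zpow', zpow_sub₀ (by norm_num : (-1 : ℂ) ≠ 0), neg_sub,
        zpow_sub₀ hz]
      have hm : ((-1 : ℂ) ^ r) * (-1) ^ r = 1 := by rw [← mul_zpow]; norm_num
      have hm0 : ((-1 : ℂ) ^ r) ≠ 0 := left_ne_zero_of_mul_eq_one hm
      norm_num
      field_simp
      linear_combination -hm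
    have e2 : Q ^ (2 - r - 1) = (Q ^ (r - 1))⁻¹ := by rw [← zpow_neg]; congr 1; ring
    rw [e1, e2]
    have h4 : 1 - (Q ^ (r - 1))⁻¹ * (x⁻¹ * z⁻¹) ≠ 0 := by
      intro h
      apply hr
      field_simp at h
      linear_combination -h
    field_simp
    rw [← neg_sub (1 : ℂ), div_neg]
  rw [appellLerch_eq, appellLerch_eq, key, theta_inv hQ hQ1 hz]
  field_simp

/-! ### The rank sum and the function `Λ` -/

/-- `∑ (-1)^n q^(n²) / (1 - z q^(dn))`. -/
def rankSum (d : ℕ) (z q : ℂ) : ℂ := ∑' n : ℤ, thetaTerm (q ^ 2) q n / (1 - (q ^ d) ^ n * z)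

theorem summable_rankSum {d : ℕ} (hd : d ≠ 0) {z q : ℂ} (hq : q ≠ 0) (hq1 : ‖q‖ < 1) (hz : z ≠ 0)
    (hz1 : ∀ r : ℤ, z ≠ (q ^ d) ^ r) :
    Summable fun n : ℤ => ‖thetaTerm (q ^ 2) q n / (1 - (q ^ d) ^ n * z)‖ := by
  obtain ⟨B, -, hB⟩ := exists_bound_inv_one_sub (pow_ne_zero d hq) (norm_pow_lt_one hq1 hd) hz hz1
  simp only [div_eq_mul_inv]
  exact summable_thetaTerm_mul (pow_ne_zero 2 hq) (norm_pow_lt_one hq1 two_ne_zero) hq hB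

theorem ne_sq_zpow {v q : ℂ} (hv : ∀ r : ℤ, v ≠ q ^ r) (r : ℤ) : v ≠ (q ^ 2) ^ r := by
  rw [← zpow_natCast q, ← zpow_mul]; exact hv _

theorem theta_self_sq_ne_zero {q : ℂ} (hq : q ≠ 0) (hq1 : ‖q‖ < 1) : theta q (q ^ 2) ≠ 0 := by
  refine theta_ne_zero (pow_ne_zero 2 hq) (norm_pow_lt_one hq1 two_ne_zero) hq fun r h => ?_
  have h1 : q ^ (2 * r - 1) = 1 := by
    rw [zpow_sub_one₀ hq, zpow_mul, zpow_ofNat, ← h, mul_inv_cancel₀ hq]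
  exact zpow_ne_one_of_norm_lt_one hq hq1 (by omega) h1

/-- In base q² at the point q, the powers of q combine to q^(n²), which is even in n. -/
theorem thetaTerm_self_sq_neg {q : ℂ} (n : ℤ) :
    thetaTerm (q ^ 2) q (-n) = thetaTerm (q ^ 2) q n := by
  unfold thetaTerm
  by_cases hq : q = 0
  · subst hq
    by_cases hn : n = 0
    · simp [hn]
    · simp [zero_zpow, hn]
  have e (r : ℤ) : (q ^ 2) ^ (r * (r - 1) / 2) * q ^ r = q ^ (r ^ 2) := by
    rw [← zpow_natCast q, ← zpow_mul, ← zpow_add₀ hq]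
    congr 1
    have := Int.mul_ediv_cancel' (Int.even_mul_pred_self r).two_dvd
    push_cast
    linear_combination this
  rw [mul_assoc, mul_assoc, e, e, neg_sq, zpow_neg, ← inv_zpow]
  norm_num

/-- `S(z) + S(z⁻¹) = j(q; q²)` for the rank sum `S`. -/
theorem rankSum_add_inv {d : ℕ} (hd : d ≠ 0) {z q : ℂ} (hq : q ≠ 0) (hq1 : ‖q‖ < 1) (hz : z ≠ 0)
    (hz1 : ∀ r : ℤ, z ≠ (q ^ d) ^ r) :
    rankSum d z q + rankSum d z⁻¹ q = theta q (q ^ 2) := by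
  have hz2 (r : ℤ) : z⁻¹ ≠ (q ^ d) ^ r := fun h => hz1 (-r) (by rw [zpow_neg, ← h, inv_inv])
  have hqd := pow_ne_zero d hq
  have s1 := (summable_rankSum hd hq hq1 hz hz1).of_norm
  have s2 := (Equiv.neg ℤ).summable_iff.mpr
    (summable_rankSum hd hq hq1 (inv_ne_zero hz) hz2).of_norm
  simp only [Function.comp_def, Equiv.neg_apply] at s2
  unfold rankSum
  rw [← (Equiv.neg ℤ).tsum_eq fun n => thetaTerm (q ^ 2) q n / (1 - (q ^ d) ^ n * z⁻¹)]
  simp only [Equiv.neg_apply]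
  rw [← s1.tsum_add s2, theta_eq_tsum (pow_ne_zero 2 hq) (norm_pow_lt_one hq1 two_ne_zero) hq]
  -- Termwise this is 1/(1 - y) + 1/(1 - y⁻¹) = 1.
  congr 1; funext n
  have h1 := one_sub_zpow_mul_ne_zero hz1 n
  have h2 := one_sub_zpow_mul_ne_zero hz2 (-n)
  have hn := zpow_ne_zero n hqd
  rw [thetaTerm_self_sq_neg]
  rw [zpow_neg] at h2 ⊢
  have h3 : (q ^ d) ^ n * z - 1 ≠ 0 := fun h => h1 (by linear_combination -h)
  field_simp
  ring

/-- `m(v⁻²q, q², v)` in terms of the rank sum. -/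
theorem appellLerch_eq_rankSum {v q : ℂ} (hq : q ≠ 0) (hq1 : ‖q‖ < 1) (hv0 : v ≠ 0)
    (hv : ∀ r : ℤ, v ≠ q ^ r) (hv2 : ∀ r : ℤ, v ^ 2 ≠ (q ^ 2) ^ r) :
    appellLerch ((v ^ 2)⁻¹ * q) (q ^ 2) v = 1 - rankSum 1 v q / theta q (q ^ 2) := by
  have hQ := pow_ne_zero 2 hq
  have hQ1 := norm_pow_lt_one hq1 two_ne_zero
  have hθ := theta_self_sq_ne_zero hq hq1
  have hadd := rankSum_add_inv one_ne_zero hq hq1 hv0 (fun r => by rw [pow_one]; exact hv r)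
  set w := v⁻¹ with hw
  have hw0 : w ≠ 0 := inv_ne_zero hv0
  have hvw : v = w⁻¹ := by rw [hw, inv_inv]
  have hw2 (r : ℤ) : w ^ 2 ≠ (q ^ 2) ^ r := fun h => hv2 (-r) (by
    rw [zpow_neg, ← h, hw, inv_pow, inv_inv])
  have hu (r : ℤ) : q ^ 2 * w ^ 2 ≠ (q ^ 2) ^ r := fun h => hw2 (r - 1) (by
    rw [zpow_sub_one₀ hQ, ← h]; field_simp)
  have hw1 (r : ℤ) : w ≠ q ^ r := fun h => hv (-r) (by rw [zpow_neg, ← h, hw, inv_inv])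
  have hu0 : q ^ 2 * w ^ 2 ≠ 0 := mul_ne_zero hQ (pow_ne_zero 2 hw0)
  have t1 : theta 1 (q ^ 2) = 0 := by simpa using theta_eq_zero_of_zpow hQ hQ1 0
  -- Write 1/(1 - y) = (1 + y)/(1 - y²) with y = q^r w. The second sum reduces to Z = 1, where
  -- `lerch_one` gives its value. The first is an Appell–Lerch sum with x = w² q and third argument
  -- q, which the three-term relation moves to v.
  have split : rankSum 1 w q =
      lerch (q ^ 2) (q ^ 2 * w ^ 2) q + w * lerch (q ^ 2) (q ^ 2 * w ^ 2) (q ^ 2) := by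
    unfold rankSum lerch
    rw [← tsum_mul_left, ← (summable_lerch hQ hQ1 hu0 hq hu).of_norm.tsum_add
      ((summable_lerch hQ hQ1 hu0 hQ hu).of_norm.mul_left w)]
    congr 1; funext r
    rw [sq q, thetaTerm_mul_right, ← sq q, pow_one]
    have e : (q ^ 2) ^ (r - 1) * (q ^ 2 * w ^ 2) = (q ^ r * w) ^ 2 := by
      rw [← mul_assoc, ← zpow_add_one₀ hQ, sub_add_cancel, mul_pow, ← zpow_natCast q,
        ← zpow_natCast (q ^ r), ← zpow_mul, ← zpow_mul, mul_comm r]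
    have h1 := one_sub_zpow_mul_ne_zero hw1 r
    have h2 := one_sub_zpow_mul_ne_zero hu (r - 1)
    rw [e, show 1 - (q ^ r * w) ^ 2 = (1 - q ^ r * w) * (1 + q ^ r * w) by ring] at h2 ⊢
    have h3 := right_ne_zero_of_mul h2
    field_simp
  have hA := lerch_q_mul hQ hQ1 hu0 one_ne_zero hu
  rw [mul_one, t1, sub_zero] at hA
  have hL := lerch_one hQ hQ1 hu0 hu
  rw [theta_q_mul hQ hQ1 (pow_ne_zero 2 hw0)] at hL
  have hθw := theta_ne_zero hQ hQ1 (pow_ne_zero 2 hw0) hw2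
  have hθv := theta_ne_zero hQ hQ1 hv0 (ne_sq_zpow hv)
  have hwq (r : ℤ) : w * q ≠ q ^ r := fun h => hw1 (r - 1) (by
    rw [zpow_sub_one₀ hq, ← h]; field_simp)
  have hθwq := theta_ne_zero hQ hQ1 (mul_ne_zero hw0 hq) (ne_sq_zpow hwq)
  have e1 : w ^ 2 * q * q = q ^ 2 * w ^ 2 := by ring
  have e2 : w ^ 2 * q * v = w * q := by rw [hvw]; field_simp
  have e3 : q / v = w * q := by rw [hvw]; field_simp
  have e4 : w * q * q = q ^ 2 / v := by rw [hvw]; field_simp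
  have h3 := lerch_three_term (x := w ^ 2 * q) (z₁ := q) (z₀ := v) hQ hQ1
    (mul_ne_zero (pow_ne_zero 2 hw0) hq) hq hv0 (by
      rw [e1]; exact theta_ne_zero hQ hQ1 hu0 hu) (by rwa [e2])
  rw [e1, e2, e3, e4, theta_q_div hQ, theta_q_mul hQ hQ1 (pow_ne_zero 2 hw0)] at h3
  have e5 : (v ^ 2)⁻¹ * q = w ^ 2 * q := by rw [hw, inv_pow]
  rw [e5, appellLerch_eq, e2, eq_sub_of_add_eq hadd, split, hA]
  rw [hvw] at *
  generalize theta (w⁻¹) (q ^ 2) = θv at *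
  generalize theta (w * q) (q ^ 2) = θwq at *
  generalize theta (w ^ 2) (q ^ 2) = θw at *
  generalize lerch (q ^ 2) (q ^ 2 * w ^ 2) 1 = L1 at *
  generalize lerch (q ^ 2) (q ^ 2 * w ^ 2) q = Lq at *
  generalize lerch (q ^ 2) (w * q) w⁻¹ = Lw at *
  generalize theta q (q ^ 2) = θ at *
  generalize J 1 (q ^ 2) = j at *
  field_simp at h3 hL ⊢
  refine mul_left_cancel₀ hθw ?_
  linear_combination -w * h3 + θv * hL

/-- The point v = -1 escapes the general argument because v² = 1 is a power of q². The shift and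
inversion equations force m = 1 - m here, and S(z) + S(z⁻¹) = j(q; q²) makes the other side 1/2 as
well. -/
theorem appellLerch_neg_one_eq_rankSum {q : ℂ} (hq : q ≠ 0) (hq1 : ‖q‖ < 1) :
    appellLerch (((-1) ^ 2)⁻¹ * q) (q ^ 2) (-1) = 1 - rankSum 1 (-1) q / theta q (q ^ 2) := by
  have hQ := pow_ne_zero 2 hq
  have hQ1 := norm_pow_lt_one hq1 two_ne_zero
  have hθ := theta_self_sq_ne_zero hq hq1
  have aux {c : ℤ} (r : ℤ) (hr : c ≠ 2 * r) : -q ^ c ≠ (q ^ 2) ^ r := by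
    intro h
    have h1 := congrArg norm h
    rw [norm_neg, ← zpow_natCast q, ← zpow_mul, norm_zpow, norm_zpow] at h1
    exact hr (zpow_right_injective₀ (norm_pos_iff.mpr hq) hq1.ne h1)
  have hm1 (r : ℤ) : (-1 : ℂ) ≠ q ^ r := by
    intro h
    have h1 := congrArg norm h
    rw [norm_neg, norm_one, norm_zpow, ← zpow_zero ‖q‖] at h1
    have h2 := zpow_right_injective₀ (norm_pos_iff.mpr hq) hq1.ne h1
    rw [← h2, zpow_zero] at h
    norm_num at h
  have hθ1 := theta_ne_zero hQ hQ1 (by norm_num : (-1 : ℂ) ≠ 0) (ne_sq_zpow hm1)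
  have hadd := rankSum_add_inv one_ne_zero hq hq1 (by norm_num : (-1 : ℂ) ≠ 0)
    (fun r => by rw [pow_one]; exact hm1 r)
  have h1 := appellLerch_q_mul (x := q⁻¹) hQ hQ1 (inv_ne_zero hq) (by norm_num : (-1 : ℂ) ≠ 0) hθ1
    (fun r => by simpa using aux (c := -1) r (by omega))
  have h2 := appellLerch_inv (x := q) hQ hQ1 hq (by norm_num : (-1 : ℂ) ≠ 0)
    (fun r => by simpa using aux (c := 1) r (by omega))
  have e : (-1 : ℂ)⁻¹ = -1 := by norm_num
  rw [e] at h2 hadd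
  rw [h2, show q ^ 2 * q⁻¹ = q by field_simp] at h1
  rw [show ((-1 : ℂ) ^ 2)⁻¹ * q = q by norm_num]
  have h3 : appellLerch q (q ^ 2) (-1) = 1 / 2 := by
    field_simp at h1 ⊢
    linear_combination h1
  rw [h3, eq_sub_iff_add_eq]
  field_simp
  linear_combination hadd

/-- For x = v⁻² q⁻¹ the third arguments v and vq give the same value of m, since the numerator of Δ
contains j(x · v · vq) = j(1) = 0. The shift x ↦ q² x does the rest. -/
theorem appellLerch_mul_q {v q : ℂ} (hq : q ≠ 0) (hq1 : ‖q‖ < 1) (hv0 : v ≠ 0)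
    (hv : ∀ r : ℤ, v ≠ q ^ r) :
    appellLerch ((v ^ 2)⁻¹ * q) (q ^ 2) v =
      1 - (v ^ 2)⁻¹ * q⁻¹ * appellLerch (((v * q) ^ 2)⁻¹ * q) (q ^ 2) (v * q) := by
  have hQ := pow_ne_zero 2 hq
  have hQ1 := norm_pow_lt_one hq1 two_ne_zero
  have hx : (v ^ 2)⁻¹ * q⁻¹ ≠ 0 := mul_ne_zero (inv_ne_zero (pow_ne_zero 2 hv0)) (inv_ne_zero hq)
  have hvq (r : ℤ) : v * q ≠ q ^ r := fun h => hv (r - 1) (by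
    rw [zpow_sub_one₀ hq, ← h]; field_simp)
  have h1 (r : ℤ) : (v ^ 2)⁻¹ * q⁻¹ * v ≠ q ^ r := fun h => hvq (-r) (by
    rw [zpow_neg, ← h]; field_simp)
  have h2 (r : ℤ) : (v ^ 2)⁻¹ * q⁻¹ * (v * q) ≠ q ^ r := fun h => hv (-r) (by
    rw [zpow_neg, ← h]; field_simp)
  have t1 : theta 1 (q ^ 2) = 0 := by simpa using theta_eq_zero_of_zpow hQ hQ1 0
  have hvq0 := mul_ne_zero hv0 hq
  have gv := theta_ne_zero hQ hQ1 hv0 (ne_sq_zpow hv)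
  have gvq := theta_ne_zero hQ hQ1 hvq0 (ne_sq_zpow hvq)
  have hD := appellLerch_sub hQ hQ1 hx hvq0 hv0 ⟨gv, gvq,
    theta_ne_zero hQ hQ1 (mul_ne_zero hx hv0) (ne_sq_zpow h1),
    theta_ne_zero hQ hQ1 (mul_ne_zero hx hvq0) (ne_sq_zpow h2)⟩
  rw [Delta, show (v ^ 2)⁻¹ * q⁻¹ * v * (v * q) = 1 by field_simp, t1, mul_zero, zero_div] at hD
  have hS := appellLerch_q_mul hQ hQ1 hx hv0 gv (ne_sq_zpow h1)
  rw [show ((v * q) ^ 2)⁻¹ * q = (v ^ 2)⁻¹ * q⁻¹ by field_simp, sub_eq_zero.mp hD, ← hS]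
  congr 1
  field_simp

end OverRank

/-! ### Evaluation of Λ on the unit circle. -/

namespace OverRank
open Filter Topology Finset

theorem ne_zpow_of_norm_eq_one {v Q : ℂ} (hQ : Q ≠ 0) (hQ1 : ‖Q‖ < 1) (hv : ‖v‖ = 1) (hv1 : v ≠ 1)
    (r : ℤ) : v ≠ Q ^ r := by
  rintro rfl
  rw [norm_zpow, ← zpow_zero ‖Q‖] at hv
  have := zpow_right_injective₀ (norm_pos_iff.mpr hQ) hQ1.ne hv
  exact hv1 (by rw [this, zpow_zero])

theorem appellLerch_eq_rankSum_of_norm {v q : ℂ} (hq : q ≠ 0) (hq1 : ‖q‖ < 1) (hv : ‖v‖ = 1)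
    (hv1 : v ≠ 1) :
    appellLerch ((v ^ 2)⁻¹ * q) (q ^ 2) v = 1 - rankSum 1 v q / theta q (q ^ 2) := by
  by_cases hm : v = -1
  · rw [hm]; exact appellLerch_neg_one_eq_rankSum hq hq1
  · refine appellLerch_eq_rankSum hq hq1 (norm_ne_zero_iff.mp (by rw [hv]; norm_num))
      (ne_zpow_of_norm_eq_one hq hq1 hv hv1) (ne_zpow_of_norm_eq_one (pow_ne_zero 2 hq)
        (norm_pow_lt_one hq1 two_ne_zero) (by rw [norm_pow, hv, one_pow]) fun h => ?_)
    rcases mul_self_eq_one_iff.mp ((sq v).symm.trans h) with h | h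
    · exact hv1 h
    · exact hm h

/-- The prefactor is that of Λ with d = 2k + 1. The leftover monomials are even powers of v between
2 and 2k, which vanish on averaging over the d-th roots of z. -/
theorem appellLerch_shift {v q : ℂ} (hq : q ≠ 0) (hq1 : ‖q‖ < 1) (hv0 : v ≠ 0)
    (hv : ∀ r : ℤ, v ≠ q ^ r) (k : ℕ) :
    (-1) ^ (k + 1) * (q ^ k ^ 2)⁻¹ * v ^ (2 * k) *
        appellLerch (((v * (q ^ k)⁻¹) ^ 2)⁻¹ * q) (q ^ 2) (v * (q ^ k)⁻¹) =
      -appellLerch ((v ^ 2)⁻¹ * q) (q ^ 2) v +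
        ∑ i ∈ range k, (-1) ^ i * (q ^ (i + 1) ^ 2)⁻¹ * v ^ (2 * (i + 1)) := by
  induction k with
  | zero => simp
  | succ k ih =>
    rw [sum_range_succ, ← add_assoc, ← ih]
    have hqk : q ^ (k + 1) ≠ 0 := pow_ne_zero _ hq
    have h := appellLerch_mul_q (v := v * (q ^ (k + 1))⁻¹) hq hq1
      (mul_ne_zero hv0 (inv_ne_zero hqk)) (fun r hr => hv (r + (k + 1 : ℕ)) (by
        rw [zpow_add₀ hq, ← hr, zpow_natCast]; field_simp))
    rw [h, show v * (q ^ (k + 1))⁻¹ * q = v * (q ^ k)⁻¹ by rw [pow_succ]; field_simp]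
    generalize appellLerch _ _ (v * (q ^ k)⁻¹) = F
    rw [show (k + 1) ^ 2 = k ^ 2 + k + k + 1 by ring, show 2 * (k + 1) = 2 * k + 2 by ring]
    simp only [pow_add, pow_one]
    field_simp
    ring

theorem primitiveRoot_pow_mul_pow {d : ℕ} {ξ : ℂ} (hξ : IsPrimitiveRoot ξ d) (w : ℂ) (t : ℕ) :
    (ξ ^ t * w) ^ d = w ^ d := by
  rw [mul_pow, ← pow_mul, mul_comm t, pow_mul, hξ.pow_eq_one, one_pow, one_mul]

/-- Termwise this is ∑ 1/(1 - ξ^t y) = d/(1 - y^d) with y = q^n w. -/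
theorem sum_rankSum_one {d : ℕ} {ξ w q : ℂ} (hξ : IsPrimitiveRoot ξ d) (hd : d ≠ 0) (hq : q ≠ 0)
    (hq1 : ‖q‖ < 1) (hw : ‖w‖ = 1) (hw1 : w ^ d ≠ 1) :
    ∑ t ∈ range d, rankSum 1 (ξ ^ t * w) q = d * rankSum d (w ^ d) q := by
  have hw0 : w ≠ 0 := norm_ne_zero_iff.mp (by rw [hw]; norm_num)
  have hξ0 := hξ.ne_zero hd
  have hv (t : ℕ) (r : ℤ) : ξ ^ t * w ≠ (q ^ 1) ^ r := by
    rw [pow_one]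
    refine ne_zpow_of_norm_eq_one hq hq1 ?_ (fun h => hw1 ?_) r
    · rw [norm_mul, norm_pow, hξ.norm'_eq_one hd, hw]; simp
    · rw [← primitiveRoot_pow_mul_pow hξ w t, h, one_pow]
  unfold rankSum
  rw [← tsum_mul_left, ← Summable.tsum_finsetSum fun t _ => (summable_rankSum one_ne_zero hq hq1
    (mul_ne_zero (pow_ne_zero _ hξ0) hw0) (hv t)).of_norm]
  congr 1; funext n
  have hy : (q ^ n * w) ^ d ≠ 1 := by
    intro h
    refine ne_zpow_of_norm_eq_one (pow_ne_zero d hq) (norm_pow_lt_one hq1 hd)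
      (by rw [norm_pow, hw, one_pow]) hw1 (-n) ?_
    rw [mul_pow, ← zpow_natCast, ← zpow_mul, mul_comm n, zpow_mul, zpow_natCast] at h
    rw [zpow_neg]
    exact eq_inv_of_mul_eq_one_right h
  have h := sum_div_one_sub_primitiveRoot hξ (Nat.pos_of_ne_zero hd) hy
  simp only [Nat.cast_zero, zero_mul, neg_zero, zpow_zero, pow_zero] at h
  have e : (q ^ d) ^ n * w ^ d = (q ^ n * w) ^ d := by
    rw [mul_pow, ← zpow_natCast q, ← zpow_natCast (q ^ n), ← zpow_mul, ← zpow_mul, mul_comm n]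
  rw [e, ← mul_one_div (thetaTerm _ _ _), mul_left_comm, ← h, mul_sum]
  refine sum_congr rfl fun t _ => ?_
  rw [pow_one, mul_left_comm, mul_one_div]

/-- By orthogonality Ψ is an average of series m(·, q², z₀) minus a multiple of m(·, q^(2d²), z').
Each Δ replaces z₀ by v_t q^(-k), where v_t = ξ^t w, so z₀ drops out. `appellLerch_shift` removes
q^(-k) and the average of the rank sums in the v_t is S(w^d). -/
theorem Lambda_eq {d k : ℕ} {ξ w z₀ z' q : ℂ} (hd : d = 2 * k + 1) (hξ : IsPrimitiveRoot ξ d)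
    (hq : q ≠ 0) (hq1 : ‖q‖ < 1) (hw : ‖w‖ = 1) (hw1 : w ^ d ≠ 1) (hz₀ : z₀ ≠ 0) (hz' : z' ≠ 0)
    (hg : LambdaGeneric d ξ w z₀ z' q) :
    Lambda d ξ w z₀ z' q = rankSum d (w ^ d) q / theta q (q ^ 2) - 1 +
      appellLerch (((w ^ d) ^ 2)⁻¹ * q ^ d ^ 2) (q ^ (2 * d ^ 2)) z' := by
  obtain ⟨gΨ, gΔ⟩ := hg
  have hd0 : d ≠ 0 := by omega
  have hdk : (d - 1) / 2 = k := by omega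
  have hQ := pow_ne_zero 2 hq
  have hQ1 := norm_pow_lt_one hq1 two_ne_zero
  have hw0 : w ≠ 0 := norm_ne_zero_iff.mp (by rw [hw]; norm_num)
  have hξ0 := hξ.ne_zero hd0
  have hη : IsPrimitiveRoot (ξ ^ 2)⁻¹ d := (hξ.pow_of_coprime 2 (by
    rw [hd]; simp)).inv
  have hx : w ^ (-2 : ℤ) * q ^ d ≠ 0 := mul_ne_zero (zpow_ne_zero _ hw0) (pow_ne_zero _ hq)
  rw [hdk] at gΨ
  have hO := sum_zpow_appellLerch hη (by omega : k < d) hQ hQ1 hx hz₀ hz' gΨ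
  have hv (t : ℕ) : ‖ξ ^ t * w‖ = 1 := by
    rw [norm_mul, norm_pow, hξ.norm'_eq_one hd0, hw]; simp
  have hv1 (t : ℕ) : ξ ^ t * w ≠ 1 := by
    intro h
    exact hw1 (by rw [← primitiveRoot_pow_mul_pow hξ w t, h, one_pow])
  have hv0 (t : ℕ) : ξ ^ t * w ≠ 0 := mul_ne_zero (pow_ne_zero _ hξ0) hw0
  have hexp : -(((d : ℤ) - 1) / 2) = -(k : ℤ) := by rw [hd]; push_cast; omega
  have hexp2 : -(((d : ℤ) - 1) ^ 2 / 4) = -((k ^ 2 : ℕ) : ℤ) := by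
    rw [hd]; push_cast
    rw [show (2 * (k : ℤ) + 1 - 1) ^ 2 = k ^ 2 * 4 by ring, Int.mul_ediv_cancel _ (by norm_num)]
  have eξ (t : ℕ) : ξ ^ (-(2 * t : ℤ)) = ((ξ ^ t) ^ 2)⁻¹ := by
    rw [zpow_neg, ← pow_mul, mul_comm t, ← zpow_natCast ξ]; push_cast; rfl
  have ew : w ^ (-2 : ℤ) = (w ^ 2)⁻¹ := by rw [zpow_neg]; rfl
  have eη (t : ℕ) : (ξ ^ 2)⁻¹ ^ t * (w ^ (-2 : ℤ) * q ^ d) =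
      ξ ^ (-(2 * t : ℤ)) * w ^ (-2 : ℤ) * q ^ d := by
    rw [eξ, inv_pow, ← pow_mul, mul_comm 2 t, pow_mul]; ring
  -- Here 2k = d - 1 is congruent to -1 modulo d, which accounts for the index (d - 1)/2 of Ψ.
  have eη2 (t : ℕ) : (ξ ^ 2)⁻¹ ^ (-((k : ℤ) * t)) = ξ ^ (-(t : ℤ)) := by
    have : ξ ^ (d : ℤ) = 1 := by rw [zpow_natCast]; exact hξ.pow_eq_one
    rw [inv_zpow', ← zpow_natCast ξ, ← zpow_mul, neg_neg,
      show ((2 : ℕ) : ℤ) * (k * t) = d * t - t by rw [hd]; push_cast; ring, zpow_sub₀ hξ0, zpow_mul,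
      this, one_zpow, zpow_neg, one_div]
  have eA (t : ℕ) : ξ ^ (-(2 * t : ℤ)) * w ^ (-2 : ℤ) * q ^ d =
      ((ξ ^ t * w * (q ^ k)⁻¹) ^ 2)⁻¹ * q := by
    rw [eξ, ew, show q ^ d = (q ^ k) ^ 2 * q by rw [hd]; ring]
    field_simp
  simp only [eη, eη2] at hO
  have hΔ : ∀ t ∈ range d, ξ ^ (-(t : ℤ)) *
      Delta (ξ ^ (-(2 * t : ℤ)) * w ^ (-2 : ℤ) * q ^ d)
        (ξ ^ t * w * q ^ (-(((d : ℤ) - 1) / 2))) z₀ (q ^ 2) =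
      ξ ^ (-(t : ℤ)) * appellLerch (((ξ ^ t * w * (q ^ k)⁻¹) ^ 2)⁻¹ * q) (q ^ 2)
        (ξ ^ t * w * (q ^ k)⁻¹) -
      ξ ^ (-(t : ℤ)) * appellLerch (ξ ^ (-(2 * t : ℤ)) * w ^ (-2 : ℤ) * q ^ d) (q ^ 2) z₀ := by
    intro t ht
    have g := gΔ t (mem_range.mp ht)
    have e : q ^ (-(((d : ℤ) - 1) / 2)) = (q ^ k)⁻¹ := by rw [hexp, zpow_neg, zpow_natCast]
    rw [e] at g ⊢
    rw [← appellLerch_sub hQ hQ1 (mul_ne_zero (mul_ne_zero (zpow_ne_zero _ hξ0)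
      (zpow_ne_zero _ hw0)) (pow_ne_zero _ hq)) (mul_ne_zero (hv0 t)
      (inv_ne_zero (pow_ne_zero _ hq))) hz₀ g, mul_sub, eA t]
  have hdC : (d : ℂ) ≠ 0 := by exact_mod_cast hd0
  have hsum : ∑ t ∈ range d, (-1) ^ (k + 1) * (q ^ k ^ 2)⁻¹ * w ^ (2 * k) *
      (ξ ^ (-(t : ℤ)) * appellLerch (((ξ ^ t * w * (q ^ k)⁻¹) ^ 2)⁻¹ * q) (q ^ 2)
        (ξ ^ t * w * (q ^ k)⁻¹)) = d * (rankSum d (w ^ d) q / theta q (q ^ 2) - 1) := by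
    have h1 : ∀ t ∈ range d, (-1) ^ (k + 1) * (q ^ k ^ 2)⁻¹ * w ^ (2 * k) *
        (ξ ^ (-(t : ℤ)) * appellLerch (((ξ ^ t * w * (q ^ k)⁻¹) ^ 2)⁻¹ * q) (q ^ 2)
        (ξ ^ t * w * (q ^ k)⁻¹)) = rankSum 1 (ξ ^ t * w) q / theta q (q ^ 2) - 1 +
        ∑ i ∈ range k, (-1) ^ i * (q ^ (i + 1) ^ 2)⁻¹ * w ^ (2 * (i + 1)) *
          (ξ ^ ((2 * (i + 1) : ℕ) : ℤ)) ^ t := by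
      intro t _
      have e : ξ ^ (-(t : ℤ)) = (ξ ^ t) ^ (2 * k) := by
        rw [← eη2 t, inv_zpow', neg_neg, show (k : ℤ) * t = ((k * t : ℕ) : ℤ) by push_cast; rfl,
          zpow_natCast, ← pow_mul, ← pow_mul]
        congr 1; ring
      have h2 := appellLerch_shift hq hq1 (hv0 t) (ne_zpow_of_norm_eq_one hq hq1 (hv t) (hv1 t)) k
      rw [appellLerch_eq_rankSum_of_norm hq hq1 (hv t) (hv1 t), mul_pow (ξ ^ t) w (2 * k)] at h2
      rw [e]
      refine Eq.trans (by ring) (h2.trans ?_)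
      rw [neg_sub]
      congr 1
      refine sum_congr rfl fun i _ => ?_
      rw [zpow_natCast, ← pow_mul, mul_pow, ← pow_mul, mul_comm t]
      ring
    rw [sum_congr rfl h1, sum_add_distrib, sum_comm, sum_eq_zero (s := range k), sum_sub_distrib,
      ← sum_div, sum_rankSum_one hξ hd0 hq hq1 hw hw1]
    · simp; ring
    · intro i hi
      -- Since 0 < 2(i + 1) ≤ 2k < d, the exponent is not divisible by d.
      rw [← mul_sum, sum_zpow_primitiveRoot hξ, if_neg, mul_zero]
      intro h
      have h3 := Nat.le_of_dvd (by omega) (Int.natCast_dvd_natCast.mp h)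
      have := mem_range.mp hi
      omega
  rw [← mul_sum] at hsum
  rw [Lambda, sum_congr rfl hΔ, sum_sub_distrib, hO, hdk, hexp2, zpow_neg, zpow_natCast,
    show (d + 1) / 2 = k + 1 by omega, show d - 1 = 2 * k by omega]
  have hch : (d.choose 2 : ℤ) - d * k = 0 := by
    have := two_mul_choose_two_add d
    have h2 : (2 * d.choose 2 + d : ℤ) = d ^ 2 := by exact_mod_cast this
    have h3 : (d : ℤ) = 2 * k + 1 := by exact_mod_cast hd
    nlinarith
  have eX : -(q ^ 2) ^ ((d.choose 2 : ℤ) - d * k) * (-(w ^ (-2 : ℤ) * q ^ d)) ^ d =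
      ((w ^ d) ^ 2)⁻¹ * q ^ d ^ 2 := by
    have hodd : Odd d := ⟨k, hd⟩
    rw [hch, zpow_zero, hodd.neg_pow, neg_one_mul, neg_neg, mul_pow, ← pow_mul q, sq d]
    congr 1
    rw [zpow_neg, inv_pow, ← pow_mul, mul_comm d, pow_mul]; rfl
  rw [eX, ← pow_mul q 2 (d ^ 2)]
  generalize appellLerch _ _ z' = m'
  generalize Psi _ _ _ _ _ _ = ψ
  generalize ∑ t ∈ range d, ξ ^ (-(t : ℤ)) * appellLerch (((ξ ^ t * w * (q ^ k)⁻¹) ^ 2)⁻¹ * q)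
    (q ^ 2) (ξ ^ t * w * (q ^ k)⁻¹) = S at *
  -- The prefactor of Λ is the negative reciprocal of the coefficient of m(·, ·, z') in the
  -- orthogonality relation.
  have hcoef : (-1) ^ (k + 1) * (q ^ k ^ 2)⁻¹ * w ^ (2 * k) *
      (((q ^ 2) ^ (k + 1).choose 2)⁻¹ * (-(w ^ (-2 : ℤ) * q ^ d)) ^ k) = -1 := by
    have h1 := two_mul_choose_two_add (k + 1)
    have h2 : 2 * (k + 1).choose 2 = k ^ 2 + k := by nlinarith
    rw [← pow_mul, h2, ew, neg_pow ((w ^ 2)⁻¹ * q ^ d), mul_pow, ← pow_mul q, hd,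
      show (2 * k + 1) * k = k ^ 2 + (k ^ 2 + k) by ring, pow_add q (k ^ 2) (k ^ 2 + k), pow_mul w,
      inv_pow, pow_succ (-1 : ℂ)]
    have hm : ((-1 : ℂ) ^ k) * (-1) ^ k = 1 := by rw [← mul_pow]; norm_num
    field_simp
    linear_combination -hm
  have hS : (-1) ^ (k + 1) * (q ^ k ^ 2)⁻¹ * w ^ (2 * k) * (1 / d * S) =
      rankSum d (w ^ d) q / theta q (q ^ 2) - 1 := by
    rw [← mul_right_inj' hdC, ← hsum]
    field_simp
  generalize ((q ^ 2) ^ (k + 1).choose 2)⁻¹ * (-(w ^ (-2 : ℤ) * q ^ d)) ^ k = c at *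
  have hd1 : 1 / (d : ℂ) * d = 1 := by field_simp
  linear_combination hS - m' * hcoef -
    (-1) ^ (k + 1) * (q ^ k ^ 2)⁻¹ * w ^ (2 * k) * (c * m' + ψ) * hd1

end OverRank

namespace OverRank
open Filter Topology Finset

/-! ### Evaluation of formal power series -/

open PowerSeries (coeff constantCoeff)

/-- `∑ ‖f_n‖ r^n` converges and is at most `B`. -/
def WBound (r : ℝ) (f : PowerSeries ℂ) (B : ℝ) : Prop :=
  Summable (fun n => ‖coeff n f‖ * r ^ n) ∧ ∑' n, ‖coeff n f‖ * r ^ n ≤ B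

/-- The value at `q` of a formal power series. -/
def evalSeries (q : ℂ) (f : PowerSeries ℂ) : ℂ := ∑' n, coeff n f * q ^ n

section WBound
variable {r : ℝ} {f g : PowerSeries ℂ} {A B : ℝ}

theorem WBound.of_partial (hr : 0 ≤ r)
    (h : ∀ N, ∑ n ∈ range N, ‖coeff n f‖ * r ^ n ≤ B) : WBound r f B := by
  have h0 : ∀ n, 0 ≤ ‖coeff n f‖ * r ^ n := fun n => by positivity
  exact ⟨summable_of_sum_range_le h0 h, Real.tsum_le_of_sum_range_le h0 h⟩

theorem WBound.sum_range_le (hr : 0 ≤ r) (h : WBound r f B) (N : ℕ) :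
    ∑ n ∈ range N, ‖coeff n f‖ * r ^ n ≤ B :=
  (h.1.sum_le_tsum _ fun n _ => by positivity).trans h.2

theorem WBound.nonneg (hr : 0 ≤ r) (h : WBound r f B) : 0 ≤ B := by
  simpa using h.sum_range_le hr 0

theorem WBound.mono (h : WBound r f A) (hAB : A ≤ B) : WBound r f B := ⟨h.1, h.2.trans hAB⟩

theorem WBound.add (hr : 0 ≤ r) (hf : WBound r f A) (hg : WBound r g B) :
    WBound r (f + g) (A + B) := by
  refine .of_partial hr fun N => ?_
  refine le_trans ?_ (add_le_add (hf.sum_range_le hr N) (hg.sum_range_le hr N))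
  rw [← sum_add_distrib]
  refine sum_le_sum fun n _ => ?_
  rw [← add_mul, map_add]
  gcongr
  exact norm_add_le _ _

theorem norm_coeff_mul_le (hr : 0 ≤ r) (f g : PowerSeries ℂ) (n : ℕ) :
    ‖coeff n (f * g)‖ * r ^ n ≤
      ∑ p ∈ antidiagonal n, (‖coeff p.1 f‖ * r ^ p.1) * (‖coeff p.2 g‖ * r ^ p.2) := by
  rw [PowerSeries.coeff_mul]
  calc _ ≤ (∑ p ∈ antidiagonal n, ‖coeff p.1 f * coeff p.2 g‖) * r ^ n := by
        gcongr; exact norm_sum_le _ _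
    _ = _ := by
      rw [sum_mul]
      refine sum_congr rfl fun p hp => ?_
      rw [← mem_antidiagonal.mp hp, norm_mul, pow_add]; ring

theorem WBound.mul (hr : 0 ≤ r) (hf : WBound r f A) (hg : WBound r g B) :
    WBound r (f * g) (A * B) := by
  have hf' : Summable fun n => ‖‖coeff n f‖ * r ^ n‖ := hf.1.norm
  have hg' : Summable fun n => ‖‖coeff n g‖ * r ^ n‖ := hg.1.norm
  have h1 := summable_sum_mul_antidiagonal_of_summable_norm' hf' hf.1 hg' hg.1
  have h2 := tsum_mul_tsum_eq_tsum_sum_antidiagonal_of_summable_norm hf' hg'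
  have h3 : Summable fun n => ‖coeff n (f * g)‖ * r ^ n :=
    h1.of_nonneg_of_le (fun n => by positivity) (norm_coeff_mul_le hr f g)
  refine ⟨h3, (h3.tsum_le_tsum (norm_coeff_mul_le hr f g) h1).trans ?_⟩
  rw [← h2]
  exact mul_le_mul hf.2 hg.2 (tsum_nonneg fun n => by positivity) (hf.nonneg hr)

theorem WBound.C (c : ℂ) : WBound r (PowerSeries.C c) ‖c‖ := by
  have h : ∀ n ≠ 0, ‖coeff n (PowerSeries.C c)‖ * r ^ n = 0 := fun n hn => by
    simp [PowerSeries.coeff_C, hn]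
  exact ⟨(hasSum_single 0 h).summable, by rw [tsum_eq_single 0 h]; simp⟩

theorem WBound.one : WBound r 1 1 := by simpa using WBound.C (r := r) 1

theorem WBound.X_pow (m : ℕ) : WBound r (PowerSeries.X ^ m) (r ^ m) := by
  have h : ∀ n ≠ m, ‖coeff n (PowerSeries.X ^ m : PowerSeries ℂ)‖ * r ^ n = 0 := fun n hn => by
    simp [PowerSeries.coeff_X_pow, hn]
  exact ⟨(hasSum_single m h).summable, by rw [tsum_eq_single m h]; simp⟩

theorem WBound.neg (hf : WBound r f A) : WBound r (-f) A := by
  simpa [WBound] using hf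

theorem WBound.C_mul_X_pow (hr : 0 ≤ r) (c : ℂ) (m : ℕ) :
    WBound r (PowerSeries.C c * PowerSeries.X ^ m) (‖c‖ * r ^ m) :=
  (WBound.C c).mul hr (WBound.X_pow m)

theorem WBound.pow (hr : 0 ≤ r) (hf : WBound r f A) (n : ℕ) : WBound r (f ^ n) (A ^ n) := by
  induction n with
  | zero => simpa using WBound.one
  | succ n ih => rw [pow_succ, pow_succ]; exact ih.mul hr hf

theorem WBound.sum {ι : Type*} (hr : 0 ≤ r) (s : Finset ι) {F : ι → PowerSeries ℂ} {b : ι → ℝ}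
    (h : ∀ i ∈ s, WBound r (F i) (b i)) : WBound r (∑ i ∈ s, F i) (∑ i ∈ s, b i) := by
  classical
  induction s using Finset.induction_on with
  | empty => simpa using (WBound.C (r := r) 0)
  | insert i s hi ih =>
    rw [sum_insert hi, sum_insert hi]
    exact (h i (mem_insert_self _ _)).add hr (ih fun j hj => h j (mem_insert_of_mem hj))

theorem WBound.prod {ι : Type*} (hr : 0 ≤ r) (s : Finset ι) {F : ι → PowerSeries ℂ} {b : ι → ℝ}
    (h : ∀ i ∈ s, WBound r (F i) (b i)) : WBound r (∏ i ∈ s, F i) (∏ i ∈ s, b i) := by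
  classical
  induction s using Finset.induction_on with
  | empty => simpa using WBound.one
  | insert i s hi ih =>
    rw [prod_insert hi, prod_insert hi]
    exact (h i (mem_insert_self _ _)).mul hr (ih fun j hj => h j (mem_insert_of_mem hj))

theorem constantCoeff_one_sub {Y : PowerSeries ℂ} (hY : constantCoeff Y = 0) :
    constantCoeff (1 - Y) ≠ 0 := by simp [hY]

/-- Below degree N the inverse agrees with ∑_{i<N} Y^i, because X^N divides Y^N; the geometric
series in y bounds the partial sums. -/
theorem WBound.inv {Y : PowerSeries ℂ} {y : ℝ} (hr : 0 ≤ r) (hY : constantCoeff Y = 0)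
    (h : WBound r Y y) (hy : y < 1) : WBound r (1 - Y)⁻¹ (1 - y)⁻¹ := by
  have hy0 := h.nonneg hr
  refine .of_partial hr fun N => ?_
  have e : (1 - Y)⁻¹ = ∑ i ∈ range N, Y ^ i + Y ^ N * (1 - Y)⁻¹ := by
    rw [PowerSeries.inv_eq_iff_mul_eq_one (constantCoeff_one_sub hY), add_mul, mul_assoc,
      PowerSeries.inv_mul_cancel _ (constantCoeff_one_sub hY), geom_sum_mul_neg]
    ring
  have e2 : ∀ n ∈ range N, ‖coeff n (1 - Y)⁻¹‖ * r ^ n =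
      ‖coeff n (∑ i ∈ range N, Y ^ i)‖ * r ^ n := by
    intro n hn
    have hdvd : (PowerSeries.X : PowerSeries ℂ) ^ N ∣ Y ^ N * (1 - Y)⁻¹ :=
      (pow_dvd_pow_of_dvd (PowerSeries.X_dvd_iff.mpr hY) N).mul_right _
    rw [e, map_add, PowerSeries.X_pow_dvd_iff.mp hdvd n (mem_range.mp hn), add_zero]
  rw [sum_congr rfl e2]
  refine ((WBound.sum hr (range N) fun i _ => h.pow hr i).sum_range_le hr N).trans ?_
  rw [← tsum_geometric_of_lt_one hy0 hy]
  exact (summable_geometric_of_lt_one hy0 hy).sum_le_tsum _ fun i _ => pow_nonneg hy0 i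

end WBound

section evalSeries
variable {q : ℂ} {f g : PowerSeries ℂ} {A B : ℝ}

theorem WBound.summable_norm (h : WBound ‖q‖ f A) : Summable fun n => ‖coeff n f * q ^ n‖ := by
  simpa [norm_mul, norm_pow] using h.1

theorem evalSeries_mul (hf : WBound ‖q‖ f A) (hg : WBound ‖q‖ g B) :
    evalSeries q (f * g) = evalSeries q f * evalSeries q g := by
  unfold evalSeries
  rw [tsum_mul_tsum_eq_tsum_sum_antidiagonal_of_summable_norm hf.summable_norm hg.summable_norm]
  congr 1; funext n
  rw [PowerSeries.coeff_mul, sum_mul]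
  refine sum_congr rfl fun p hp => ?_
  rw [← mem_antidiagonal.mp hp, pow_add]; ring

theorem evalSeries_add (hf : WBound ‖q‖ f A) (hg : WBound ‖q‖ g B) :
    evalSeries q (f + g) = evalSeries q f + evalSeries q g := by
  unfold evalSeries
  rw [← hf.summable_norm.of_norm.tsum_add hg.summable_norm.of_norm]
  congr 1; funext n
  rw [map_add, add_mul]

theorem evalSeries_C (c : ℂ) : evalSeries q (PowerSeries.C c) = c := by
  unfold evalSeries
  rw [tsum_eq_single 0 fun n hn => by simp [PowerSeries.coeff_C, hn]]
  simp

theorem evalSeries_one : evalSeries q 1 = 1 := by simpa using evalSeries_C (q := q) 1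

theorem evalSeries_X_pow (m : ℕ) : evalSeries q (PowerSeries.X ^ m) = q ^ m := by
  unfold evalSeries
  rw [tsum_eq_single m fun n hn => by simp [PowerSeries.coeff_X_pow, hn]]
  simp

theorem evalSeries_C_mul_X_pow (c : ℂ) (m : ℕ) :
    evalSeries q (PowerSeries.C c * PowerSeries.X ^ m) = c * q ^ m := by
  rw [evalSeries_mul (WBound.C c) (WBound.X_pow m), evalSeries_C, evalSeries_X_pow]

theorem evalSeries_neg (f : PowerSeries ℂ) : evalSeries q (-f) = -evalSeries q f := by
  unfold evalSeries
  rw [← tsum_neg]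
  congr 1; funext n
  simp

theorem evalSeries_sum {ι : Type*} (s : Finset ι) {F : ι → PowerSeries ℂ} {b : ι → ℝ}
    (h : ∀ i ∈ s, WBound ‖q‖ (F i) (b i)) :
    evalSeries q (∑ i ∈ s, F i) = ∑ i ∈ s, evalSeries q (F i) := by
  classical
  induction s using Finset.induction_on with
  | empty => simpa using evalSeries_C (q := q) 0
  | insert i s hi ih =>
    have h' : ∀ j ∈ s, WBound ‖q‖ (F j) (b j) := fun j hj => h j (mem_insert_of_mem hj)
    rw [sum_insert hi, sum_insert hi, evalSeries_add (h i (mem_insert_self _ _))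
      (WBound.sum (norm_nonneg q) s h'), ih h']

theorem evalSeries_prod {ι : Type*} (s : Finset ι) {F : ι → PowerSeries ℂ} {b : ι → ℝ}
    (h : ∀ i ∈ s, WBound ‖q‖ (F i) (b i)) :
    evalSeries q (∏ i ∈ s, F i) = ∏ i ∈ s, evalSeries q (F i) := by
  classical
  induction s using Finset.induction_on with
  | empty => simpa using evalSeries_one
  | insert i s hi ih =>
    have h' : ∀ j ∈ s, WBound ‖q‖ (F j) (b j) := fun j hj => h j (mem_insert_of_mem hj)
    rw [prod_insert hi, prod_insert hi, evalSeries_mul (h i (mem_insert_self _ _))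
      (WBound.prod (norm_nonneg q) s h'), ih h']

theorem evalSeries_inv {Y : PowerSeries ℂ} {y : ℝ} (hY : constantCoeff Y = 0)
    (h : WBound ‖q‖ Y y) (hy : y < 1) : evalSeries q (1 - Y)⁻¹ = (1 - evalSeries q Y)⁻¹ := by
  have h1 : WBound ‖q‖ (1 - Y) (1 + y) := by
    rw [sub_eq_add_neg]; exact WBound.one.add (norm_nonneg q) h.neg
  have h2 := evalSeries_mul (WBound.inv (norm_nonneg q) hY h hy) h1
  rw [PowerSeries.inv_mul_cancel _ (constantCoeff_one_sub hY), evalSeries_one, sub_eq_add_neg,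
    evalSeries_add WBound.one h.neg, evalSeries_one, evalSeries_neg, ← sub_eq_add_neg,
    ← sub_eq_add_neg] at h2
  exact eq_inv_of_mul_eq_one_left h2.symm

/-- Passage to the limit in a sequence of power series whose coefficients stabilize. -/
theorem tendsto_evalSeries {F : PowerSeries ℂ} {f : ℕ → PowerSeries ℂ} {ρ : ℝ}
    (hF : ∀ K n, n ≤ K → coeff n F = coeff n (f K)) (hq : ‖q‖ < ρ)
    (hB : ∀ K, WBound ρ (f K) B) :
    Summable (fun n => coeff n F * q ^ n) ∧
      Tendsto (fun K => evalSeries q (f K)) atTop (𝓝 (evalSeries q F)) := by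
  have hρ : 0 < ρ := (norm_nonneg q).trans_lt hq
  -- A bound at the larger radius ρ gives |coefficient| ≤ B ρ^(-n) uniformly in K, hence a geometric
  -- majorant at q.
  have bound (K n : ℕ) : ‖coeff n (f K) * q ^ n‖ ≤ B * (‖q‖ / ρ) ^ n := by
    have h1 : ‖coeff n (f K)‖ * ρ ^ n ≤ B :=
      ((hB K).1.le_tsum n fun m _ => by positivity).trans (hB K).2
    rw [norm_mul, norm_pow, div_pow, ← mul_div_assoc, le_div_iff₀ (by positivity)]
    calc _ = ‖coeff n (f K)‖ * ρ ^ n * ‖q‖ ^ n := by ring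
      _ ≤ _ := by gcongr
  have hs : Summable fun n : ℕ => B * (‖q‖ / ρ) ^ n :=
    (summable_geometric_of_lt_one (by positivity) ((div_lt_one hρ).mpr hq)).mul_left B
  refine ⟨Summable.of_norm_bounded hs fun n => ?_, ?_⟩
  · rw [hF n n le_rfl]; exact bound n n
  · refine tendsto_tsum_of_dominated_convergence hs (fun n => ?_)
      (Eventually.of_forall fun K n => bound K n)
    refine tendsto_const_nhds.congr' ?_
    filter_upwards [eventually_ge_atTop n] with K hK
    rw [hF K n hK]

end evalSeries

end OverRank

namespace OverRank
open Filter Topology Finset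

/-! ### The rank generating function at a complex number -/

open PowerSeries (coeff constantCoeff X)

/-- The image of `rankTrunc d K` under `z ↦ u`. -/
def truncAt (d : ℕ) (u : ℂ) (K : ℕ) : PowerSeries ℂ :=
  (∏ k ∈ Icc 1 K, (1 + X ^ k)) * (∏ k ∈ Icc 1 K, (1 - X ^ k)⁻¹) *
    (1 + 2 * ∑ n ∈ Icc 1 K, PowerSeries.C ((1 - u) * (1 - u⁻¹) * (-1) ^ n) *
      X ^ (n ^ 2 + d * n) *
      ((1 - PowerSeries.C u * X ^ (d * n))⁻¹ * (1 - PowerSeries.C u⁻¹ * X ^ (d * n))⁻¹))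

theorem prod_inv_of_constantCoeff {ι : Type*} (s : Finset ι) {F : ι → PowerSeries ℂ}
    (h : ∀ i ∈ s, constantCoeff (F i) ≠ 0) : ∏ i ∈ s, (F i)⁻¹ = (∏ i ∈ s, F i)⁻¹ := by
  have h' : constantCoeff (∏ i ∈ s, F i) ≠ 0 := by
    rw [map_prod]; exact prod_ne_zero_iff.mpr h
  rw [eq_comm, PowerSeries.inv_eq_iff_mul_eq_one h', ← prod_mul_distrib]
  exact prod_eq_one fun i hi => PowerSeries.inv_mul_cancel _ (h i hi)

theorem map_invOfUnit_one {R : Type*} [CommRing R] (φ : R →+* ℂ) {f : PowerSeries R}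
    (h : constantCoeff f = 1) :
    PowerSeries.map φ (PowerSeries.invOfUnit f 1) = (PowerSeries.map φ f)⁻¹ := by
  have h0 : constantCoeff (PowerSeries.map φ f) ≠ 0 := by
    rw [← PowerSeries.coeff_zero_eq_constantCoeff_apply, PowerSeries.coeff_map,
      PowerSeries.coeff_zero_eq_constantCoeff_apply, h, map_one]
    exact one_ne_zero
  rw [eq_comm, PowerSeries.inv_eq_iff_mul_eq_one h0, mul_comm, ← map_mul,
    PowerSeries.mul_invOfUnit _ _ (h.trans Units.val_one.symm), map_one]

/-- Evaluation of a Laurent polynomial with integral coefficients at `u`. -/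
abbrev evalAt (u : ℂˣ) : LaurentPolynomial ℤ →+* ℂ :=
  LaurentPolynomial.eval₂ (Int.castRingHom ℂ) u

theorem evalAt_eq_sum (u : ℂˣ) (f : LaurentPolynomial ℤ) :
    evalAt u f = ∑ k ∈ f.coeff.support, (f.coeff k : ℂ) * (u : ℂ) ^ k := by
  have key : evalAt u f = f.coeff.sum fun k c => (c : ℂ) * (u : ℂ) ^ k := by
    induction f using LaurentPolynomial.induction_on' with
    | add p q hp hq =>
      rw [map_add, hp, hq, AddMonoidAlgebra.coeff_add, Finsupp.sum_add_index']
      · simp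
      · intros; push_cast; ring
    | C_mul_T n a =>
      rw [LaurentPolynomial.eval₂_C_mul_T, ← LaurentPolynomial.single_eq_C_mul_T,
        AddMonoidAlgebra.coeff_single, Finsupp.sum_single_index (by simp)]
      simp
  exact key

theorem map_rankTrunc {d : ℕ} (hd : d ≠ 0) (u : ℂˣ) (K : ℕ) :
    PowerSeries.map (evalAt u) (rankTrunc d K) = truncAt d u K := by
  have hc (c : LaurentPolynomial ℤ) {m : ℕ} (hm : m ≠ 0) :
      constantCoeff (1 - PowerSeries.C c * X ^ m) = 1 := by simp [hm]
  have h1 : constantCoeff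
      (∏ k ∈ Icc 1 K, (1 - X ^ k) : PowerSeries (LaurentPolynomial ℤ)) = 1 := by
    rw [map_prod]
    refine prod_eq_one fun k hk => ?_
    have : k ≠ 0 := by have := (mem_Icc.mp hk).1; omega
    simp [this]
  unfold rankTrunc truncAt
  rw [map_mul, map_mul, map_invOfUnit_one _ h1, map_add, map_mul, map_sum, map_prod, map_prod,
    prod_inv_of_constantCoeff]
  · rw [map_one]
    refine congrArg₂ _ (congrArg₂ _ (by simp) (by simp))
      (congrArg _ (congrArg₂ _ (map_ofNat _ 2) ?_))
    · refine sum_congr rfl fun n hn => ?_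
      have hn' : d * n ≠ 0 := mul_ne_zero hd (by have := (mem_Icc.mp hn).1; omega)
      rw [map_mul, map_invOfUnit_one, ← PowerSeries.mul_inv_rev]
      · congr 1
        · simp [LaurentPolynomial.eval₂_T]
        · congr 1
          simp [LaurentPolynomial.eval₂_T]
          ring
      · rw [map_mul, hc _ hn', hc _ hn', one_mul]
  · intro k hk
    have : k ≠ 0 := by have := (mem_Icc.mp hk).1; omega
    simp [this]

/-- The image of `𝒪_d` under `z ↦ u`. -/
def rankAt (d : ℕ) (u : ℂˣ) : PowerSeries ℂ := PowerSeries.map (evalAt u) (rankGF d)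

theorem coeff_rankAt {d : ℕ} (hd : d ≠ 0) (u : ℂˣ) {K n : ℕ} (h : n ≤ K) :
    coeff n (rankAt d u) = coeff n (truncAt d u K) := by
  rw [← map_rankTrunc hd, rankAt, PowerSeries.coeff_map, PowerSeries.coeff_map, coeff_rankTrunc d h]
  simp [rankGF]

theorem coeff_rankAt_eq_sum (d : ℕ) (u : ℂˣ) (n : ℕ) :
    coeff n (rankAt d u) =
      ∑ k ∈ (coeff n (rankGF d)).coeff.support, (Nbar d k n : ℂ) * (u : ℂ) ^ k := by
  rw [rankAt, PowerSeries.coeff_map, evalAt_eq_sum]; rfl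

/-! ### Overpartitions -/

theorem pbar_eq_sum (n : ℕ) : pbar n = ∑ p : n.Partition, 2 ^ p.parts.toFinset.card := by
  simp [pbar, overpartitions, card_sigma, card_powerset]

open scoped PowerSeries.WithPiTopology in
-- Each part size that occurs contributes a factor 2, overlined or not, whatever its multiplicity.
-- Thus size i has the factor 1 + 2 ∑_{j≥1} X^(ij) = (1 + X^i)/(1 - X^i).
theorem coeff_prod_eq_pbar {n K : ℕ} (h : n ≤ K) :
    coeff n ((∏ k ∈ Icc 1 K, (1 + X ^ k)) * (∏ k ∈ Icc 1 K, (1 - X ^ k)⁻¹) : PowerSeries ℂ) =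
      pbar n := by
  have hgen := Nat.Partition.hasProd_genFun (R := ℂ) fun _ _ => 2
  have hfac (i : ℕ) : (1 + ∑' j : ℕ, (2 : ℂ) • (X : PowerSeries ℂ) ^ ((i + 1) * (j + 1))) =
      (1 + X ^ (i + 1)) * (1 - X ^ (i + 1))⁻¹ := by
    have hc : constantCoeff (X ^ (i + 1) : PowerSeries ℂ) = 0 := by simp
    have hs := PowerSeries.WithPiTopology.summable_pow_of_constantCoeff_eq_zero hc
    have ht := PowerSeries.WithPiTopology.tsum_pow_mul_one_sub_of_constantCoeff_eq_zero hc
    have h1 := (PowerSeries.eq_mul_inv_iff_mul_eq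
      (φ₁ := ∑' j : ℕ, (X ^ (i + 1) : PowerSeries ℂ) ^ j) (φ₂ := 1)
      (constantCoeff_one_sub hc)).mpr ht
    rw [one_mul] at h1
    have h2 : ∀ j : ℕ, (2 : ℂ) • (X : PowerSeries ℂ) ^ ((i + 1) * (j + 1)) =
        (2 * X ^ (i + 1)) * (X ^ (i + 1)) ^ j := fun j => by
      rw [PowerSeries.smul_eq_C_mul, mul_add, pow_add, pow_mul, mul_one, map_ofNat]; ring
    simp_rw [h2]
    rw [hs.tsum_mul_left, h1]
    linear_combination (-1) * PowerSeries.mul_inv_cancel _ (constantCoeff_one_sub hc)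
  simp_rw [hfac] at hgen
  have hlim := hgen.tendsto_prod_nat
  rw [PowerSeries.WithPiTopology.tendsto_iff_coeff_tendsto] at hlim
  have hstab : ∀ L, n ≤ L → coeff n (∏ i ∈ range (L + 1), (1 + X ^ (i + 1)) * (1 - X ^ (i + 1))⁻¹ :
      PowerSeries ℂ) = coeff n (∏ i ∈ range L, (1 + X ^ (i + 1)) * (1 - X ^ (i + 1))⁻¹) := by
    intro L hL
    have hc : constantCoeff (X ^ (L + 1) : PowerSeries ℂ) = 0 := by simp
    rw [← sub_eq_zero, ← map_sub]
    refine PowerSeries.X_pow_dvd_iff.mp (?_ : X ^ (L + 1) ∣ _) n (by omega)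
    rw [prod_range_succ]
    refine ⟨(∏ i ∈ range L, (1 + X ^ (i + 1)) * (1 - X ^ (i + 1))⁻¹) *
      (2 * (1 - X ^ (L + 1))⁻¹), ?_⟩
    linear_combination (∏ i ∈ range L, (1 + X ^ (i + 1)) * (1 - X ^ (i + 1))⁻¹) *
      PowerSeries.mul_inv_cancel _ (constantCoeff_one_sub hc)
  have hconst : ∀ L, n ≤ L → coeff n (∏ i ∈ range L, (1 + X ^ (i + 1)) * (1 - X ^ (i + 1))⁻¹ :
      PowerSeries ℂ) = coeff n (∏ i ∈ range n, (1 + X ^ (i + 1)) * (1 - X ^ (i + 1))⁻¹) := by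
    intro L hL
    induction L, hL using Nat.le_induction with
    | base => rfl
    | succ L hL ih => rw [hstab L hL, ih]
  have hval := tendsto_nhds_unique (hlim n) (tendsto_const_nhds.congr'
    ((eventually_ge_atTop n).mono fun L hL => (hconst L hL).symm))
  rw [← prod_mul_distrib, ← Ico_succ_right_eq_Icc, prod_Ico_eq_prod_range]
  simp only [Order.succ_eq_add_one, Nat.add_sub_cancel]
  simp_rw [add_comm 1]
  have e := hconst K h
  simp_rw [add_comm (1 : PowerSeries ℂ)] at e hval ⊢
  rw [e, ← hval, Nat.Partition.coeff_genFun, pbar_eq_sum]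
  push_cast
  refine sum_congr rfl fun p _ => ?_
  simp [Finsupp.prod, Multiset.toFinsupp_support]

/-- At z = 1 the factor (1 - z)(1 - z⁻¹) removes the whole sum and leaves the overpartition product.
-/
theorem coeff_rankAt_one {d : ℕ} (hd : d ≠ 0) (n : ℕ) : coeff n (rankAt d 1) = pbar n := by
  rw [coeff_rankAt hd 1 le_rfl, ← coeff_prod_eq_pbar (le_refl n), truncAt]
  simp

end OverRank

namespace OverRank
open Filter Topology Finset

open PowerSeries (coeff constantCoeff X)

/-! ### Analytic evaluation of the rank generating function on the unit circle -/

theorem prod_Icc_one_eq_range {R : Type*} [CommMonoid R] (f : ℕ → R) (K : ℕ) :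
    ∏ k ∈ Icc 1 K, f k = ∏ i ∈ range K, f (i + 1) := by
  induction K with
  | zero => simp
  | succ K ih => rw [prod_Icc_succ_top (by omega), prod_range_succ, ih]

theorem sum_Icc_one_eq_range {R : Type*} [AddCommMonoid R] (f : ℕ → R) (K : ℕ) :
    ∑ k ∈ Icc 1 K, f k = ∑ i ∈ range K, f (i + 1) := by
  induction K with
  | zero => simp
  | succ K ih => rw [sum_Icc_succ_top (by omega), sum_range_succ, ih]

theorem tendsto_prod_one_add_pow {q : ℂ} (hq1 : ‖q‖ < 1) :
    Tendsto (fun K => ∏ k ∈ Icc 1 K, (1 + q ^ k)) atTop (𝓝 (qPoch (-q) q)) := by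
  refine (tendsto_qPoch hq1 (-q)).congr fun K => ?_
  rw [prod_Icc_one_eq_range]
  exact prod_congr rfl fun i _ => by ring

theorem tendsto_prod_one_sub_pow_inv {q : ℂ} (hq1 : ‖q‖ < 1) :
    Tendsto (fun K => ∏ k ∈ Icc 1 K, (1 - q ^ k)⁻¹) atTop (𝓝 (qPoch q q)⁻¹) := by
  refine ((tendsto_qPoch hq1 q).inv₀ (qPoch_self_ne_zero hq1)).congr fun K => ?_
  rw [prod_Icc_one_eq_range, ← prod_inv_distrib]
  exact prod_congr rfl fun i _ => by ring

theorem exists_bound_prod_one_add_pow {r : ℝ} (hr : 0 ≤ r) (hr1 : r < 1) :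
    ∃ B, ∀ K, ∏ k ∈ Icc 1 K, (1 + r ^ k) ≤ B := by
  have hr' : ‖(r : ℂ)‖ < 1 := by rwa [Complex.norm_of_nonneg hr]
  obtain ⟨B, -, hB⟩ := exists_bound_of_tendsto (tendsto_prod_one_add_pow hr')
  refine ⟨B, fun K => ?_⟩
  have := hB K
  rw [norm_prod] at this
  refine le_trans (prod_le_prod (fun k _ => by positivity) fun k _ => ?_) this
  rw [show (1 + (r : ℂ) ^ k) = ((1 + r ^ k : ℝ) : ℂ) by push_cast; rfl,
    Complex.norm_of_nonneg (by positivity)]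

theorem exists_bound_prod_one_sub_pow_inv {r : ℝ} (hr : 0 ≤ r) (hr1 : r < 1) :
    ∃ B, ∀ K, ∏ k ∈ Icc 1 K, (1 - r ^ k)⁻¹ ≤ B := by
  have hr' : ‖(r : ℂ)‖ < 1 := by rwa [Complex.norm_of_nonneg hr]
  obtain ⟨B, -, hB⟩ := exists_bound_of_tendsto (tendsto_prod_one_sub_pow_inv hr')
  refine ⟨B, fun K => ?_⟩
  have := hB K
  rw [norm_prod] at this
  have h0 : ∀ k, 0 ≤ 1 - r ^ k := fun k => sub_nonneg.mpr (pow_le_one₀ hr hr1.le)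
  refine le_trans (prod_le_prod (fun k _ => inv_nonneg.mpr (h0 k)) fun k _ => ?_) this
  rw [show (1 - (r : ℂ) ^ k)⁻¹ = (((1 - r ^ k)⁻¹ : ℝ) : ℂ) by push_cast; rfl,
    Complex.norm_of_nonneg (inv_nonneg.mpr (h0 k))]

section factors
variable {r : ℝ}

theorem wBound_one_add_X_pow (hr : 0 ≤ r) (k : ℕ) : WBound r (1 + X ^ k) (1 + r ^ k) :=
  WBound.one.add hr (WBound.X_pow k)

theorem wBound_one_sub_X_pow_inv (hr : 0 ≤ r) (hr1 : r < 1) {k : ℕ} (hk : k ≠ 0) :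
    WBound r (1 - X ^ k)⁻¹ (1 - r ^ k)⁻¹ :=
  WBound.inv hr (by simp [hk]) (WBound.X_pow k) (pow_lt_one₀ hr hr1 hk)

theorem wBound_one_sub_C_mul_X_pow_inv (hr : 0 ≤ r) (hr1 : r < 1) {u : ℂ} (hu : ‖u‖ = 1) {k : ℕ}
    (hk : k ≠ 0) : WBound r (1 - PowerSeries.C u * X ^ k)⁻¹ (1 - r ^ k)⁻¹ := by
  have h := WBound.C_mul_X_pow hr u k
  rw [hu, one_mul] at h
  exact WBound.inv hr (by simp [hk]) h (pow_lt_one₀ hr hr1 hk)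

theorem wBound_truncAt_summand (hr : 0 ≤ r) (hr1 : r < 1) {u : ℂ} (hu : ‖u‖ = 1) {d n : ℕ}
    (h : d * n ≠ 0) :
    WBound r (PowerSeries.C ((1 - u) * (1 - u⁻¹) * (-1) ^ n) * X ^ (n ^ 2 + d * n) *
      ((1 - PowerSeries.C u * X ^ (d * n))⁻¹ * (1 - PowerSeries.C u⁻¹ * X ^ (d * n))⁻¹))
      (‖(1 - u) * (1 - u⁻¹) * (-1) ^ n‖ * r ^ (n ^ 2 + d * n) *
        ((1 - r ^ (d * n))⁻¹ * (1 - r ^ (d * n))⁻¹)) := by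
  have hu' : ‖u⁻¹‖ = 1 := by rw [norm_inv, hu, inv_one]
  exact (WBound.C_mul_X_pow hr _ _).mul hr ((wBound_one_sub_C_mul_X_pow_inv hr hr1 hu h).mul hr
    (wBound_one_sub_C_mul_X_pow_inv hr hr1 hu' h))

end factors

/-- A bound independent of K permits passage from the truncations to the series itself. On |u| = 1
the denominators are at least 1 - r and n² + dn ≥ n, so the summands have a geometric majorant. -/
theorem exists_wBound_truncAt {r : ℝ} (hr : 0 ≤ r) (hr1 : r < 1) {d : ℕ} (hd : d ≠ 0) {u : ℂ}
    (hu : ‖u‖ = 1) : ∃ B, ∀ K, WBound r (truncAt d u K) B := by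
  obtain ⟨A, hA⟩ := exists_bound_prod_one_add_pow hr hr1
  obtain ⟨B, hB⟩ := exists_bound_prod_one_sub_pow_inv hr hr1
  set D : ℝ := ‖(1 - u) * (1 - u⁻¹)‖ * ((1 - r)⁻¹ * (1 - r)⁻¹) with hD
  have h1r : 0 < 1 - r := sub_pos.mpr hr1
  refine ⟨A * B * (1 + 2 * (D * (1 - r)⁻¹)), fun K => ?_⟩
  have hne {n : ℕ} (hn : n ∈ Icc 1 K) : n ≠ 0 := by have := (mem_Icc.mp hn).1; omega
  have hP := (WBound.prod hr (Icc 1 K) fun k _ => wBound_one_add_X_pow hr k).mono (hA K)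
  have hQ := (WBound.prod hr (Icc 1 K) fun k hk =>
    wBound_one_sub_X_pow_inv hr hr1 (hne hk)).mono (hB K)
  refine (hP.mul hr hQ).mul hr (WBound.one.add hr ?_)
  have h2 : WBound r (2 : PowerSeries ℂ) 2 := by
    simpa only [map_ofNat, Complex.norm_ofNat] using WBound.C (r := r) 2
  refine h2.mul hr ?_
  refine (WBound.sum hr (Icc 1 K) fun n hn =>
    wBound_truncAt_summand hr hr1 hu (mul_ne_zero hd (hne hn))).mono ?_
  calc _ ≤ ∑ n ∈ Icc 1 K, D * r ^ n := by
        refine sum_le_sum fun n hn => ?_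
        have hdn : r ^ (d * n) ≤ r := pow_le_of_le_one hr hr1.le (mul_ne_zero hd (hne hn))
        have hpow : r ^ (n ^ 2 + d * n) ≤ r ^ n := by
          refine pow_le_pow_of_le_one hr hr1.le ?_
          have := Nat.le_mul_of_pos_left n (Nat.pos_of_ne_zero hd)
          omega
        have h3 : 0 < 1 - r ^ (d * n) := by linarith
        rw [norm_mul _ ((-1) ^ n), norm_pow, norm_neg, norm_one, one_pow, mul_one, hD, mul_assoc,
          mul_assoc, mul_comm (r ^ _)]
        gcongr
    _ ≤ D * (1 - r)⁻¹ := by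
        rw [← mul_sum]
        refine mul_le_mul_of_nonneg_left ?_ (by positivity)
        rw [← tsum_geometric_of_lt_one hr hr1]
        exact (summable_geometric_of_lt_one hr hr1).sum_le_tsum _ fun i _ => pow_nonneg hr i

theorem evalSeries_truncAt {q : ℂ} (hq1 : ‖q‖ < 1) {d : ℕ} (hd : d ≠ 0) {u : ℂ}
    (hu : ‖u‖ = 1) (K : ℕ) :
    evalSeries q (truncAt d u K) =
      (∏ k ∈ Icc 1 K, (1 + q ^ k)) * (∏ k ∈ Icc 1 K, (1 - q ^ k)⁻¹) *
        (1 + 2 * ∑ n ∈ Icc 1 K, (1 - u) * (1 - u⁻¹) * (-1) ^ n * q ^ (n ^ 2 + d * n) *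
          ((1 - u * q ^ (d * n))⁻¹ * (1 - u⁻¹ * q ^ (d * n))⁻¹)) := by
  have hr := norm_nonneg q
  have hu' : ‖u⁻¹‖ = 1 := by rw [norm_inv, hu, inv_one]
  have hne {n : ℕ} (hn : n ∈ Icc 1 K) : n ≠ 0 := by have := (mem_Icc.mp hn).1; omega
  have hdn {n : ℕ} (hn : n ∈ Icc 1 K) : d * n ≠ 0 := mul_ne_zero hd (hne hn)
  have hP := WBound.prod hr (Icc 1 K) fun k _ => wBound_one_add_X_pow hr k
  have hQ := WBound.prod hr (Icc 1 K) fun k hk => wBound_one_sub_X_pow_inv hr hq1 (hne hk)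
  have h2 : WBound ‖q‖ (2 : PowerSeries ℂ) 2 := by
    simpa only [map_ofNat, Complex.norm_ofNat] using WBound.C (r := ‖q‖) 2
  have e2 : evalSeries q 2 = 2 := by
    simpa only [map_ofNat] using evalSeries_C (q := q) 2
  have hS := WBound.sum hr (Icc 1 K) fun n hn => wBound_truncAt_summand hr hq1 hu (hdn hn)
  unfold truncAt
  rw [evalSeries_mul (hP.mul hr hQ) (WBound.one.add hr (h2.mul hr hS)), evalSeries_mul hP hQ,
    evalSeries_add WBound.one (h2.mul hr hS), evalSeries_mul h2 hS, e2, evalSeries_one,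
    evalSeries_prod _ fun k _ => wBound_one_add_X_pow hr k,
    evalSeries_prod _ fun k hk => wBound_one_sub_X_pow_inv hr hq1 (hne hk),
    evalSeries_sum _ fun n hn => wBound_truncAt_summand hr hq1 hu (hdn hn)]
  congr 1
  · congr 1
    · refine prod_congr rfl fun k _ => ?_
      rw [evalSeries_add WBound.one (WBound.X_pow k), evalSeries_one, evalSeries_X_pow]
    · refine prod_congr rfl fun k hk => ?_
      rw [evalSeries_inv (by simp [hne hk]) (WBound.X_pow k) (pow_lt_one₀ hr hq1 (hne hk)),
        evalSeries_X_pow]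
  · congr 2
    refine sum_congr rfl fun n hn => ?_
    have hb (v : ℂ) (hv : ‖v‖ = 1) : evalSeries q (1 - PowerSeries.C v * X ^ (d * n))⁻¹ =
        (1 - v * q ^ (d * n))⁻¹ := by
      have h := WBound.C_mul_X_pow hr v (d * n)
      rw [hv, one_mul] at h
      rw [evalSeries_inv (by simp [hd, hne hn]) h (pow_lt_one₀ hr hq1 (hdn hn)),
        evalSeries_C_mul_X_pow]
    rw [evalSeries_mul (WBound.C_mul_X_pow hr _ _)
      ((wBound_one_sub_C_mul_X_pow_inv hr hq1 hu (hdn hn)).mul hr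
        (wBound_one_sub_C_mul_X_pow_inv hr hq1 hu' (hdn hn))),
      evalSeries_mul (wBound_one_sub_C_mul_X_pow_inv hr hq1 hu (hdn hn))
        (wBound_one_sub_C_mul_X_pow_inv hr hq1 hu' (hdn hn)),
      evalSeries_C_mul_X_pow, hb u hu, hb u⁻¹ hu']

theorem qPoch_eq_mul_sq {q : ℂ} (hq1 : ‖q‖ < 1) (x : ℂ) :
    qPoch x q = qPoch x (q ^ 2) * qPoch (x * q) (q ^ 2) := by
  have hq2 := norm_pow_lt_one hq1 two_ne_zero
  refine tendsto_nhds_unique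
    ((tendsto_qPoch hq1 x).comp (tendsto_id.const_mul_atTop' two_pos)) ?_
  refine ((tendsto_qPoch hq2 x).mul (tendsto_qPoch hq2 (x * q))).congr fun N => ?_
  simp only [Function.comp_apply, id_eq]
  induction N with
  | zero => simp
  | succ N ih =>
    rw [mul_add_one, show 2 * N + 2 = 2 * N + 1 + 1 from rfl]
    simp only [prod_range_succ]
    rw [← ih]
    ring

/-- Gauss's identity j(q; q²) = (q)_∞ / (-q)_∞: split (q)_∞ into odd and even powers and use (q)_∞
(-q)_∞ = (q²; q²)_∞. -/
theorem theta_self_sq {q : ℂ} (hq1 : ‖q‖ < 1) :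
    theta q (q ^ 2) * qPoch (-q) q = qPoch q q := by
  have hq2 := norm_pow_lt_one hq1 two_ne_zero
  have h1 := qPoch_eq_mul_sq hq1 q
  have h2 : qPoch q q * qPoch (-q) q = qPoch (q ^ 2) (q ^ 2) := by
    refine tendsto_nhds_unique ((tendsto_qPoch hq1 q).mul (tendsto_qPoch hq1 (-q))) ?_
    refine (tendsto_qPoch hq2 (q ^ 2)).congr fun N => ?_
    rw [← prod_mul_distrib]
    exact prod_congr rfl fun k _ => by ring
  have h3 : q ^ 2 / q = q := by
    rcases eq_or_ne q 0 with rfl | h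
    · simp
    · field_simp
  have h4 := qPoch_self_ne_zero hq2
  rw [← sq] at h1
  rw [theta, h3]
  refine mul_right_cancel₀ h4 ?_
  linear_combination (-qPoch (-q) q * (qPoch q q + qPoch q (q ^ 2) * qPoch (q ^ 2) (q ^ 2))) * h1 +
    qPoch q q * h2

/-- With y = q^(dn), 1/(1 - uy) + 1/(1 - u/y) - 1 = y(1 - u²) / ((1 - uy)(y - u)). The factor 1 + u
therefore makes each summand a pair of terms of the two-sided series, minus half of the
corresponding theta terms. -/
theorem tendsto_sum_rank {q : ℂ} (hq : q ≠ 0) (hq1 : ‖q‖ < 1) {d : ℕ} (hd : d ≠ 0) {u : ℂ}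
    (hu : ‖u‖ = 1) (hu1 : u ≠ 1) :
    Tendsto (fun K => (1 + u) * (1 + 2 * ∑ n ∈ Icc 1 K, (1 - u) * (1 - u⁻¹) * (-1) ^ n *
        q ^ (n ^ 2 + d * n) * ((1 - u * q ^ (d * n))⁻¹ * (1 - u⁻¹ * q ^ (d * n))⁻¹))) atTop
      (𝓝 ((1 - u) * (2 * rankSum d u q - theta q (q ^ 2)))) := by
  have hu0 : u ≠ 0 := by rintro rfl; simp at hu
  have hz1 : ∀ r : ℤ, u ≠ (q ^ d) ^ r :=
    ne_zpow_of_norm_eq_one (pow_ne_zero d hq) (norm_pow_lt_one hq1 hd) hu hu1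
  have hs1 : HasSum (fun n : ℤ => thetaTerm (q ^ 2) q n / (1 - (q ^ d) ^ n * u)) (rankSum d u q) :=
    (summable_rankSum hd hq hq1 hu0 hz1).of_norm.hasSum
  have hs2 : HasSum (fun n : ℤ => thetaTerm (q ^ 2) q n) (theta q (q ^ 2)) := by
    rw [theta_eq_tsum (pow_ne_zero 2 hq) (norm_pow_lt_one hq1 two_ne_zero) hq]
    exact (summable_norm_thetaTerm (pow_ne_zero 2 hq) (norm_pow_lt_one hq1 two_ne_zero)
      hq).of_norm.hasSum
  have hs := ((hs1.nat_add_neg).sub (hs2.nat_add_neg.div_const 2)).tendsto_sum_nat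
  -- Pairing n with -n counts n = 0 twice; that pair equals 2/(1 - u) - 1. It is subtracted, and the
  -- constant summand 1, times 1 + u, is added.
  have hlim := ((hs.comp (tendsto_add_atTop_nat 1)).const_mul (2 * (1 - u))).add_const
    ((1 + u) - 2 * (1 - u) * (2 / (1 - u) - 1))
  have h1u : 1 - u ≠ 0 := sub_ne_zero.mpr hu1.symm
  have hterm (n : ℕ) : (1 + u) * ((1 - u) * (1 - u⁻¹) * (-1) ^ n * q ^ (n ^ 2 + d * n) *
      ((1 - u * q ^ (d * n))⁻¹ * (1 - u⁻¹ * q ^ (d * n))⁻¹)) =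
      (1 - u) * (thetaTerm (q ^ 2) q n / (1 - (q ^ d) ^ (n : ℤ) * u) +
        thetaTerm (q ^ 2) q (-n) / (1 - (q ^ d) ^ (-(n : ℤ)) * u) -
        (thetaTerm (q ^ 2) q n + thetaTerm (q ^ 2) q (-n)) / 2) := by
    have hT : thetaTerm (q ^ 2) q n = (-1) ^ n * q ^ n ^ 2 := by
      rw [thetaTerm_natCast (pow_ne_zero 2 hq) hq, ← pow_mul, mul_assoc, ← pow_add,
        two_mul_choose_two_add]
    have h1 := one_sub_zpow_mul_ne_zero hz1 n
    have h2 := one_sub_zpow_mul_ne_zero hz1 (-n)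
    have hy0 := pow_ne_zero n (pow_ne_zero d hq)
    rw [thetaTerm_self_sq_neg, hT]
    rw [zpow_neg, zpow_natCast] at h2 ⊢
    rw [zpow_natCast] at h1
    rw [pow_add, pow_mul]
    generalize (q ^ d) ^ n = y at *
    have h1' : 1 - u * y ≠ 0 := by rwa [mul_comm]
    have h2' : u - y ≠ 0 := fun h => h2 (by field_simp; linear_combination -h)
    have h2'' : y - u ≠ 0 := fun h => h2' (by linear_combination -h)
    have e1 : 1 - u⁻¹ * y = (u - y) / u := by field_simp
    have e2 : 1 - y⁻¹ * u = -(u - y) / y := by field_simp; ring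
    rw [e1, e2, mul_comm y u]
    field_simp
    ring
  have hval : (2 : ℂ) * (1 - u) *
      (rankSum d u q + thetaTerm (q ^ 2) q 0 / (1 - (q ^ d) ^ (0 : ℤ) * u) -
      (theta q (q ^ 2) + thetaTerm (q ^ 2) q 0) / 2) +
        (1 + u - 2 * (1 - u) * (2 / (1 - u) - 1)) =
      (1 - u) * (2 * rankSum d u q - theta q (q ^ 2)) := by
    rw [thetaTerm_zero, zpow_zero, one_mul]
    field_simp
    ring
  rw [← hval]
  refine hlim.congr fun K => ?_
  have h0 : thetaTerm (q ^ 2) q 0 = 1 := thetaTerm_zero ..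
  simp only [Function.comp_apply]
  rw [sum_range_succ', sum_Icc_one_eq_range]
  have hsum : (1 + u) * ∑ i ∈ range K, (1 - u) * (1 - u⁻¹) * (-1) ^ (i + 1) *
      q ^ ((i + 1) ^ 2 + d * (i + 1)) *
        ((1 - u * q ^ (d * (i + 1)))⁻¹ * (1 - u⁻¹ * q ^ (d * (i + 1)))⁻¹) =
      (1 - u) * ∑ i ∈ range K,
        (thetaTerm (q ^ 2) q (i + 1 : ℕ) / (1 - (q ^ d) ^ ((i + 1 : ℕ) : ℤ) * u) +
        thetaTerm (q ^ 2) q (-(i + 1 : ℕ)) / (1 - (q ^ d) ^ (-((i + 1 : ℕ) : ℤ)) * u) -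
        (thetaTerm (q ^ 2) q (i + 1 : ℕ) + thetaTerm (q ^ 2) q (-(i + 1 : ℕ))) / 2) := by
    rw [mul_sum, mul_sum]
    exact sum_congr rfl fun i _ => hterm (i + 1)
  simp only [Nat.cast_zero, neg_zero, zpow_zero, one_mul, h0]
  linear_combination (-2) * hsum

/-- `(1 + z) 𝒪_d(z; q)` in terms of the rank sum. -/
theorem evalSeries_rankAt {q : ℂ} (hq : q ≠ 0) (hq1 : ‖q‖ < 1) {d : ℕ} (hd : d ≠ 0) {u : ℂˣ}
    (hu : ‖(u : ℂ)‖ = 1) (hu1 : (u : ℂ) ≠ 1) :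
    (1 + (u : ℂ)) * evalSeries q (rankAt d u) =
      (1 - u) * (2 * (rankSum d u q / theta q (q ^ 2)) - 1) := by
  obtain ⟨ρ, hρ, hρ1⟩ := exists_between hq1
  obtain ⟨B, hB⟩ := exists_wBound_truncAt ((norm_nonneg q).trans hρ.le) hρ1 hd hu
  have h1 := (tendsto_evalSeries (fun K n => coeff_rankAt hd u) hρ hB).2.const_mul (1 + (u : ℂ))
  have h2 := ((tendsto_prod_one_add_pow hq1).mul (tendsto_prod_one_sub_pow_inv hq1)).mul
    (tendsto_sum_rank hq hq1 hd hu hu1)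
  have h3 := theta_self_sq hq1
  have h4 := theta_self_sq_ne_zero hq hq1
  have h5 := qPoch_self_ne_zero hq1
  have h6 := tendsto_nhds_unique h1 (h2.congr fun K => by
    rw [evalSeries_truncAt hq1 hd hu]; ring)
  rw [h6, ← h3]
  have h7 : qPoch (-q) q ≠ 0 := fun h => h5 (by rw [← h3, h, mul_zero])
  field_simp

theorem summable_rankAt {q : ℂ} (hq1 : ‖q‖ < 1) {d : ℕ} (hd : d ≠ 0) {u : ℂˣ}
    (hu : ‖(u : ℂ)‖ = 1) : Summable fun n => coeff n (rankAt d u) * q ^ n := by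
  obtain ⟨ρ, hρ, hρ1⟩ := exists_between hq1
  obtain ⟨B, hB⟩ := exists_wBound_truncAt ((norm_nonneg q).trans hρ.le) hρ1 hd hu
  exact (tendsto_evalSeries (fun K n => coeff_rankAt hd u) hρ hB).1

/-! ### The rank deviations -/

/-- Fourier inversion on the residues modulo M; the j = 0 contribution is p̄(n)/M, exactly what the
deviation subtracts. -/
theorem devCoeff_eq {d M : ℕ} (hd : d ≠ 0) (hM : M ≠ 0) {ζ : ℂ} (hζ : IsPrimitiveRoot ζ M)
    (ζu : ℂˣ) (hζu : (ζu : ℂ) = ζ) (b : ℤ) (n : ℕ) :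
    devCoeff d b M n =
      1 / M * ∑ j ∈ Icc 1 (M - 1), ζ ^ (-(b * j)) * coeff n (rankAt d (ζu ^ j)) := by
  have hM' : (M : ℂ) ≠ 0 := Nat.cast_ne_zero.mpr hM
  have hζ0 : ζ ≠ 0 := hζ.ne_zero hM
  have h1 : ∑ j ∈ range M, ζ ^ (-(b * j)) * coeff n (rankAt d (ζu ^ j)) =
      M * (NbarMod d b M n : ℂ) := by
    simp_rw [coeff_rankAt_eq_sum, mul_sum]
    rw [sum_comm, NbarMod]
    push_cast
    rw [sum_filter, mul_sum]
    refine sum_congr rfl fun k _ => ?_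
    have h2 := sum_zpow_primitiveRoot hζ (k - b)
    have h3 : ∀ j ∈ range M, ζ ^ (-(b * (j : ℤ))) * ((Nbar d k n : ℂ) * ((ζu : ℂ) ^ j) ^ k) =
        Nbar d k n * (ζ ^ (k - b)) ^ j := fun j _ => by
      rw [hζu, ← zpow_natCast ζ j, ← zpow_natCast _ j, ← zpow_mul,
        ← zpow_mul, mul_left_comm, ← zpow_add₀ hζ0]
      congr 2; ring
    rw [sum_congr rfl h3, ← mul_sum, h2]
    have h4 : (M : ℤ) ∣ k - b ↔ k ≡ b [ZMOD M] := by
      rw [Int.modEq_comm]; exact Int.modEq_iff_dvd.symm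
    simp only [h4]
    split_ifs <;> ring
  obtain ⟨m, rfl⟩ := Nat.exists_eq_succ_of_ne_zero hM
  rw [sum_range_succ'] at h1
  simp only [pow_zero, Nat.cast_zero, mul_zero, neg_zero, zpow_zero, one_mul,
    coeff_rankAt_one hd] at h1
  rw [devCoeff, sum_Icc_one_eq_range, Nat.succ_sub_one]
  field_simp
  linear_combination -h1

end OverRank

/-! ### Sums of two deviations and Fourier transforms of Appell–Lerch series. -/

namespace OverRank
open Filter Topology Finset

open PowerSeries (coeff)

section dev
variable {d M : ℕ} {q ζ : ℂ}

theorem summable_devCoeff (hd : d ≠ 0) (hM : M ≠ 0) (hζ : IsPrimitiveRoot ζ M) (hq1 : ‖q‖ < 1)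
    (b : ℤ) : Summable fun n : ℕ => devCoeff d b M n * q ^ n := by
  have hn : ‖ζ‖ = 1 := hζ.norm'_eq_one hM
  simp_rw [devCoeff_eq hd hM hζ (Units.mk0 ζ (hζ.ne_zero hM)) rfl, mul_assoc, sum_mul]
  refine (summable_sum fun j _ => ?_).mul_left _
  simp_rw [mul_assoc]
  refine (summable_rankAt hq1 hd ?_).mul_left _
  simp [hn]

theorem dev_eq (hd : d ≠ 0) (hM : M ≠ 0) (hζ : IsPrimitiveRoot ζ M) (hq1 : ‖q‖ < 1) (b : ℤ) :
    dev d b M q = 1 / M * ∑ j ∈ Icc 1 (M - 1), ζ ^ (-(b * j)) *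
      evalSeries q (rankAt d (Units.mk0 ζ (hζ.ne_zero hM) ^ j)) := by
  have hn : ‖ζ‖ = 1 := hζ.norm'_eq_one hM
  have hs (j : ℕ) := summable_rankAt hq1 hd (u := Units.mk0 ζ (hζ.ne_zero hM) ^ j) (by simp [hn])
  unfold dev evalSeries
  simp_rw [devCoeff_eq hd hM hζ (Units.mk0 ζ (hζ.ne_zero hM)) rfl, mul_assoc, sum_mul]
  rw [tsum_mul_left, Summable.tsum_finsetSum]
  · congr 1
    refine sum_congr rfl fun j _ => ?_
    simp_rw [mul_assoc]
    rw [tsum_mul_left]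
  · intro j _
    simp_rw [mul_assoc]
    exact (hs j).mul_left _

/-- The two classes combine to ζ^(-bj) (1 + ζ^j), so the formula for (1 + z) 𝒪_d applies without
dividing by 1 + ζ^j, which vanishes when ζ^j = -1. -/
theorem dev_add_dev (hd : d ≠ 0) (hM : M ≠ 0) (hζ : IsPrimitiveRoot ζ M) (hq : q ≠ 0)
    (hq1 : ‖q‖ < 1) (b : ℤ) :
    dev d b M q + dev d (b - 1) M q = 1 / M * ∑ j ∈ Icc 1 (M - 1), ζ ^ (-(b * j)) * (1 - ζ ^ j) *
      (2 * (rankSum d (ζ ^ j) q / theta q (q ^ 2)) - 1) := by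
  have hn : ‖ζ‖ = 1 := hζ.norm'_eq_one hM
  have hζ0 := hζ.ne_zero hM
  rw [dev_eq hd hM hζ hq1, dev_eq hd hM hζ hq1, ← mul_add, ← sum_add_distrib]
  congr 1
  refine sum_congr rfl fun j hj => ?_
  obtain ⟨hj1, hj2⟩ := mem_Icc.mp hj
  have hj' : ζ ^ j ≠ 1 := hζ.pow_ne_one_of_pos_of_lt (by omega) (by omega)
  have h := evalSeries_rankAt hq hq1 hd (u := Units.mk0 ζ hζ0 ^ j) (by simp [hn])
    (by simpa using hj')
  rw [Units.val_pow_eq_pow_val, Units.val_mk0] at h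
  have e : ζ ^ (-((b - 1) * (j : ℤ))) = ζ ^ (-(b * j)) * ζ ^ j := by
    rw [← zpow_natCast, ← zpow_add₀ hζ0]; congr 1; ring
  rw [e]
  linear_combination ζ ^ (-(b * (j : ℤ))) * h

/-- The finite Fourier transform of the Appell–Lerch series that occur in `Λ`. -/
def lerchTransform (d M : ℕ) (b : ℤ) (ζ q : ℂ) : ℂ :=
  ∑ j ∈ range M, ζ ^ (-(b * j)) *
    appellLerch (((ζ ^ 2)⁻¹) ^ j * q ^ d ^ 2) (q ^ (2 * d ^ 2)) (-1)

/-- Substituting `Lambda_eq` leaves a constant 1, a multiple of Λ and an Appell–Lerch term. By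
orthogonality the constant yields χ(a = M), as M divides a only for a = M and never divides a - 1.
-/
theorem dev_add_dev_eq_lambda (hd : Odd d) {a : ℕ} (ha : 2 ≤ a) (haM : a ≤ M)
    (hζ : IsPrimitiveRoot ζ M) (hq : q ≠ 0) (hq1 : ‖q‖ < 1) {ξ : ℂ} (hξ : IsPrimitiveRoot ξ d)
    {w : ℕ → ℂ} (hw : ∀ j ∈ Icc 1 (M - 1), w j ^ d = ζ ^ j) {z₀ : ℂ} (hz₀ : z₀ ≠ 0)
    (hΛ : ∀ j ∈ Icc 1 (M - 1), LambdaGeneric d ξ (w j) z₀ (-1) q) :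
    dev d a M q + dev d (a - 1) M q = (if a = M then 1 else 0)
      - 2 / M * lerchTransform d M a ζ q + 2 / M * lerchTransform d M (a - 1) ζ q
      + 2 / (M : ℂ) * ∑ j ∈ Icc 1 (M - 1),
        ζ ^ (-((a : ℤ) * j)) * (1 - ζ ^ j) * Lambda d ξ (w j) z₀ (-1) q := by
  have hM : M ≠ 0 := by omega
  have hM' : (M : ℂ) ≠ 0 := Nat.cast_ne_zero.mpr hM
  obtain ⟨k, hk⟩ := hd
  have hd0 : d ≠ 0 := by omega
  have hn : ‖ζ‖ = 1 := hζ.norm'_eq_one hM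
  have hζ0 := hζ.ne_zero hM
  have hR : ∀ j ∈ Icc 1 (M - 1), rankSum d (ζ ^ j) q / theta q (q ^ 2) =
      Lambda d ξ (w j) z₀ (-1) q + 1 -
        appellLerch (((ζ ^ 2)⁻¹) ^ j * q ^ d ^ 2) (q ^ (2 * d ^ 2)) (-1) := by
    intro j hj
    obtain ⟨hj1, hj2⟩ := mem_Icc.mp hj
    have hwn : ‖w j‖ = 1 := by
      have := congrArg norm (hw j hj)
      rw [norm_pow, norm_pow, hn, one_pow] at this
      exact (pow_eq_one_iff_of_nonneg (norm_nonneg _) hd0).mp this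
    have hw1 : w j ^ d ≠ 1 := by
      rw [hw j hj]; exact hζ.pow_ne_one_of_pos_of_lt (by omega) (by omega)
    have h := Lambda_eq hk hξ hq hq1 hwn hw1 hz₀ (neg_ne_zero.mpr one_ne_zero) (hΛ j hj)
    rw [hw j hj, ← pow_mul, mul_comm j 2, pow_mul, ← inv_pow] at h
    linear_combination -h
  -- The weight 1 - ζ^j vanishes at j = 0, so complete sums over j may be used although the rank sum
  -- formula excludes j = 0.
  have hsplit (g : ℕ → ℂ) : ∑ j ∈ Icc 1 (M - 1), ζ ^ (-((a : ℤ) * j)) * (1 - ζ ^ j) * g j =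
      ∑ j ∈ range M, ζ ^ (-((a : ℤ) * j)) * g j -
        ∑ j ∈ range M, ζ ^ (-(((a : ℤ) - 1) * j)) * g j := by
    obtain ⟨m, rfl⟩ := Nat.exists_eq_succ_of_ne_zero hM
    rw [← sum_sub_distrib, sum_Icc_one_eq_range, Nat.succ_sub_one, sum_range_succ' _ m]
    simp only [Nat.cast_zero, mul_zero, neg_zero, sub_self, add_zero]
    refine sum_congr rfl fun j _ => ?_
    have e : ζ ^ (-(((a : ℤ) - 1) * ((j + 1 : ℕ) : ℤ))) =
        ζ ^ (-((a : ℤ) * (j + 1 : ℕ))) * ζ ^ (j + 1) := by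
      rw [← zpow_natCast, ← zpow_add₀ hζ0]; congr 1; ring
    rw [e]; ring
  have hroot (b : ℤ) : ∑ j ∈ range M, ζ ^ (-(b * j)) * 1 = if (M : ℤ) ∣ b then (M : ℂ) else 0 := by
    have h := sum_zpow_primitiveRoot hζ (-b)
    simp only [dvd_neg] at h
    rw [← h]
    refine sum_congr rfl fun j _ => ?_
    rw [mul_one, ← zpow_natCast _ j, ← zpow_mul, neg_mul]
  have h1 := hsplit fun _ => 1
  have hdiv1 : (M : ℤ) ∣ (a : ℤ) ↔ a = M := by
    rw [Int.natCast_dvd_natCast]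
    exact ⟨fun h => le_antisymm haM (Nat.le_of_dvd (by omega) h), fun h => h ▸ dvd_rfl⟩
  have hdiv2 : ¬ (M : ℤ) ∣ (a : ℤ) - 1 := fun h => by
    have := Int.le_of_dvd (by omega) h
    omega
  rw [hroot, hroot, if_neg hdiv2, sub_zero] at h1
  simp only [hdiv1] at h1
  have h2 : _ = lerchTransform d M a ζ q - lerchTransform d M (a - 1) ζ q :=
    hsplit fun j => appellLerch (((ζ ^ 2)⁻¹) ^ j * q ^ d ^ 2) (q ^ (2 * d ^ 2)) (-1)
  have hterm : ∀ j ∈ Icc 1 (M - 1), ζ ^ (-((a : ℤ) * j)) * (1 - ζ ^ j) *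
      (2 * (rankSum d (ζ ^ j) q / theta q (q ^ 2)) - 1) =
      ζ ^ (-((a : ℤ) * j)) * (1 - ζ ^ j) * 1 +
      2 * (ζ ^ (-((a : ℤ) * j)) * (1 - ζ ^ j) * Lambda d ξ (w j) z₀ (-1) q) -
      2 * (ζ ^ (-((a : ℤ) * j)) * (1 - ζ ^ j) *
        appellLerch (((ζ ^ 2)⁻¹) ^ j * q ^ d ^ 2) (q ^ (2 * d ^ 2)) (-1)) := fun j hj => by
    rw [hR j hj]; ring
  rw [dev_add_dev hd0 hM hζ hq hq1, sum_congr rfl hterm, sum_sub_distrib, sum_add_distrib,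
    ← mul_sum, ← mul_sum, h1, h2]
  generalize ∑ j ∈ Icc 1 (M - 1), ζ ^ (-((a : ℤ) * j)) * (1 - ζ ^ j) *
    Lambda d ξ (w j) z₀ (-1) q = S
  split_ifs <;> field_simp <;> ring

/-- For odd M, ζ⁻² is again a primitive M-th root, and b ≡ -2k modulo M turns ζ^(-bj) into the
character of index k for it. -/
theorem lerchTransform_odd (hM : Odd M) (hζ : IsPrimitiveRoot ζ M) (hd : d ≠ 0) (hq : q ≠ 0)
    (hq1 : ‖q‖ < 1) {b : ℤ} {k : ℕ} (hk : k < M) (hb : (M : ℤ) ∣ b + 2 * k) {z : ℂ} (hz : z ≠ 0)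
    (hg : PsiGeneric k M (q ^ d ^ 2) (-1) z (q ^ (2 * d ^ 2))) :
    lerchTransform d M b ζ q =
      M * ((-1) ^ k * q ^ (-((d : ℤ) ^ 2 * (k : ℤ) ^ 2)) *
        appellLerch (q ^ ((d : ℤ) ^ 2 * M * ((M : ℤ) - 2 * k))) (q ^ (2 * d ^ 2 * M ^ 2)) z +
        Psi k M (q ^ d ^ 2) (-1) z (q ^ (2 * d ^ 2))) := by
  have hM0 : M ≠ 0 := hM.pos.ne'
  have hζ0 := hζ.ne_zero hM0
  have hη : IsPrimitiveRoot (ζ ^ 2)⁻¹ M :=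
    (hζ.pow_of_coprime 2 (Nat.coprime_two_left.mpr hM)).inv
  have hd2 : 2 * d ^ 2 ≠ 0 := mul_ne_zero two_ne_zero (pow_ne_zero 2 hd)
  have h := sum_zpow_appellLerch hη hk (pow_ne_zero (2 * d ^ 2) hq) (norm_pow_lt_one hq1 hd2)
    (pow_ne_zero (d ^ 2) hq) (neg_ne_zero.mpr one_ne_zero) hz hg
  obtain ⟨c, hc⟩ := hb
  have hroot (j : ℕ) : ((ζ ^ 2)⁻¹) ^ (-((k : ℤ) * j)) = ζ ^ (-(b * j)) := by
    have : ζ ^ ((M : ℤ) * c * j) = 1 := by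
      rw [mul_assoc, zpow_mul, zpow_natCast, hζ.pow_eq_one, one_zpow]
    rw [inv_zpow, zpow_neg, inv_inv, ← zpow_natCast, ← zpow_mul, ← mul_one (ζ ^ (-(b * (j : ℤ)))),
      ← this, ← zpow_add₀ hζ0, ← hc]
    congr 1; push_cast; ring
  simp_rw [hroot] at h
  rw [lerchTransform, h]
  have e1 : ((q ^ (2 * d ^ 2)) ^ (k + 1).choose 2)⁻¹ * (-q ^ d ^ 2) ^ k =
      (-1) ^ k * q ^ (-((d : ℤ) ^ 2 * (k : ℤ) ^ 2)) := by
    have hk2 : 2 * (k + 1).choose 2 = k ^ 2 + k := by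
      rw [succ_choose_two, mul_add, two_mul k]
      have := two_mul_choose_two_add k
      omega
    rw [neg_pow (q ^ d ^ 2), ← pow_mul, ← pow_mul, mul_left_comm, mul_right_comm 2 (d ^ 2), hk2]
    congr 1
    rw [← zpow_natCast q, ← zpow_natCast q, ← zpow_neg, ← zpow_add₀ hq]
    congr 1; push_cast; ring
  have e2 : -(q ^ (2 * d ^ 2)) ^ ((M.choose 2 : ℤ) - M * k) * (-q ^ d ^ 2) ^ M =
      q ^ ((d : ℤ) ^ 2 * M * ((M : ℤ) - 2 * k)) := by
    have hM2 : (2 * M.choose 2 + M : ℤ) = M ^ 2 := by exact_mod_cast two_mul_choose_two_add M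
    rw [neg_pow (q ^ d ^ 2), hM.neg_one_pow, ← pow_mul, neg_one_mul, neg_mul_neg,
      ← zpow_natCast q, ← zpow_natCast q, ← zpow_mul, ← zpow_add₀ hq]
    congr 1; push_cast
    linear_combination (d : ℤ) ^ 2 * hM2
  rw [e1, e2, ← pow_mul]

/-- Here ζ² has order n and the summands have period n in j, hence the factor 2. The inversion
m(x⁻¹, Q, z⁻¹) = x m(x, Q, z), applied at z = -1, contributes ζ^(2j), which lowers the index 2k + 2
to 2k, and replaces q^(d²) by q^(-d²). -/
theorem lerchTransform_even {n k : ℕ} (hζ : IsPrimitiveRoot ζ (2 * n)) (hd : d ≠ 0) (hq : q ≠ 0)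
    (hq1 : ‖q‖ < 1) (hk : k < n) {z : ℂ} (hz : z ≠ 0)
    (hg : PsiGeneric k n (q ^ (-(d : ℤ) ^ 2)) (-1) z (q ^ (2 * d ^ 2))) :
    lerchTransform d (2 * n) (2 * k + 2) ζ q =
      2 * n * ((-1) ^ k * q ^ (-((d : ℤ) ^ 2 * ((k : ℤ) + 1) ^ 2)) *
        appellLerch ((-1) ^ (n + 1) * q ^ ((d : ℤ) ^ 2 * ((n : ℤ) ^ 2 - 2 * (k + 1) * n)))
          (q ^ (2 * d ^ 2 * n ^ 2)) z +
        q ^ (-(d : ℤ) ^ 2) * Psi k n (q ^ (-(d : ℤ) ^ 2)) (-1) z (q ^ (2 * d ^ 2))) := by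
  have hn0 : n ≠ 0 := by omega
  have hζ0 := hζ.ne_zero (mul_ne_zero two_ne_zero hn0)
  have hη : IsPrimitiveRoot (ζ ^ 2) n := hζ.pow (by omega) rfl
  have hη0 := pow_ne_zero 2 hζ0
  have hηn : ‖ζ ^ 2‖ = 1 := hη.norm'_eq_one hn0
  have hd2 : 2 * d ^ 2 ≠ 0 := mul_ne_zero two_ne_zero (pow_ne_zero 2 hd)
  have hQ := pow_ne_zero (2 * d ^ 2) hq
  have hQ1 := norm_pow_lt_one hq1 hd2
  have hx0 : q ^ (-(d : ℤ) ^ 2) ≠ 0 := zpow_ne_zero _ hq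
  have h := sum_zpow_appellLerch hη hk hQ hQ1 hx0 (neg_ne_zero.mpr one_ne_zero) hz hg
  have hinv (j : ℕ) : appellLerch (((ζ ^ 2)⁻¹) ^ j * q ^ d ^ 2) (q ^ (2 * d ^ 2)) (-1) =
      (ζ ^ 2) ^ j * q ^ (-(d : ℤ) ^ 2) *
        appellLerch ((ζ ^ 2) ^ j * q ^ (-(d : ℤ) ^ 2)) (q ^ (2 * d ^ 2)) (-1) := by
    have hx := mul_ne_zero (pow_ne_zero j hη0) hx0
    have h1 := appellLerch_inv hQ hQ1 hx (neg_ne_zero.mpr one_ne_zero) fun r hr => by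
      have h2 := congrArg norm hr
      rw [norm_mul, norm_mul, norm_neg, norm_one, norm_pow, hηn, one_pow, one_mul, mul_one,
        norm_zpow, norm_zpow, norm_pow, ← zpow_natCast ‖q‖, ← zpow_mul] at h2
      have h3 := zpow_right_injective₀ (norm_pos_iff.mpr hq) hq1.ne h2
      push_cast at h3
      have h4 : (d : ℤ) ^ 2 * (2 * r + 1) = 0 := by linear_combination -h3
      rcases mul_eq_zero.mp h4 with h5 | h5
      · exact hd (by exact_mod_cast pow_eq_zero_iff two_ne_zero |>.mp h5)
      · omega
    rw [← h1, mul_inv, inv_pow, zpow_neg, inv_inv, inv_neg, inv_one]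
    congr 3
  have hterm (j : ℕ) : ζ ^ (-((2 * (k : ℤ) + 2) * j)) *
      appellLerch (((ζ ^ 2)⁻¹) ^ j * q ^ d ^ 2) (q ^ (2 * d ^ 2)) (-1) =
      q ^ (-(d : ℤ) ^ 2) * ((ζ ^ 2) ^ (-((k : ℤ) * j)) *
        appellLerch ((ζ ^ 2) ^ j * q ^ (-(d : ℤ) ^ 2)) (q ^ (2 * d ^ 2)) (-1)) := by
    have e : ζ ^ (-((2 * (k : ℤ) + 2) * j)) * (ζ ^ 2) ^ j = (ζ ^ 2) ^ (-((k : ℤ) * j)) := by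
      rw [← pow_mul, ← zpow_natCast ζ, ← zpow_natCast ζ 2, ← zpow_mul, ← zpow_add₀ hζ0]
      congr 1; push_cast; ring
    rw [hinv, ← e]; ring
  have hper (j : ℕ) : (ζ ^ 2) ^ (-((k : ℤ) * ((n + j : ℕ) : ℤ))) = (ζ ^ 2) ^ (-((k : ℤ) * j)) ∧
      (ζ ^ 2) ^ (n + j) = (ζ ^ 2) ^ j := by
    constructor
    · have : ((ζ ^ 2) ^ (n : ℤ)) = 1 := by rw [zpow_natCast, hη.pow_eq_one]
      rw [Nat.cast_add, mul_add, neg_add, zpow_add₀ hη0, ← mul_neg, mul_neg, mul_comm (k : ℤ),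
        ← mul_neg, zpow_mul, this, one_zpow, one_mul]
    · rw [pow_add, hη.pow_eq_one, one_mul]
  unfold lerchTransform
  simp_rw [hterm]
  rw [← mul_sum, two_mul n, sum_range_add]
  simp_rw [hper]
  rw [h]
  have e1 : q ^ (-(d : ℤ) ^ 2) * (((q ^ (2 * d ^ 2)) ^ (k + 1).choose 2)⁻¹ *
      (-q ^ (-(d : ℤ) ^ 2)) ^ k) = (-1) ^ k * q ^ (-((d : ℤ) ^ 2 * ((k : ℤ) + 1) ^ 2)) := by
    have hk2 : 2 * (k + 1).choose 2 = k ^ 2 + k := by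
      rw [succ_choose_two, mul_add, two_mul k]
      have := two_mul_choose_two_add k
      omega
    have e : q ^ (-(d : ℤ) ^ 2) * (((q ^ (2 * d ^ 2)) ^ (k + 1).choose 2)⁻¹ *
        (q ^ (-(d : ℤ) ^ 2)) ^ k) = q ^ (-((d : ℤ) ^ 2 * ((k : ℤ) + 1) ^ 2)) := by
      rw [← pow_mul, mul_right_comm 2 (d ^ 2), hk2, ← zpow_natCast q, ← zpow_natCast _ k,
        ← zpow_mul, ← zpow_neg, ← zpow_add₀ hq, ← zpow_add₀ hq]
      congr 1; push_cast; ring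
    rw [neg_pow (q ^ (-(d : ℤ) ^ 2)), ← e]
    ring
  have e2 : -(q ^ (2 * d ^ 2)) ^ ((n.choose 2 : ℤ) - n * k) * (-q ^ (-(d : ℤ) ^ 2)) ^ n =
      (-1) ^ (n + 1) * q ^ ((d : ℤ) ^ 2 * ((n : ℤ) ^ 2 - 2 * (k + 1) * n)) := by
    have hn2 : (2 * n.choose 2 + n : ℤ) = n ^ 2 := by exact_mod_cast two_mul_choose_two_add n
    have e : (q ^ (2 * d ^ 2)) ^ ((n.choose 2 : ℤ) - n * k) * (q ^ (-(d : ℤ) ^ 2)) ^ n =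
        q ^ ((d : ℤ) ^ 2 * ((n : ℤ) ^ 2 - 2 * (k + 1) * n)) := by
      rw [← zpow_natCast q, ← zpow_natCast _ n, ← zpow_mul, ← zpow_mul, ← zpow_add₀ hq]
      congr 1; push_cast
      linear_combination (d : ℤ) ^ 2 * hn2
    rw [neg_pow (q ^ (-(d : ℤ) ^ 2)), ← e, pow_succ]
    ring
  rw [e2, ← pow_mul q (2 * d ^ 2) (n ^ 2), ← e1]
  generalize appellLerch _ _ z = A
  generalize Psi k n _ _ z _ = P
  ring

/-- The shift j ↦ j + n negates the character, because ζ^n = -1 and the index is odd, but fixes the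
Appell–Lerch factor; the two halves cancel. -/
theorem lerchTransform_even_odd {n k : ℕ} (hζ : IsPrimitiveRoot ζ (2 * n)) (hn : n ≠ 0) :
    lerchTransform d (2 * n) (2 * k + 1) ζ q = 0 := by
  have hζ0 := hζ.ne_zero (mul_ne_zero two_ne_zero hn)
  have h1 : ζ ^ n = -1 := by
    have := (hζ.pow (by omega) (mul_comm 2 n) : IsPrimitiveRoot (ζ ^ n) 2)
    exact this.eq_neg_one_of_two_right
  have h2 : (ζ ^ 2)⁻¹ ^ n = 1 := by rw [inv_pow, ← pow_mul, hζ.pow_eq_one, inv_one]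
  unfold lerchTransform
  rw [two_mul n, sum_range_add, ← sum_add_distrib]
  refine sum_eq_zero fun j _ => ?_
  have e : ζ ^ (-((2 * (k : ℤ) + 1) * ((n + j : ℕ) : ℤ))) = -ζ ^ (-((2 * (k : ℤ) + 1) * j)) := by
    rw [Nat.cast_add, mul_add, neg_add, zpow_add₀ hζ0, mul_comm _ (n : ℤ), ← mul_neg, zpow_mul,
      zpow_natCast, h1, Odd.neg_one_zpow, neg_one_mul]
    exact ⟨-k - 1, by ring⟩
  rw [e, pow_add, h2, one_mul]
  ring

end dev

end OverRank

end

/-! ### Assembly of the three parity cases. -/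

theorem theorem1p1 (d a M : ℕ) (hd : Odd d) (ha : 2 ≤ a) (haM : a ≤ M)
    (q : ℂ) (hq : q ≠ 0) (hq1 : ‖q‖ < 1)
    (ζ ξ : ℂ) (hζ : IsPrimitiveRoot ζ M) (hξ : IsPrimitiveRoot ξ d)
    (w : ℕ → ℂ) (hw : ∀ j ∈ Finset.Icc 1 (M - 1), w j ^ d = ζ ^ j)
    (z' z'' z₀ : ℂ) (hz' : z' ≠ 0) (hz'' : z'' ≠ 0) (hz₀ : z₀ ≠ 0)
    (hΛ : ∀ j ∈ Finset.Icc 1 (M - 1), LambdaGeneric d ξ (w j) z₀ (-1) q) :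
    Summable (fun n : ℕ => devCoeff d a M n * q ^ n) ∧
    Summable (fun n : ℕ => devCoeff d (a - 1) M n * q ^ n) ∧
    (Even a → Even M →
      AppellLerchGeneric
        ((-1) ^ (M / 2 + 1) * q ^ ((d : ℤ) ^ 2 * ((M : ℤ) ^ 2 / 4 - (a : ℤ) * M / 2)))
        (q ^ (d ^ 2 * M ^ 2 / 2)) z' →
      PsiGeneric (a / 2 - 1) (M / 2) (q ^ (-(d : ℤ) ^ 2)) (-1) z' (q ^ (2 * d ^ 2)) →
      dev d a M q + dev d (a - 1) M q =
        (if a = M then 1 else 0)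
        + 2 * (-1) ^ (a / 2) * q ^ (-((d : ℤ) ^ 2 * (a : ℤ) ^ 2 / 4)) *
          appellLerch
            ((-1) ^ (M / 2 + 1) * q ^ ((d : ℤ) ^ 2 * ((M : ℤ) ^ 2 / 4 - (a : ℤ) * M / 2)))
            (q ^ (d ^ 2 * M ^ 2 / 2)) z'
        - 2 * q ^ (-(d : ℤ) ^ 2) *
          Psi (a / 2 - 1) (M / 2) (q ^ (-(d : ℤ) ^ 2)) (-1) z' (q ^ (2 * d ^ 2))
        + 2 / (M : ℂ) * ∑ j ∈ Finset.Icc 1 (M - 1),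
          ζ ^ (-((a : ℤ) * j)) * (1 - ζ ^ j) * Lambda d ξ (w j) z₀ (-1) q) ∧
    (Even a → Odd M →
      AppellLerchGeneric (q ^ ((d : ℤ) ^ 2 * M * ((a : ℤ) - M))) (q ^ (2 * d ^ 2 * M ^ 2)) z' →
      AppellLerchGeneric (q ^ ((d : ℤ) ^ 2 * M * ((a : ℤ) - 1))) (q ^ (2 * d ^ 2 * M ^ 2)) z'' →
      PsiGeneric ((2 * M - a) / 2) M (q ^ d ^ 2) (-1) z' (q ^ (2 * d ^ 2)) →
      PsiGeneric ((M + 1 - a) / 2) M (q ^ d ^ 2) (-1) z'' (q ^ (2 * d ^ 2)) →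
      dev d a M q + dev d (a - 1) M q =
        2 * (-1) ^ (a / 2) * q ^ (-((d : ℤ) ^ 2 * ((2 * (M : ℤ) - a) / 2) ^ 2)) *
          appellLerch (q ^ ((d : ℤ) ^ 2 * M * ((a : ℤ) - M))) (q ^ (2 * d ^ 2 * M ^ 2)) z'
        + 2 * (-1) ^ ((M + 1 - a) / 2) *
          q ^ (-((d : ℤ) ^ 2 * (((M : ℤ) + 1 - a) / 2) ^ 2)) *
          appellLerch (q ^ ((d : ℤ) ^ 2 * M * ((a : ℤ) - 1))) (q ^ (2 * d ^ 2 * M ^ 2)) z''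
        - 2 * Psi ((2 * M - a) / 2) M (q ^ d ^ 2) (-1) z' (q ^ (2 * d ^ 2))
        + 2 * Psi ((M + 1 - a) / 2) M (q ^ d ^ 2) (-1) z'' (q ^ (2 * d ^ 2))
        + 2 / (M : ℂ) * ∑ j ∈ Finset.Icc 1 (M - 1),
          ζ ^ (-((a : ℤ) * j)) * (1 - ζ ^ j) * Lambda d ξ (w j) z₀ (-1) q) ∧
    (Odd a → Odd M →
      AppellLerchGeneric (q ^ (d ^ 2 * M * a)) (q ^ (2 * d ^ 2 * M ^ 2)) z' →
      AppellLerchGeneric (q ^ ((d : ℤ) ^ 2 * M * ((a : ℤ) - M - 1)))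
        (q ^ (2 * d ^ 2 * M ^ 2)) z'' →
      PsiGeneric ((M - a) / 2) M (q ^ d ^ 2) (-1) z' (q ^ (2 * d ^ 2)) →
      PsiGeneric ((2 * M + 1 - a) / 2) M (q ^ d ^ 2) (-1) z'' (q ^ (2 * d ^ 2)) →
      dev d a M q + dev d (a - 1) M q =
        (if a = M then 1 else 0)
        - 2 * (-1) ^ ((M - a) / 2) * q ^ (-((d : ℤ) ^ 2 * (((M : ℤ) - a) / 2) ^ 2)) *
          appellLerch (q ^ (d ^ 2 * M * a)) (q ^ (2 * d ^ 2 * M ^ 2)) z'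
        + 2 * (-1) ^ ((a + 1) / 2) *
          q ^ (-((d : ℤ) ^ 2 * ((2 * (M : ℤ) - a + 1) / 2) ^ 2)) *
          appellLerch (q ^ ((d : ℤ) ^ 2 * M * ((a : ℤ) - M - 1)))
            (q ^ (2 * d ^ 2 * M ^ 2)) z''
        - 2 * Psi ((M - a) / 2) M (q ^ d ^ 2) (-1) z' (q ^ (2 * d ^ 2))
        + 2 * Psi ((2 * M + 1 - a) / 2) M (q ^ d ^ 2) (-1) z'' (q ^ (2 * d ^ 2))
        + 2 / (M : ℂ) * ∑ j ∈ Finset.Icc 1 (M - 1),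
          ζ ^ (-((a : ℤ) * j)) * (1 - ζ ^ j) * Lambda d ξ (w j) z₀ (-1) q) := by
  have hM0 : M ≠ 0 := by omega
  have hM' : (M : ℂ) ≠ 0 := Nat.cast_ne_zero.mpr hM0
  have hd0 : d ≠ 0 := hd.pos.ne'
  have hdev := dev_add_dev_eq_lambda hd ha haM hζ hq hq1 hξ hw hz₀ hΛ
  refine ⟨summable_devCoeff hd0 hM0 hζ hq1 a, summable_devCoeff hd0 hM0 hζ hq1 _, ?_, ?_, ?_⟩
  · intro ha2 hM2 _ hg
    obtain ⟨n, rfl⟩ := even_iff_two_dvd.mp hM2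
    obtain ⟨k, rfl⟩ : ∃ k, a = 2 * k + 2 := by
      obtain ⟨c, rfl⟩ := even_iff_two_dvd.mp ha2
      exact ⟨c - 1, by omega⟩
    have hn0 : n ≠ 0 := by omega
    have ek : (2 * k + 2) / 2 - 1 = k := by omega
    have en : 2 * n / 2 = n := by omega
    rw [ek, en] at hg
    have h1 := lerchTransform_even hζ hd0 hq hq1 (by omega) hz' hg
    have h2 := lerchTransform_even_odd (d := d) (k := k) (q := q) hζ hn0
    have ec : ((2 * k + 2 : ℕ) : ℤ) = 2 * k + 2 := by push_cast; ring
    have ec1 : ((2 * k + 2 : ℕ) : ℤ) - 1 = 2 * k + 1 := by push_cast; ring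
    rw [hdev, ec1, ec, h1, h2, ek, en]
    have e1 : (d : ℤ) ^ 2 * (2 * (k : ℤ) + 2) ^ 2 / 4 = (d : ℤ) ^ 2 * ((k : ℤ) + 1) ^ 2 := by
      rw [show (d : ℤ) ^ 2 * (2 * (k : ℤ) + 2) ^ 2 = (d : ℤ) ^ 2 * ((k : ℤ) + 1) ^ 2 * 4 by ring]
      exact Int.mul_ediv_cancel _ four_ne_zero
    have e2 : ((2 * n : ℕ) : ℤ) ^ 2 / 4 - (2 * (k : ℤ) + 2) * (2 * n : ℕ) / 2 =
        (n : ℤ) ^ 2 - 2 * (k + 1) * n := by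
      push_cast
      rw [show (2 * (n : ℤ)) ^ 2 = (n : ℤ) ^ 2 * 4 by ring,
        show (2 * (k : ℤ) + 2) * (2 * n) = 2 * (k + 1) * n * 2 by ring,
        Int.mul_ediv_cancel _ four_ne_zero, Int.mul_ediv_cancel _ two_ne_zero]
    have e3 : d ^ 2 * (2 * n) ^ 2 / 2 = 2 * d ^ 2 * n ^ 2 := by
      rw [show d ^ 2 * (2 * n) ^ 2 = 2 * d ^ 2 * n ^ 2 * 2 by ring]
      exact Nat.mul_div_cancel _ two_pos
    have e4 : (2 * k + 2) / 2 = k + 1 := by omega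
    rw [e1, e2, e3, e4]
    generalize ∑ j ∈ Finset.Icc 1 (2 * n - 1), (_ : ℂ) = S
    generalize appellLerch _ _ z' = A
    generalize Psi k n _ _ z' _ = P
    have hn' : (n : ℂ) ≠ 0 := Nat.cast_ne_zero.mpr hn0
    push_cast
    field_simp
    ring
  · intro ha2 hM2 _ _ hg1 hg2
    obtain ⟨m, hm⟩ := id hM2
    obtain ⟨c, rfl⟩ := even_iff_two_dvd.mp ha2
    have ek1 : (2 * M - 2 * c) / 2 = M - c := by omega
    have ek2 : (M + 1 - 2 * c) / 2 = m + 1 - c := by omega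
    rw [ek1] at hg1
    rw [ek2] at hg2
    have c1 : ((M - c : ℕ) : ℤ) = M - c := by omega
    have c2 : ((m + 1 - c : ℕ) : ℤ) = m + 1 - c := by omega
    -- The indices solve b + 2k ≡ 0 modulo M: 2c + 2(M - c) = 2M for b = a, and (2c - 1) + 2(m + 1 -
    -- c) = M for b = a - 1.
    have h1 := lerchTransform_odd (b := (2 * c : ℕ)) hM2 hζ hd0 hq hq1 (by omega)
      ⟨2, by rw [c1]; push_cast; ring⟩ hz' hg1
    have h2 := lerchTransform_odd (b := (2 * c : ℕ) - 1) hM2 hζ hd0 hq hq1 (by omega)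
      ⟨1, by rw [c2, hm]; push_cast; ring⟩ hz'' hg2
    have hne : 2 * c ≠ M := by omega
    have z1 : (2 * (M : ℤ) - (2 * c : ℕ)) / 2 = M - c := by omega
    have z2 : ((M : ℤ) + 1 - (2 * c : ℕ)) / 2 = m + 1 - c := by omega
    have x1 : (M : ℤ) - 2 * (M - c) = (2 * c : ℕ) - M := by push_cast; ring
    have x2 : (M : ℤ) - 2 * (m + 1 - c) = (2 * c : ℕ) - 1 := by rw [hm]; push_cast; ring
    -- As M is odd, this sign cancels the minus sign in front of the transform for a.
    have s1 : (-1 : ℂ) ^ (M - c) = -(-1) ^ c := by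
      have h : (-1 : ℂ) ^ (M - c) * (-1) ^ c = -1 := by
        rw [← pow_add, Nat.sub_add_cancel (by omega), hM2.neg_one_pow]
      have h' : (-1 : ℂ) ^ c * (-1) ^ c = 1 := by rw [← mul_pow]; simp
      linear_combination (-1) ^ c * h - (-1) ^ (M - c) * h'
    rw [hdev, h1, h2, if_neg hne, ek1, ek2, c1, c2, z1, z2, x1, x2, s1,
      show 2 * c / 2 = c by omega]
    generalize ∑ j ∈ Finset.Icc 1 (M - 1), (_ : ℂ) = S
    field_simp
    ring
  · intro ha2 hM2 _ _ hg1 hg2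
    obtain ⟨m, hm⟩ := id hM2
    obtain ⟨c, rfl⟩ := ha2
    have ek1 : (M - (2 * c + 1)) / 2 = m - c := by omega
    have ek2 : (2 * M + 1 - (2 * c + 1)) / 2 = M - c := by omega
    rw [ek1] at hg1
    rw [ek2] at hg2
    have c1 : ((m - c : ℕ) : ℤ) = m - c := by omega
    have c2 : ((M - c : ℕ) : ℤ) = M - c := by omega
    -- Now (2c + 1) + 2(m - c) = M for b = a, and 2c + 2(M - c) = 2M for b = a - 1.
    have h1 := lerchTransform_odd (b := (2 * c + 1 : ℕ)) hM2 hζ hd0 hq hq1 (by omega)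
      ⟨1, by rw [c1, hm]; push_cast; ring⟩ hz' hg1
    have h2 := lerchTransform_odd (b := (2 * c + 1 : ℕ) - 1) hM2 hζ hd0 hq hq1 (by omega)
      ⟨2, by rw [c2]; push_cast; ring⟩ hz'' hg2
    have z1 : ((M : ℤ) - (2 * c + 1 : ℕ)) / 2 = m - c := by omega
    have z2 : (2 * (M : ℤ) - (2 * c + 1 : ℕ) + 1) / 2 = M - c := by omega
    have x1 : q ^ (d ^ 2 * M * (2 * c + 1)) = q ^ ((d : ℤ) ^ 2 * M * (M - 2 * (m - c))) := by
      rw [← zpow_natCast, show (M : ℤ) - 2 * (m - c) = 2 * c + 1 by rw [hm]; push_cast; ring]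
      push_cast; rfl
    have x2 : (M : ℤ) - 2 * (M - c) = (2 * c + 1 : ℕ) - M - 1 := by push_cast; ring
    have s2 : (-1 : ℂ) ^ (M - c) = (-1) ^ (c + 1) := by
      have h : (-1 : ℂ) ^ (M - c) * (-1) ^ c = -1 := by
        rw [← pow_add, Nat.sub_add_cancel (by omega), hM2.neg_one_pow]
      have h' : (-1 : ℂ) ^ c * (-1) ^ c = 1 := by rw [← mul_pow]; simp
      linear_combination (-1) ^ c * h - (-1) ^ (M - c) * h'
    rw [hdev, h1, h2, ek1, ek2, c1, c2, z1, z2, x1, x2, s2,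
      show (2 * c + 1 + 1) / 2 = c + 1 by omega]
    generalize ∑ j ∈ Finset.Icc 1 (M - 1), (_ : ℂ) = S
    generalize (if 2 * c + 1 = M then (1 : ℂ) else 0) = D
    field_simp
    ring
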